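/- Let $\mathbb T=\mathbb R/\mathbb Z$, $I=(0,1)$, $Q=\mathbb T\times I$, with variables $t\in\mathbb T$, $x\in I$; all functions are real valued. For $s\ge 0$ let $D^s$ and $D^s_*$ be the fractional time derivatives on $Q$ with Fourier multipliers $(2\pi i k)^s$ (principal branch) and $\overline{(2\pi i k)^s}$, $k\in\mathbb Z$. Let $H^{1/2,1}(Q)=\{u\in L^2(Q): D^{1/2}u,\,u_x\in L^2(Q)\}$ with norm $(\|u\|^2+\|D^{1/2}u\|^2+\|u_x\|^2)^{1/2}$ (norms in $L^2(Q)$), let $H=H^{1/2,1}_0(Q)$ be the closure in it of the smooth functions with compact support in $\mathbb T\times I$, and let $H^*$ be its dual. Let $H^{1,2}_N$ be the set of $u\in L^2(Q)$ with $u_t,u_x,u_{xx}\in L^2(Q)$ and $u_x=0$ (in the sense of traces) at $x=0$ and $x=1$, and let $H^{1,2}_{N+}$ be the set of those $u\in H^{1,2}_N$ whose continuous representative is positive on $\mathbb T\times[0,1]$. Fix $\mu>0$ and $v\in H$. Define $T:H\to H^*$ by $$\langle T(u),\chi\rangle=(D^{1/2}u,D^{1/2}_*\chi)+\mu(u_x,\chi_x)-\tfrac12(u^2,\chi_x),\qquad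 \chi\in H,$$ with $(\cdot,\cdot)$ the scalar product of $L^2(Q)$, and let $(vw)_x\in H^*$ be given by $\langle (vw)_x,\chi\rangle=-(vw,\chi_x)$. Put - $S_1=\{w\in H:\ T(w)=-(vw)_x \text{ in } H^*\}$; - $S_2$ = the set of pairs $([W],K)$, with $[W]\in H^{1,2}_N/\mathbb R$ a class modulo additive constants and $K\in\mathbb R$, such that $W_t-\mu W_{xx}+\frac12 (W_x)^2=-vW_x+K$ a.e. in $Q$; - $S_3$ = the set of pairs $([\varphi],K)$, with $[\varphi]\in H^{1,2}_{N+}/\mathbb R_+$ a class modulo positive scalar factors and $K\in\mathbb R$, such that $\varphi_t-\mu\varphi_{xx}+v\varphi_x+K\varphi=0$ a.e. in $Q$. Then $S_1$, $S_2$ and $S_3$ have the same cardinality. More precisely, there are bijections $\Phi_{21}:S_1\to S_2$ and $\Phi_{32}:S_2\to S_3$ such that: - for $w\in S_1$, $\Phi_{21}(w)=([W],K)$ is the unique element of $S_2$ with $W_x=w$, and $W(t,x)=\int_0^x w(t,y)\,dy-h(t)$ a.e. for some $h\in L^2(\mathbb T)$; - $\Phi_{32}([W],K)=\bigl([e^{-W/(2\mu)}],\,K/(2\mu)\bigr)$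 for every $([W],K)\in S_2$. Hence the Cole–Hopf transformation $\Phi=\Phi_{32}\circ\Phi_{21}$ is a bijection from $S_1$ to $S_3$. -/

import Mathlib

open MeasureTheory Set
open scoped ContDiff

noncomputable section

namespace Burgers

/-- The measure `dt dx` on `Q = 𝕋 × I`, where `𝕋 = ℝ/ℤ` and `I = (0,1)`. -/
def measQ : Measure (UnitAddCircle × ℝ) :=
  (volume : Measure UnitAddCircle).prod ((volume : Measure ℝ).restrict (Ioo 0 1))

/-- The real Hilbert space `L²(Q)`. -/
abbrev L2 : Type := Lp ℝ 2 measQ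

/-- Test functions in `𝒟(𝕋 × I)`: smooth, `1`-periodic in time, compactly supported in `𝕋 × I`. -/
structure IsTest (φ : UnitAddCircle × ℝ → ℝ) : Prop where
  smooth : ContDiff ℝ ∞ (fun p : ℝ × ℝ => φ ((p.1 : UnitAddCircle), p.2))
  compact_support : ∃ a b : ℝ, 0 < a ∧ b < 1 ∧ ∀ t x, x ∉ Icc a b → φ (t, x) = 0

/-! ### Derivatives -/

/-- `b = u_x` in the sense of distributions on `Q`. -/
def HasDx (u b : L2) : Prop :=
  ∀ φ : UnitAddCircle × ℝ → ℝ, IsTest φ →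
    ∫ p, u p * deriv (fun y => φ (p.1, y)) p.2 ∂measQ = - ∫ p, b p * φ p ∂measQ

/-- The time Fourier coefficient `u_k(x) = ∫_𝕋 u(t,x) exp(-2πikt) dt`. -/
def timeCoeff (u : UnitAddCircle × ℝ → ℝ) (k : ℤ) (x : ℝ) : ℂ :=
  fourierCoeff (T := 1) (fun t => (u (t, x) : ℂ)) k

/-- The multiplier `(2πik)^s` of the fractional derivative (principal branch). -/
def fracSymbol (s : ℝ) (k : ℤ) : ℂ := (2 * Real.pi * Complex.I * k) ^ (s : ℂ)

/-- `a = D^s u`, the fractional time derivative of order `s`. -/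
def HasFracDeriv (s : ℝ) (u a : L2) : Prop :=
  ∀ k : ℤ, ∀ᵐ x ∂(volume.restrict (Ioo (0 : ℝ) 1)),
    timeCoeff a k x = fracSymbol s k * timeCoeff u k x

/-- `a = D^s_* u`, the adjoint fractional time derivative of order `s`
(conjugate multiplier). -/
def HasFracDerivAdj (s : ℝ) (u a : L2) : Prop :=
  ∀ k : ℤ, ∀ᵐ x ∂(volume.restrict (Ioo (0 : ℝ) 1)),
    timeCoeff a k x = (starRingEnd ℂ) (fracSymbol s k) * timeCoeff u k x

open Classical in
/-- The weak derivative `u_x` (`0` if it does not exist in `L²(Q)`). -/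
def dx (u : L2) : L2 := if h : ∃ b, HasDx u b then h.choose else 0

open Classical in
/-- `D^s u` (`0` if it is not in `L²(Q)`). -/
def fracDeriv (s : ℝ) (u : L2) : L2 := if h : ∃ a, HasFracDeriv s u a then h.choose else 0

open Classical in
/-- `D^s_* u` (`0` if it is not in `L²(Q)`). -/
def fracDerivAdj (s : ℝ) (u : L2) : L2 :=
  if h : ∃ a, HasFracDerivAdj s u a then h.choose else 0

/-- The time derivative `u_t = D^1 u`. -/
def dt (u : L2) : L2 := fracDeriv 1 u

/-! ### Anisotropic Sobolev spaces -/

/-- `H^{1/2,1}(Q) = H^{1/2}(𝕋, L²(I)) ∩ L²(𝕋, H¹(I))`. -/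
def sobolevHalfOne : Set L2 :=
  {u | (∃ a, HasFracDeriv (1 / 2) u a) ∧ ∃ b, HasDx u b}

/-- The norm of `H^{1/2,1}(Q)`. -/
def normHalfOne (u : L2) : ℝ :=
  Real.sqrt (‖u‖ ^ 2 + ‖fracDeriv (1 / 2) u‖ ^ 2 + ‖dx u‖ ^ 2)

/-- `H^{1/2,1}_0(Q)`: the closure of the test functions `𝒟(Q)` in `H^{1/2,1}(Q)`. -/
def H : Set L2 :=
  {u | u ∈ sobolevHalfOne ∧ ∀ ε : ℝ, 0 < ε →
    ∃ f : L2, (∃ φ, IsTest φ ∧ f =ᵐ[measQ] φ) ∧ normHalfOne (u - f) < ε}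

/-- `H^{1,2}(Q) = H^1(𝕋, L²(I)) ∩ L²(𝕋, H²(I))`. -/
def sobolevOneTwo : Set L2 :=
  {u | (∃ a, HasFracDeriv 1 u a) ∧ ∃ b, HasDx u b ∧ ∃ c, HasDx b c}

/-- The trace of `p` at `x = x₀` vanishes, for `p, p_x ∈ L²(Q)`: for almost every `t`, the
absolutely continuous representative of `p(t,·)` takes the value `0` at `x₀`. -/
def ZeroTraceAt (x₀ : ℝ) (p : L2) : Prop :=
  ∀ᵐ q ∂measQ, p q = ∫ y in x₀..q.2, dx p (q.1, y)

/-- `H^{1,2}_N`: the functions in `H^{1,2}(Q)` with `u_x(t,0) = u_x(t,1) = 0`. -/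
def sobolevN : Set L2 :=
  {u | u ∈ sobolevOneTwo ∧ ZeroTraceAt 0 (dx u) ∧ ZeroTraceAt 1 (dx u)}

/-- `H^{1,2}_{N+}`: the functions in `H^{1,2}_N` whose continuous representative is positive on
the closure `𝕋 × [0,1]` of `Q`. -/
def sobolevNPos : Set L2 :=
  {u | u ∈ sobolevN ∧ ∃ f : UnitAddCircle × ℝ → ℝ, ContinuousOn f (univ ×ˢ Icc 0 1) ∧
    (∀ p ∈ (univ ×ˢ Icc 0 1 : Set (UnitAddCircle × ℝ)), 0 < f p) ∧ u =ᵐ[measQ] f}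

/-- Equality up to an additive real constant. -/
def additiveSetoid : Setoid sobolevN where
  r U W := ∃ c : ℝ, (W : L2) =ᵐ[measQ] fun p => (U : L2) p + c
  iseqv :=
    { refl := fun U => ⟨0, by simp⟩
      symm := by
        rintro U W ⟨c, hc⟩
        refine ⟨-c, ?_⟩
        filter_upwards [hc] with p hp
        rw [hp]; ring
      trans := by
        rintro U V W ⟨c, hc⟩ ⟨d, hd⟩
        refine ⟨c + d, ?_⟩
        filter_upwards [hc, hd] with p hp hq
        rw [hq, hp]; ring }

/-- Equality up to a positive scalar factor. -/
def multiplicativeSetoid : Setoid sobolevNPos where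
  r φ ψ := ∃ η : ℝ, 0 < η ∧ (ψ : L2) = η • (φ : L2)
  iseqv :=
    { refl := fun φ => ⟨1, one_pos, by simp⟩
      symm := by
        rintro φ ψ ⟨η, hη, h⟩
        refine ⟨η⁻¹, inv_pos.mpr hη, ?_⟩
        rw [h, smul_smul, inv_mul_cancel₀ hη.ne', one_smul]
      trans := by
        rintro φ ψ χ ⟨η, hη, h⟩ ⟨θ, hθ, h'⟩
        exact ⟨θ * η, mul_pos hθ hη, by rw [h', h, smul_smul]⟩ }

/-- `H^{1,2}_N / ℝ`. -/
abbrev NModConst : Type := Quotient additiveSetoid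

/-- `H^{1,2}_{N+} / ℝ₊`. -/
abbrev NPosModScalars : Type := Quotient multiplicativeSetoid

/-- The class `[W]` in `H^{1,2}_N / ℝ`. -/
def classN (W : sobolevN) : NModConst := Quotient.mk additiveSetoid W

/-- The class `[φ]` in `H^{1,2}_{N+} / ℝ₊`. -/
def classNPos (φ : sobolevNPos) : NPosModScalars := Quotient.mk multiplicativeSetoid φ

/-! ### The Burgers operator -/

/-- `⟨ℒ u, χ⟩ = (D^{1/2} u, D^{1/2}_* χ) + μ (u_x, χ_x)`. -/
def linOp (μ : ℝ) (u χ : L2) : ℝ :=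
  inner ℝ (fracDeriv (1 / 2) u) (fracDerivAdj (1 / 2) χ) + μ * inner ℝ (dx u) (dx χ)

/-- `⟨S u, χ⟩ = -½ (u², χ_x)`. -/
def nonlinOp (u χ : L2) : ℝ := -(1 / 2) * ∫ p, (u p) ^ 2 * dx χ p ∂measQ

/-- The Burgers operator `T = ℒ + S`, as the pairing `⟨T u, χ⟩` with `χ` in `H^{1/2,1}_0(Q)`. -/
def burgersOp (μ : ℝ) (u χ : L2) : ℝ := linOp μ u χ + nonlinOp u χ

/-- The pairing `⟨(vw)_x, χ⟩ = -(vw, χ_x)`. -/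
def dxMul (v w χ : L2) : ℝ := - ∫ p, v p * w p * dx χ p ∂measQ

/-! ### The three solution sets -/

/-- `S₁`: the `w ∈ H^{1/2,1}_0(Q)` with `T(w) = -(vw)_x` in the dual of `H^{1/2,1}_0(Q)`. -/
def S1 (μ : ℝ) (v : L2) : Set L2 :=
  {w | w ∈ H ∧ ∀ χ ∈ H, burgersOp μ w χ = - dxMul v w χ}

/-- `S₂`: the pairs `([W], K)` with `W_t - μ W_xx + ½ (W_x)² = -v W_x + K`. -/
def S2 (μ : ℝ) (v : L2) : Set (NModConst × ℝ) :=
  {P | ∃ W : sobolevN, classN W = P.1 ∧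
    ∀ᵐ p ∂measQ, dt W p - μ * dx (dx W) p + 1 / 2 * (dx W p) ^ 2 = - (v p * dx W p) + P.2}

/-- `S₃`: the pairs `([φ], K)` with `φ_t - μ φ_xx + v φ_x + K φ = 0`. -/
def S3 (μ : ℝ) (v : L2) : Set (NPosModScalars × ℝ) :=
  {P | ∃ φ : sobolevNPos, classNPos φ = P.1 ∧
    ∀ᵐ p ∂measQ, dt φ p - μ * dx (dx φ) p + v p * dx φ p + P.2 * (φ : L2) p = 0}

end Burgers

end

/-!
The proof works with double Fourier series: a function on `Q` is expanded into `e^{2πikt} γ_n(x)`,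
where `γ` is either the cosine system (`cosB`) or the sine system (`sinB`) on `(0,1)`. Both systems
are complete, so real functions in `L²(Q)` correspond to square summable coefficients with a
conjugation symmetry (`L2.ext_coef`, `exists_coef_eq`), and every space in the statement is
described by its coefficients. The weak derivative `u_x` is the passage from cosine to sine
coefficients (`hasDx_iff`); functions vanishing at `x = 0` and `x = 1` are those for which the
passage from sine to cosine coefficients is also the derivative (`CoefDxZero`). The space
`H^{1/2,1}_0(Q)` is a weighted `ℓ²` space of sine coefficients (`mem_H_of_summable`,
`summable_sinWeight_of_mem_H`), and `H^{1,2}_N(Q)` one of cosine coefficients (`HasDerivs`,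
`hasDerivs_of_mem_sobolevN`, `HasDerivs.mem_sobolevN`).

Two analytic facts are needed. First, `H^{1/2,1}_0(Q)` embeds into `L⁴(Q)`
(`memLp_four_of_mem_H`), which makes the flux `G = μ w_x - w²/2 - v w` square integrable; this is
an estimate of the quadruple sum that computes the `L⁴` norm of a trigonometric polynomial, with
weights `1 + |k| + m²` whose inverse squares are summable over `ℤ²`. Second, the chain rule holds
in `H^{1,2}_N(Q)` (`HasDerivs.comp`), since the partial sums converge uniformly there and the
squares of their `x`-derivatives converge in `L²(Q)`, again by the `L⁴` estimate.

The equation defining `S₁` says `w_t = G_x` in the dual of `H^{1/2,1}_0(Q)`. Testing it with single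
sine modes turns it into a relation between the sine coefficients of `w` and the cosine coefficients
of `G` (`residual_eq_zero_iff`). This relation says exactly that the time derivative of the
primitive `W` of `w` and the flux `G` have the same coefficients on all modes that are not constant
in `x`. The remaining coefficients of `W`, for the modes `e^{2πikt}` with `k ≠ 0`, are fixed by
`W_t = G + K`, and the mean value of this equation fixes `K`, so that only the mean value of `W` is
free (`exists_potential`, `potential_unique`). Since `W_x` lies in `H^{1/2,1}_0(Q)` for every `W` in
`H^{1,2}_N(Q)`, the map `W ↦ W_x` inverts this construction (`mem_S1_of_isPotential`).

The map to `S₃` is the chain rule for `exp(-W/2μ)`: the linear equation is the integrated equation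
multiplied by `-exp(-W/2μ)/2μ` (`exists_exp`). Its inverse `-2μ log φ` is covered by the chain rule
because the continuous representative of `φ` is bounded below by a positive constant on the compact
set `𝕋 × [0,1]`, so that the logarithm may be replaced by a `C²` function on `ℝ` (`exists_log`).
-/

noncomputable section

namespace Burgers

open Filter Topology

variable {γ : ℕ → ℝ → ℝ}

/-! ### The sine and cosine systems on `(0,1)` -/

theorem integrableOn_ofReal_mul {f : ℝ → ℝ} (hf : Continuous f) {g : ℝ → ℂ}
    (hg : IntegrableOn g (Ioo 0 1)) : IntegrableOn (fun x => (f x : ℂ) * g x) (Ioo 0 1) := by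
  have h1 : IntegrableOn g (Icc 0 1) := by rwa [integrableOn_Icc_iff_integrableOn_Ioo]
  exact (h1.continuousOn_mul (g' := g) (g := fun x => (f x : ℂ))
    (by fun_prop) isCompact_Icc).mono_set Ioo_subset_Icc_self

/-- An `L¹` function on `(0,1)` that is orthogonal to all `cos (nπx)` vanishes. -/
theorem ae_eq_zero_of_integral_cos {g : ℝ → ℂ} (hg : IntegrableOn g (Ioo 0 1))
    (h : ∀ n : ℕ, ∫ x in Ioo (0 : ℝ) 1, (Real.cos (n * Real.pi * x) : ℂ) * g x = 0) :
    g =ᵐ[volume.restrict (Ioo 0 1)] 0 := by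
  have hI := fun (f : ℝ → ℝ) hf => integrableOn_ofReal_mul (f := f) hf hg
  -- products with powers of `cos (πx)` are again combinations of the `cos (nπx)`
  have hpow : ∀ m n : ℕ, ∫ x in Ioo (0 : ℝ) 1,
      (((Real.cos (Real.pi * x)) ^ m * Real.cos (n * Real.pi * x) : ℝ) : ℂ) * g x = 0 := by
    intro m
    induction m with
    | zero => intro n; simpa using h n
    | succ m ih =>
      intro n
      cases n with
      | zero =>
        have := ih 1
        simp only [Nat.cast_zero, Nat.cast_one, zero_mul, one_mul, Real.cos_zero, mul_one] at this ⊢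
        simpa [pow_succ] using this
      | succ n =>
        have e : ∀ x : ℝ, (((Real.cos (Real.pi * x)) ^ (m + 1) *
            Real.cos ((n + 1 : ℕ) * Real.pi * x) : ℝ) : ℂ) * g x =
            (1 / 2 : ℂ) * ((((Real.cos (Real.pi * x)) ^ m *
              Real.cos ((n + 2 : ℕ) * Real.pi * x) : ℝ) : ℂ) * g x) +
            (1 / 2 : ℂ) * ((((Real.cos (Real.pi * x)) ^ m *
              Real.cos (n * Real.pi * x) : ℝ) : ℂ) * g x) := by
          intro x
          have e1 : Real.cos ((n + 2 : ℕ) * Real.pi * x) + Real.cos (n * Real.pi * x) =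
              2 * Real.cos (Real.pi * x) * Real.cos ((n + 1 : ℕ) * Real.pi * x) := by
            rw [Real.cos_add_cos]
            push_cast
            rw [show ((n + 2) * Real.pi * x + n * Real.pi * x) / 2 = (n + 1) * Real.pi * x by ring,
              show ((n + 2) * Real.pi * x - n * Real.pi * x) / 2 = Real.pi * x by ring]
            ring
          have e2 : (Real.cos (Real.pi * x)) ^ (m + 1) * Real.cos ((n + 1 : ℕ) * Real.pi * x) =
            1 / 2 * ((Real.cos (Real.pi * x)) ^ m * Real.cos ((n + 2 : ℕ) * Real.pi * x)) +
            1 / 2 * ((Real.cos (Real.pi * x)) ^ m * Real.cos (n * Real.pi * x)) := by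
            linear_combination (-1 / 2 * (Real.cos (Real.pi * x)) ^ m) * e1
          rw [e2]; push_cast; ring
        simp_rw [e]
        rw [integral_add, integral_const_mul, integral_const_mul, ih, ih]
        · simp
        · exact (hI _ (by fun_prop)).const_mul _
        · exact (hI _ (by fun_prop)).const_mul _
  have hpoly : ∀ P : Polynomial ℝ, ∫ x in Ioo (0 : ℝ) 1,
      ((P.eval (Real.cos (Real.pi * x)) : ℝ) : ℂ) * g x = 0 := by
    intro P
    induction P using Polynomial.induction_on' with
    | add p q hp hq =>
      simp only [Polynomial.eval_add, Complex.ofReal_add, add_mul]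
      rw [integral_add (hI _ (by fun_prop)) (hI _ (by fun_prop)), hp, hq, add_zero]
    | monomial m a =>
      have := hpow m 0
      simp only [Nat.cast_zero, zero_mul, Real.cos_zero, mul_one] at this
      simp only [Polynomial.eval_monomial, Complex.ofReal_mul, mul_assoc]
      rw [integral_const_mul, this, mul_zero]
  have key := isOpen_Ioo.ae_eq_zero_of_integral_contDiff_smul_eq_zero
    (U := Ioo (0 : ℝ) 1) (f := g) (μ := volume) hg.locallyIntegrableOn ?_
  · rw [Filter.EventuallyEq, ae_restrict_iff' measurableSet_Ioo]
    simpa using key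
  intro η hη _ hsupp
  have hout : ∀ x, x ∉ Ioo (0 : ℝ) 1 → η x = 0 := fun x hx => by
    by_contra hne
    exact hx (hsupp (subset_tsupport _ hne))
  rw [← setIntegral_eq_integral_of_forall_compl_eq_zero (s := Ioo (0 : ℝ) 1)
    (fun x hx => by rw [hout x hx, zero_smul])]
  -- a continuous `η` on `[0,1]` is a continuous function of `cos (πx)`
  have hbound : ∀ ε > 0, ‖∫ x in Ioo (0 : ℝ) 1, η x • g x‖
      ≤ ε * ∫ x in Ioo (0 : ℝ) 1, ‖g x‖ := by
    intro ε hε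
    obtain ⟨P, hP⟩ := exists_polynomial_near_of_continuousOn (-1) 1
      (fun y => η (Real.arccos y / Real.pi))
      (by have := hη.continuous; have := Real.continuous_arccos; fun_prop) ε hε
    have hI2 : IntegrableOn (fun x => η x • g x) (Ioo 0 1) := by
      simpa [Complex.real_smul] using hI η hη.continuous
    have e : ∫ x in Ioo (0 : ℝ) 1, η x • g x = ∫ x in Ioo (0 : ℝ) 1,
        (η x • g x - ((P.eval (Real.cos (Real.pi * x)) : ℝ) : ℂ) * g x) := by
      rw [integral_sub hI2 (hI _ (by fun_prop)), hpoly, sub_zero]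
    rw [e, ← integral_const_mul]
    refine norm_integral_le_of_norm_le (hg.norm.const_mul _) ?_
    filter_upwards [ae_restrict_mem measurableSet_Ioo] with x hx
    rw [Complex.real_smul, ← sub_mul, norm_mul]
    gcongr
    rw [← Complex.ofReal_sub, Complex.norm_real, Real.norm_eq_abs, abs_sub_comm]
    have := hP (Real.cos (Real.pi * x)) ⟨Real.neg_one_le_cos _, Real.cos_le_one _⟩
    rw [Real.arccos_cos (by have := hx.1; positivity)
      (by nlinarith [hx.2, Real.pi_pos]), mul_div_cancel_left₀ _ Real.pi_ne_zero] at this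
    exact this.le
  have hlim : Filter.Tendsto (fun ε : ℝ => ε * ∫ x in Ioo (0 : ℝ) 1, ‖g x‖)
      (nhdsWithin 0 (Ioi 0)) (nhds 0) := by
    have : Continuous (fun ε : ℝ => ε * ∫ x in Ioo (0 : ℝ) 1, ‖g x‖) := by fun_prop
    simpa using (this.tendsto 0).mono_left nhdsWithin_le_nhds
  have := ge_of_tendsto hlim (by
    filter_upwards [self_mem_nhdsWithin] with ε hε using hbound ε hε)
  exact norm_le_zero_iff.mp this

/-- Reduction of the sine system to the cosine system: multiply by `sin (πx)`. -/
theorem ae_eq_zero_of_integral_sin {g : ℝ → ℂ} (hg : IntegrableOn g (Ioo 0 1))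
    (h : ∀ n : ℕ, ∫ x in Ioo (0 : ℝ) 1, (Real.sin ((n + 1) * Real.pi * x) : ℂ) * g x = 0) :
    g =ᵐ[volume.restrict (Ioo 0 1)] 0 := by
  have hI := fun (f : ℝ → ℝ) hf => integrableOn_ofReal_mul (f := f) hf hg
  have h' : ∀ n : ℕ, ∫ x in Ioo (0 : ℝ) 1, (Real.sin (n * Real.pi * x) : ℂ) * g x = 0 := by
    intro n
    cases n with
    | zero => simp
    | succ n => simpa using h n
  have := ae_eq_zero_of_integral_cos (g := fun x => (Real.sin (Real.pi * x) : ℂ) * g x)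
    (hI _ (by fun_prop)) ?_
  · filter_upwards [this, ae_restrict_mem measurableSet_Ioo] with x hx hx'
    have hs : 0 < Real.sin (Real.pi * x) := Real.sin_pos_of_pos_of_lt_pi
      (by have := hx'.1; positivity) (by nlinarith [hx'.2, Real.pi_pos])
    simpa [hs.ne', -Complex.ofReal_sin] using hx
  intro n
  cases n with
  | zero => simpa using h 0
  | succ n =>
    have e : ∀ x : ℝ, (Real.cos ((n + 1 : ℕ) * Real.pi * x) : ℂ) *
        ((Real.sin (Real.pi * x) : ℂ) * g x) =
        (1 / 2 : ℂ) * ((Real.sin ((n + 2 : ℕ) * Real.pi * x) : ℂ) * g x) -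
        (1 / 2 : ℂ) * ((Real.sin (n * Real.pi * x) : ℂ) * g x) := by
      intro x
      have e1 : Real.sin ((n + 2 : ℕ) * Real.pi * x) - Real.sin (n * Real.pi * x) =
          2 * Real.sin (Real.pi * x) * Real.cos ((n + 1 : ℕ) * Real.pi * x) := by
        rw [Real.sin_sub_sin]
        push_cast
        rw [show ((n + 2) * Real.pi * x + n * Real.pi * x) / 2 = (n + 1) * Real.pi * x by ring,
          show ((n + 2) * Real.pi * x - n * Real.pi * x) / 2 = Real.pi * x by ring]
      have e2 := congrArg (fun r : ℝ => (r : ℂ)) e1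
      simp only [Complex.ofReal_sub, Complex.ofReal_mul, Complex.ofReal_ofNat] at e2
      linear_combination (-1 / 2 * g x) * e2
    simp_rw [e]
    rw [integral_sub, integral_const_mul, integral_const_mul, h', h']
    · simp
    · exact (hI _ (by fun_prop)).const_mul _
    · exact (hI _ (by fun_prop)).const_mul _

/-- An orthonormal system of bounded continuous functions on `(0,1)` that is total in the strong
sense that an `L¹` function orthogonal to it vanishes. -/
structure IsXBasis (γ : ℕ → ℝ → ℝ) : Prop where
  continuous : ∀ n, Continuous (γ n)
  bound : ∀ n x, |γ n x| ≤ 2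
  orthonormal : ∀ n m, ∫ x in Ioo (0 : ℝ) 1, γ n x * γ m x = if n = m then 1 else 0
  complete : ∀ g : ℝ → ℂ, IntegrableOn g (Ioo 0 1) →
    (∀ n, ∫ x in Ioo (0 : ℝ) 1, (γ n x : ℂ) * g x = 0) → g =ᵐ[volume.restrict (Ioo 0 1)] 0

/-- The orthonormal cosine system `1, √2 cos (πx), √2 cos (2πx), …`. -/
def cosB (n : ℕ) (x : ℝ) : ℝ := if n = 0 then 1 else √2 * Real.cos (n * Real.pi * x)

/-- The orthonormal sine system `√2 sin (πx), √2 sin (2πx), …`, indexed from `0`. -/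
def sinB (n : ℕ) (x : ℝ) : ℝ := √2 * Real.sin ((n + 1) * Real.pi * x)

@[simp] theorem cosB_zero (x : ℝ) : cosB 0 x = 1 := by simp [cosB]

theorem cosB_succ (n : ℕ) (x : ℝ) : cosB (n + 1) x = √2 * Real.cos ((n + 1) * Real.pi * x) := by
  simp [cosB]

@[simp] theorem sinB_at_zero (n : ℕ) : sinB n 0 = 0 := by simp [sinB]

@[simp] theorem sinB_at_one (n : ℕ) : sinB n 1 = 0 := by
  have := Real.sin_nat_mul_pi (n + 1)
  push_cast at this
  simp [sinB, this]

theorem hasDerivAt_cosB_succ (n : ℕ) (x : ℝ) :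
    HasDerivAt (cosB (n + 1)) (-((n + 1) * Real.pi) * sinB n x) x := by
  have h1 : HasDerivAt (fun y : ℝ => (n + 1) * Real.pi * y) ((n + 1) * Real.pi) x := by
    simpa using (hasDerivAt_id x).const_mul ((n + 1) * Real.pi)
  have := (h1.cos).const_mul √2
  refine (this.congr_deriv ?_).congr_of_eventuallyEq (.of_forall fun y => cosB_succ n y)
  rw [sinB]; ring

theorem hasDerivAt_sinB (n : ℕ) (x : ℝ) :
    HasDerivAt (sinB n) ((n + 1) * Real.pi * cosB (n + 1) x) x := by
  have h1 : HasDerivAt (fun y : ℝ => (n + 1) * Real.pi * y) ((n + 1) * Real.pi) x := by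
    simpa using (hasDerivAt_id x).const_mul ((n + 1) * Real.pi)
  have := (h1.sin).const_mul √2
  refine (this.congr_deriv ?_).congr_of_eventuallyEq (.of_forall fun y => rfl)
  rw [cosB_succ]; ring

theorem continuous_cosB (n : ℕ) : Continuous (cosB n) := by
  cases n with
  | zero => simpa [funext cosB_zero] using continuous_const
  | succ n => exact continuous_iff_continuousAt.2 fun x => (hasDerivAt_cosB_succ n x).continuousAt

theorem continuous_sinB (n : ℕ) : Continuous (sinB n) :=
  continuous_iff_continuousAt.2 fun x => (hasDerivAt_sinB n x).continuousAt

theorem sqrt_two_le_two : √2 ≤ 2 := by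
  rw [Real.sqrt_le_left (by norm_num)]; norm_num

theorem abs_cosB_le (n : ℕ) (x : ℝ) : |cosB n x| ≤ 2 := by
  cases n with
  | zero => simp
  | succ n =>
    rw [cosB_succ, abs_mul, abs_of_nonneg (Real.sqrt_nonneg _)]
    nlinarith [Real.abs_cos_le_one ((n + 1) * Real.pi * x), sqrt_two_le_two, Real.sqrt_nonneg 2,
      abs_nonneg (Real.cos ((n + 1) * Real.pi * x))]

theorem abs_sinB_le (n : ℕ) (x : ℝ) : |sinB n x| ≤ 2 := by
  rw [sinB, abs_mul, abs_of_nonneg (Real.sqrt_nonneg _)]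
  nlinarith [Real.abs_sin_le_one ((n + 1) * Real.pi * x), sqrt_two_le_two, Real.sqrt_nonneg 2,
      abs_nonneg (Real.sin ((n + 1) * Real.pi * x))]

theorem integral_cos_int (m : ℤ) :
    ∫ x in Ioo (0 : ℝ) 1, Real.cos (m * Real.pi * x) = if m = 0 then 1 else 0 := by
  rw [← integral_Ioc_eq_integral_Ioo, ← intervalIntegral.integral_of_le zero_le_one]
  split_ifs with hm
  · simp [hm]
  · have hm' : (m : ℝ) * Real.pi ≠ 0 := by
      simp [hm, Real.pi_ne_zero]
    rw [intervalIntegral.integral_comp_mul_left (fun y => Real.cos y) hm']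
    simp [integral_cos, Real.sin_int_mul_pi]

theorem isXBasis_sinB : IsXBasis sinB where
  continuous := continuous_sinB
  bound := abs_sinB_le
  orthonormal n m := by
    have e : ∀ x : ℝ, sinB n x * sinB m x = Real.cos (((n - m : ℤ) : ℝ) * Real.pi * x)
        - Real.cos (((n + m + 2 : ℤ) : ℝ) * Real.pi * x) := by
      intro x
      have h2 : √2 * √2 = 2 := Real.mul_self_sqrt (by norm_num)
      rw [sinB, sinB, Real.cos_sub_cos]
      push_cast
      rw [show ((n - m : ℝ) * Real.pi * x + (n + m + 2) * Real.pi * x) / 2 =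
        (n + 1) * Real.pi * x by ring,
        show ((n - m : ℝ) * Real.pi * x - (n + m + 2) * Real.pi * x) / 2 =
        - ((m + 1) * Real.pi * x) by ring, Real.sin_neg]
      linear_combination Real.sin ((n + 1) * Real.pi * x) * Real.sin ((m + 1) * Real.pi * x) * h2
    simp_rw [e]
    have hi : ∀ k : ℤ, IntegrableOn (fun x : ℝ => Real.cos (k * Real.pi * x)) (Ioo 0 1) :=
      fun k => (Continuous.integrableOn_Icc (by fun_prop)).mono_set Ioo_subset_Icc_self
    rw [integral_sub (hi _) (hi _), integral_cos_int, integral_cos_int]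
    simp only [sub_eq_zero, Nat.cast_inj]
    rw [if_neg (c := (n + m + 2 : ℤ) = 0) (by omega), sub_zero]
  complete g hg h := by
    refine ae_eq_zero_of_integral_sin hg fun n => ?_
    have := h n
    simp only [sinB, Complex.ofReal_mul, mul_assoc] at this
    rw [integral_const_mul] at this
    simpa [mul_assoc] using this

theorem isXBasis_cosB : IsXBasis cosB where
  continuous := continuous_cosB
  bound := abs_cosB_le
  orthonormal n m := by
    have h2 : √2 * √2 = 2 := Real.mul_self_sqrt (by norm_num)
    have hi : ∀ k : ℤ, IntegrableOn (fun x : ℝ => Real.cos (k * Real.pi * x)) (Ioo 0 1) :=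
      fun k => (Continuous.integrableOn_Icc (by fun_prop)).mono_set Ioo_subset_Icc_self
    have h0 : ∀ n : ℕ, ∫ x in Ioo (0 : ℝ) 1, √2 * Real.cos ((n + 1) * Real.pi * x) = 0 := by
      intro n
      rw [integral_const_mul]
      have := integral_cos_int (n + 1)
      rw [if_neg (by omega)] at this
      push_cast at this
      rw [this, mul_zero]
    rcases n with _ | n <;> rcases m with _ | m
    · simp
    · simp [cosB_succ, h0]
    · simp [cosB_succ, h0]
    have e : ∀ x : ℝ, cosB (n + 1) x * cosB (m + 1) x =
        Real.cos (((n - m : ℤ) : ℝ) * Real.pi * x)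
        + Real.cos (((n + m + 2 : ℤ) : ℝ) * Real.pi * x) := by
      intro x
      rw [cosB_succ, cosB_succ, Real.cos_add_cos]
      push_cast
      rw [show ((n - m : ℝ) * Real.pi * x + (n + m + 2) * Real.pi * x) / 2 =
        (n + 1) * Real.pi * x by ring,
        show ((n - m : ℝ) * Real.pi * x - (n + m + 2) * Real.pi * x) / 2 =
        - ((m + 1) * Real.pi * x) by ring, Real.cos_neg]
      linear_combination Real.cos ((n + 1) * Real.pi * x) * Real.cos ((m + 1) * Real.pi * x) * h2
    simp_rw [e]
    rw [integral_add (hi _) (hi _), integral_cos_int, integral_cos_int]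
    simp only [sub_eq_zero, Nat.cast_inj, add_left_inj]
    rw [if_neg (c := (n + m + 2 : ℤ) = 0) (by omega), add_zero]
  complete g hg h := by
    refine ae_eq_zero_of_integral_cos hg fun n => ?_
    cases n with
    | zero => simpa using h 0
    | succ n =>
      have := h (n + 1)
      simp only [cosB_succ, Complex.ofReal_mul, mul_assoc] at this
      rw [integral_const_mul] at this
      simpa [mul_assoc] using this

/-! ### Double Fourier series on `Q` -/

/-- The complex Hilbert space `L²(Q; ℂ)`. -/
abbrev L2C : Type := Lp ℂ 2 measQ

instance : IsProbabilityMeasure (volume.restrict (Ioo (0 : ℝ) 1)) :=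
  ⟨by simp⟩

instance : IsProbabilityMeasure (volume : Measure UnitAddCircle) :=
  ⟨by simp [AddCircle.measure_univ]⟩

instance : IsProbabilityMeasure measQ := by
  unfold measQ; infer_instance

theorem volume_eq_haar : (volume : Measure UnitAddCircle) = AddCircle.haarAddCircle := by
  rw [AddCircle.volume_eq_smul_haarAddCircle]; simp

/-- The product function `e^{2πikt} γ_n(x)`, with `i = (k, n)`. -/
def modeFun (γ : ℕ → ℝ → ℝ) (i : ℤ × ℕ) (p : UnitAddCircle × ℝ) : ℂ :=
  fourier i.1 p.1 * (γ i.2 p.2 : ℂ)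

/-- The coefficient of `F` with respect to `modeFun γ i`. -/
def coefC (γ : ℕ → ℝ → ℝ) (F : UnitAddCircle × ℝ → ℂ) (i : ℤ × ℕ) : ℂ :=
  ∫ p, fourier (-i.1) p.1 * (γ i.2 p.2 : ℂ) * F p ∂measQ

/-- The coefficient of a real function `u` with respect to `modeFun γ i`. -/
def coef (γ : ℕ → ℝ → ℝ) (u : UnitAddCircle × ℝ → ℝ) (i : ℤ × ℕ) : ℂ :=
  coefC γ (fun p => (u p : ℂ)) i

theorem norm_fourier_apply (k : ℤ) (t : UnitAddCircle) : ‖(fourier k t : ℂ)‖ = 1 := by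
  rw [fourier_apply]; exact Circle.norm_coe _

theorem continuous_modeFun (hγ : IsXBasis γ) (i : ℤ × ℕ) : Continuous (modeFun γ i) := by
  have := hγ.continuous i.2
  unfold modeFun
  fun_prop

theorem norm_modeFun_le (hγ : IsXBasis γ) (i : ℤ × ℕ) (p : UnitAddCircle × ℝ) :
    ‖modeFun γ i p‖ ≤ 2 := by
  rw [modeFun, norm_mul, norm_fourier_apply, one_mul, Complex.norm_real]
  exact hγ.bound _ _

theorem memLp_modeFun (hγ : IsXBasis γ) (i : ℤ × ℕ) : MemLp (modeFun γ i) 2 measQ :=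
  MemLp.of_bound (continuous_modeFun hγ i).aestronglyMeasurable 2
    (.of_forall (norm_modeFun_le hγ i))

/-- The element `e^{2πikt} γ_n(x)` of `L²(Q; ℂ)`. -/
def mode (hγ : IsXBasis γ) (i : ℤ × ℕ) : L2C := (memLp_modeFun hγ i).toLp

theorem conj_modeFun (γ : ℕ → ℝ → ℝ) (i : ℤ × ℕ) (p : UnitAddCircle × ℝ) :
    (starRingEnd ℂ) (modeFun γ i p) = fourier (-i.1) p.1 * (γ i.2 p.2 : ℂ) := by
  rw [modeFun, map_mul, Complex.conj_ofReal, fourier_neg]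

theorem inner_mode (hγ : IsXBasis γ) (i : ℤ × ℕ) (F : L2C) :
    inner ℂ (mode hγ i) F = coefC γ F i := by
  rw [L2.inner_def, coefC]
  refine integral_congr_ae ?_
  filter_upwards [(memLp_modeFun hγ i).coeFn_toLp] with p hp
  rw [RCLike.inner_apply, mode, hp, conj_modeFun, mul_comm]

theorem coefC_mode (hγ : IsXBasis γ) (i j : ℤ × ℕ) :
    coefC γ (mode hγ j) i = if i = j then 1 else 0 := by
  have h1 : coefC γ (mode hγ j) i =
      ∫ p, (fourier (-i.1) p.1 * fourier j.1 p.1 : ℂ) *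
        ((γ i.2 p.2 * γ j.2 p.2 : ℝ) : ℂ) ∂measQ := by
    refine integral_congr_ae ?_
    filter_upwards [(memLp_modeFun hγ j).coeFn_toLp] with p hp
    rw [mode, hp, modeFun]; push_cast; ring
  rw [h1, measQ, integral_prod_mul (fun t : UnitAddCircle => (fourier (-i.1) t * fourier j.1 t : ℂ))
    (fun x : ℝ => ((γ i.2 x * γ j.2 x : ℝ) : ℂ)), integral_complex_ofReal, hγ.orthonormal]
  have h2 : ∫ t : UnitAddCircle, (fourier (-i.1) t * fourier j.1 t : ℂ) =
      if i.1 = j.1 then 1 else 0 := by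
    have := fourierCoeff_fourier (T := 1) j.1
    have h3 := congrFun this i.1
    rw [fourierCoeff, ← volume_eq_haar] at h3
    simp only [smul_eq_mul] at h3
    rw [h3, Pi.single_apply]
  rw [h2]
  by_cases ha : i.1 = j.1 <;> by_cases hb : i.2 = j.2 <;> simp [ha, hb, Prod.ext_iff]

theorem orthonormal_mode (hγ : IsXBasis γ) : Orthonormal ℂ (mode hγ) := by
  rw [orthonormal_iff_ite]
  intro i j
  rw [inner_mode, coefC_mode]

theorem integrable_bdd_mul {g F : UnitAddCircle × ℝ → ℂ} (hg : Continuous g) {C : ℝ}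
    (hC : ∀ p, ‖g p‖ ≤ C) (hF : Integrable F measQ) : Integrable (fun p => g p * F p) measQ :=
  hF.bdd_mul hg.aestronglyMeasurable (.of_forall hC)

theorem integrable_timeCoeffC {F : UnitAddCircle × ℝ → ℂ} (hF : Integrable F measQ) (k : ℤ) :
    IntegrableOn (fun x => fourierCoeff (T := 1) (fun t => F (t, x)) k) (Ioo 0 1) := by
  have h1 : Integrable (fun p : UnitAddCircle × ℝ => fourier (-k) p.1 * F p) measQ :=
    integrable_bdd_mul (g := fun p => fourier (-k) p.1) (C := 1) (by fun_prop)
      (fun p => (norm_fourier_apply _ _).le) hF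
  have := Integrable.integral_prod_right h1
  unfold fourierCoeff
  rw [← volume_eq_haar]
  exact this

theorem integral_timeCoeffC (hγ : IsXBasis γ) {F : UnitAddCircle × ℝ → ℂ} (hF : Integrable F measQ)
    (k : ℤ) (n : ℕ) :
    ∫ x in Ioo (0 : ℝ) 1, (γ n x : ℂ) * fourierCoeff (T := 1) (fun t => F (t, x)) k =
      coefC γ F (k, n) := by
  have h1 : Integrable
      (fun p : UnitAddCircle × ℝ => fourier (-k) p.1 * (γ n p.2 : ℂ) * F p) measQ :=
    integrable_bdd_mul (g := fun p => fourier (-k) p.1 * (γ n p.2 : ℂ)) (C := 2)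
      (by have := hγ.continuous n; fun_prop)
      (fun p => by
        rw [norm_mul, norm_fourier_apply, one_mul, Complex.norm_real]; exact hγ.bound _ _) hF
  rw [coefC, measQ, integral_prod_symm _ h1]
  refine integral_congr_ae (.of_forall fun x => ?_)
  simp only
  rw [fourierCoeff, ← volume_eq_haar, ← integral_const_mul]
  congr 1; ext t
  simp only [smul_eq_mul]; ring

/-- Fourier coefficients in time are determined by the double coefficients. -/
theorem timeCoeffC_ae_eq (hγ : IsXBasis γ) {F G : UnitAddCircle × ℝ → ℂ} (hF : Integrable F measQ)
    (hG : Integrable G measQ) (k : ℤ) (m : ℂ)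
    (h : ∀ n, coefC γ G (k, n) = m * coefC γ F (k, n)) :
    ∀ᵐ x ∂(volume.restrict (Ioo (0 : ℝ) 1)), fourierCoeff (T := 1) (fun t => G (t, x)) k =
      m * fourierCoeff (T := 1) (fun t => F (t, x)) k := by
  have hiF := integrable_timeCoeffC hF k
  have hiG := integrable_timeCoeffC hG k
  have := hγ.complete (fun x => fourierCoeff (T := 1) (fun t => G (t, x)) k -
      m * fourierCoeff (T := 1) (fun t => F (t, x)) k) (hiG.sub (hiF.const_mul m)) ?_
  · filter_upwards [this] with x hx
    exact sub_eq_zero.mp hx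
  intro n
  have e : ∀ x : ℝ, (γ n x : ℂ) * (fourierCoeff (T := 1) (fun t => G (t, x)) k -
      m * fourierCoeff (T := 1) (fun t => F (t, x)) k) =
      (γ n x : ℂ) * fourierCoeff (T := 1) (fun t => G (t, x)) k -
      m * ((γ n x : ℂ) * fourierCoeff (T := 1) (fun t => F (t, x)) k) := fun x => by ring
  simp_rw [e]
  rw [integral_sub (integrableOn_ofReal_mul (hγ.continuous n) hiG)
    ((integrableOn_ofReal_mul (hγ.continuous n) hiF).const_mul m), integral_const_mul,
    integral_timeCoeffC hγ hG, integral_timeCoeffC hγ hF, h n, sub_self]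

/-- An `L²` function with vanishing double coefficients vanishes. -/
theorem eq_zero_of_coefC (hγ : IsXBasis γ) (F : L2C) (h : ∀ i, coefC γ F i = 0) : F = 0 := by
  have hF : MemLp F 2 measQ := Lp.memLp F
  have hFi : Integrable F measQ := hF.integrable one_le_two
  have h1 : ∀ᵐ x ∂(volume.restrict (Ioo (0 : ℝ) 1)),
      ∀ k, fourierCoeff (T := 1) (fun t => F (t, x)) k = 0 := by
    rw [ae_all_iff]
    intro k
    have := timeCoeffC_ae_eq hγ hFi hFi k 0 (fun n => by rw [h, zero_mul])
    simpa using this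
  have h2 : ∀ᵐ x ∂(volume.restrict (Ioo (0 : ℝ) 1)),
      MemLp (fun t => F (t, x)) 2 (volume : Measure UnitAddCircle) := by
    have hsq : Integrable (fun p => ‖F p‖ ^ 2)
        ((volume : Measure UnitAddCircle).prod (volume.restrict (Ioo (0 : ℝ) 1))) :=
      hF.integrable_norm_pow (by norm_num)
    have hm : AEStronglyMeasurable F
        ((volume : Measure UnitAddCircle).prod (volume.restrict (Ioo (0 : ℝ) 1))) := hF.1
    filter_upwards [hsq.prod_left_ae, hm.prod_swap.prodMk_left] with x hx hx'
    exact (memLp_two_iff_integrable_sq_norm hx').2 hx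
  have h3 : ∀ᵐ x ∂(volume.restrict (Ioo (0 : ℝ) 1)),
      (fun t => F (t, x)) =ᵐ[(volume : Measure UnitAddCircle)] 0 := by
    filter_upwards [h1, h2] with x hx1 hx2
    rw [volume_eq_haar] at hx2 ⊢
    have : hx2.toLp = 0 := by
      refine (fourierBasis (T := 1)).repr.map_eq_zero_iff.1 ?_
      ext k
      rw [fourierBasis_repr, fourierCoeff_congr_ae hx2.coeFn_toLp, hx1]; rfl
    have h5 := hx2.coeFn_toLp
    rw [this] at h5
    exact h5.symm.trans (Lp.coeFn_zero _ _ _)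
  rw [Lp.eq_zero_iff_ae_eq_zero]
  have hms := (Lp.stronglyMeasurable F).measurable
  have hset : MeasurableSet {p : UnitAddCircle × ℝ | F p = 0} := hms (measurableSet_singleton 0)
  have h4 : ∀ᵐ q ∂((volume.restrict (Ioo (0 : ℝ) 1)).prod (volume : Measure UnitAddCircle)),
      F q.swap = 0 :=
    (Measure.ae_prod_iff_ae_ae (measurable_swap hset)).2 h3
  have h5 : measQ = Measure.map Prod.swap
      ((volume.restrict (Ioo (0 : ℝ) 1)).prod (volume : Measure UnitAddCircle)) :=
    Measure.prod_swap.symm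
  have h6 : ∀ P : UnitAddCircle × ℝ → Prop, (∀ᵐ p ∂(Measure.map Prod.swap
      ((volume.restrict (Ioo (0 : ℝ) 1)).prod (volume : Measure UnitAddCircle))), P p) →
      ∀ᵐ p ∂measQ, P p := fun P hP => by rw [h5]; exact hP
  exact h6 _ ((ae_map_iff measurable_swap.aemeasurable hset).2 h4)

/-- The Hilbert basis of `L²(Q; ℂ)` formed by the functions `e^{2πikt} γ_n(x)`. -/
def modeBasis (hγ : IsXBasis γ) : HilbertBasis (ℤ × ℕ) ℂ L2C :=
  HilbertBasis.mkOfOrthogonalEqBot (orthonormal_mode hγ) (by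
    rw [Submodule.eq_bot_iff]
    intro F hF
    refine eq_zero_of_coefC hγ F fun i => ?_
    rw [← inner_mode hγ]
    exact (Submodule.mem_orthogonal _ _).1 hF _ (Submodule.subset_span ⟨i, rfl⟩))

theorem modeBasis_apply (hγ : IsXBasis γ) (i : ℤ × ℕ) : modeBasis hγ i = mode hγ i := by
  rw [modeBasis, HilbertBasis.coe_mkOfOrthogonalEqBot]

theorem modeBasis_repr (hγ : IsXBasis γ) (F : L2C) (i : ℤ × ℕ) :
    (modeBasis hγ).repr F i = coefC γ F i := by
  rw [HilbertBasis.repr_apply_apply, modeBasis_apply, inner_mode]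

/-! ### Coefficients of real functions -/

/-- The inclusion `L²(Q) → L²(Q; ℂ)`. -/
def toC : L2 →L[ℝ] L2C := Complex.ofRealCLM.compLpL 2 measQ

/-- The real part `L²(Q; ℂ) → L²(Q)`. -/
def reL : L2C →L[ℝ] L2 := Complex.reCLM.compLpL 2 measQ

theorem coeFn_toC (u : L2) : toC u =ᵐ[measQ] fun p => (u p : ℂ) :=
  ContinuousLinearMap.coeFn_compLpL _ _

theorem coeFn_reL (F : L2C) : reL F =ᵐ[measQ] fun p => (F p).re :=
  ContinuousLinearMap.coeFn_compLpL _ _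

theorem reL_toC (u : L2) : reL (toC u) = u := by
  ext1
  filter_upwards [coeFn_toC u, coeFn_reL (toC u)] with p h1 h2
  rw [h2, h1, Complex.ofReal_re]

theorem coefC_congr {F G : UnitAddCircle × ℝ → ℂ} (h : F =ᵐ[measQ] G) (i : ℤ × ℕ) :
    coefC γ F i = coefC γ G i := by
  refine integral_congr_ae ?_
  filter_upwards [h] with p hp
  rw [hp]

theorem coef_congr {u v : UnitAddCircle × ℝ → ℝ} (h : u =ᵐ[measQ] v) (i : ℤ × ℕ) :
    coef γ u i = coef γ v i :=
  coefC_congr (by filter_upwards [h] with p hp; rw [hp]) i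

theorem coefC_toC (u : L2) (i : ℤ × ℕ) : coefC γ (toC u) i = coef γ u i :=
  coefC_congr (coeFn_toC u) i

theorem coef_neg (u : UnitAddCircle × ℝ → ℝ) (k : ℤ) (n : ℕ) :
    coef γ u (-k, n) = (starRingEnd ℂ) (coef γ u (k, n)) := by
  unfold coef coefC
  rw [← integral_conj]
  congr 1; ext p
  simp only [map_mul, Complex.conj_ofReal]
  rw [fourier_neg]

/-- Conjugation symmetry characterizes the coefficients of real functions. -/
def ConjSymm (d : ℤ × ℕ → ℂ) : Prop := ∀ k n, d (-k, n) = (starRingEnd ℂ) (d (k, n))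

theorem conjSymm_coef (u : UnitAddCircle × ℝ → ℝ) : ConjSymm (coef γ u) := coef_neg u

theorem L2.ext_coef (hγ : IsXBasis γ) {u v : L2} (h : ∀ i, coef γ u i = coef γ v i) : u = v := by
  have : toC u = toC v := by
    refine (modeBasis hγ).repr.injective ?_
    ext i
    rw [modeBasis_repr, modeBasis_repr, coefC_toC, coefC_toC, h]
  rw [← reL_toC u, this, reL_toC]

theorem integrable_L2 (u : L2) : Integrable u measQ := (Lp.memLp u).integrable one_le_two

theorem integrable_ofReal (u : L2) : Integrable (fun p => (u p : ℂ)) measQ :=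
  (integrable_L2 u).ofReal

/-- The coefficient as a linear form on `L²(Q)`. -/
def coefL (hγ : IsXBasis γ) (i : ℤ × ℕ) : L2 →L[ℝ] ℂ :=
  ((innerSL ℂ (mode hγ i)).restrictScalars ℝ).comp toC

theorem coefL_apply (hγ : IsXBasis γ) (i : ℤ × ℕ) (u : L2) : coefL hγ i u = coef γ u i := by
  rw [← coefC_toC, ← inner_mode hγ]; rfl

theorem coef_add (hγ : IsXBasis γ) (u v : L2) (i : ℤ × ℕ) :
    coef γ (u + v : L2) i = coef γ u i + coef γ v i := by
  simp only [← coefL_apply hγ, map_add]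

theorem coef_sub (hγ : IsXBasis γ) (u v : L2) (i : ℤ × ℕ) :
    coef γ (u - v : L2) i = coef γ u i - coef γ v i := by
  simp only [← coefL_apply hγ, map_sub]

theorem coef_smul (hγ : IsXBasis γ) (r : ℝ) (u : L2) (i : ℤ × ℕ) :
    coef γ (r • u : L2) i = r * coef γ u i := by
  simp only [← coefL_apply hγ, map_smul, Complex.real_smul]

theorem inner_toC (u v : L2) : inner ℂ (toC u) (toC v) = ((inner ℝ u v : ℝ) : ℂ) := by
  rw [L2.inner_def, L2.inner_def, ← integral_complex_ofReal]
  refine integral_congr_ae ?_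
  filter_upwards [coeFn_toC u, coeFn_toC v] with p h1 h2
  rw [h1, h2]
  simp

/-- Parseval's identity. -/
theorem hasSum_coef_mul (hγ : IsXBasis γ) (u v : L2) :
    HasSum (fun i => (starRingEnd ℂ) (coef γ u i) * coef γ v i) ((inner ℝ u v : ℝ) : ℂ) := by
  have := (modeBasis hγ).hasSum_inner_mul_inner (toC u) (toC v)
  rw [inner_toC] at this
  refine this.congr_fun fun i => ?_
  rw [← inner_conj_symm, modeBasis_apply, inner_mode, inner_mode, coefC_toC, coefC_toC]

theorem hasSum_sq_coef (hγ : IsXBasis γ) (u : L2) :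
    HasSum (fun i => ‖coef γ u i‖ ^ 2) (‖u‖ ^ 2) := by
  have := hasSum_coef_mul hγ u u
  rw [← Complex.hasSum_ofReal]
  rw [real_inner_self_eq_norm_sq] at this
  refine this.congr_fun fun i => ?_
  rw [mul_comm, Complex.mul_conj, Complex.normSq_eq_norm_sq]

/-- The real function `Re (z e^{2πikt} γ_n(x))`. -/
def reMode (γ : ℕ → ℝ → ℝ) (z : ℂ) (i : ℤ × ℕ) (p : UnitAddCircle × ℝ) : ℝ :=
  (z * modeFun γ i p).re

/-- The element `Re (z e^{2πikt} γ_n(x))` of `L²(Q)`. -/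
def reModeL (hγ : IsXBasis γ) (z : ℂ) (i : ℤ × ℕ) : L2 := reL (z • mode hγ i)

theorem coeFn_reModeL (hγ : IsXBasis γ) (z : ℂ) (i : ℤ × ℕ) :
    reModeL hγ z i =ᵐ[measQ] reMode γ z i := by
  filter_upwards [coeFn_reL (z • mode hγ i), Lp.coeFn_smul z (mode hγ i),
    (memLp_modeFun hγ i).coeFn_toLp] with p h1 h2 h3
  rw [reModeL, h1, h2, Pi.smul_apply, mode, h3, smul_eq_mul, reMode]

/-- The expansion of a real function. -/
theorem hasSum_reModeL (hγ : IsXBasis γ) (u : L2) :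
    HasSum (fun i => reModeL hγ (coef γ u i) i) u := by
  have := ((modeBasis hγ).hasSum_repr (toC u)).mapL reL
  rw [reL_toC] at this
  refine this.congr_fun fun i => ?_
  rw [modeBasis_repr, modeBasis_apply, coefC_toC]; rfl

theorem coefC_star (F : UnitAddCircle × ℝ → ℂ) (k : ℤ) (n : ℕ) :
    coefC γ (fun p => (starRingEnd ℂ) (F p)) (k, n) = (starRingEnd ℂ) (coefC γ F (-k, n)) := by
  unfold coefC
  rw [← integral_conj]
  congr 1; ext p
  simp only [map_mul, Complex.conj_ofReal]
  rw [fourier_neg, fourier_neg, fourier_neg, Complex.conj_conj]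

theorem coef_reL (hγ : IsXBasis γ) (F : L2C) (k : ℤ) (n : ℕ) :
    coef γ (reL F) (k, n) =
      (coefC γ F (k, n) + (starRingEnd ℂ) (coefC γ F (-k, n))) / 2 := by
  have hFi : Integrable F measQ := (Lp.memLp F).integrable one_le_two
  have h1 : coef γ (reL F) (k, n) =
      coefC γ (fun p => (F p + (starRingEnd ℂ) (F p)) / 2) (k, n) := by
    refine coefC_congr ?_ _
    filter_upwards [coeFn_reL F] with p hp
    rw [hp, Complex.re_eq_add_conj]
  have hi : ∀ G : UnitAddCircle × ℝ → ℂ, Integrable G measQ → Integrable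
      (fun p : UnitAddCircle × ℝ => fourier (-k) p.1 * (γ n p.2 : ℂ) * G p) measQ := fun G hG =>
    integrable_bdd_mul (g := fun p => fourier (-k) p.1 * (γ n p.2 : ℂ)) (C := 2)
      (by have := hγ.continuous n; fun_prop)
      (fun p => by
        rw [norm_mul, norm_fourier_apply, one_mul, Complex.norm_real]; exact hγ.bound _ _) hG
  have hFs : Integrable (fun p => (starRingEnd ℂ) (F p)) measQ :=
    (RCLike.conjCLE (K := ℂ)).toContinuousLinearMap.integrable_comp hFi
  rw [h1, ← coefC_star, coefC, coefC, coefC, ← integral_add (hi _ hFi) (hi _ hFs),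
    ← integral_div]
  congr 1; ext p
  simp only
  ring

/-- Riesz-Fischer: conjugation symmetric square summable families are the coefficients of real
`L²` functions. -/
theorem exists_coef_eq (hγ : IsXBasis γ) {d : ℤ × ℕ → ℂ} (hd : ConjSymm d)
    (hs : Summable fun i => ‖d i‖ ^ 2) : ∃ u : L2, ∀ i, coef γ u i = d i := by
  have hm : Memℓp d 2 := by
    refine memℓp_gen ?_
    simpa using hs
  refine ⟨reL ((modeBasis hγ).repr.symm ⟨d, hm⟩), ?_⟩
  rintro ⟨k, n⟩
  rw [coef_reL hγ, ← modeBasis_repr hγ, ← modeBasis_repr hγ, LinearIsometryEquiv.apply_symm_apply]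
  change (d (k, n) + (starRingEnd ℂ) (d (-k, n))) / 2 = d (k, n)
  rw [hd, Complex.conj_conj]; ring

/-! ### Fractional time derivatives in terms of coefficients -/

/-- Multipliers in time act on the double coefficients, for any basis in space. -/
theorem timeMultiplier_iff (hγ : IsXBasis γ) (m : ℤ → ℂ) (u a : L2) :
    (∀ k : ℤ, ∀ᵐ x ∂(volume.restrict (Ioo (0 : ℝ) 1)), timeCoeff a k x = m k * timeCoeff u k x) ↔
      ∀ k n, coef γ a (k, n) = m k * coef γ u (k, n) := by
  constructor
  · intro h k n
    rw [coef, coef, ← integral_timeCoeffC hγ (integrable_ofReal a),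
      ← integral_timeCoeffC hγ (integrable_ofReal u), ← integral_const_mul]
    refine integral_congr_ae ?_
    filter_upwards [h k] with x hx
    unfold timeCoeff at hx
    rw [hx]; ring
  · intro h k
    exact timeCoeffC_ae_eq hγ (integrable_ofReal u) (integrable_ofReal a) k (m k) (h k)

theorem hasFracDeriv_iff (hγ : IsXBasis γ) {s : ℝ} {u a : L2} :
    HasFracDeriv s u a ↔ ∀ k n, coef γ a (k, n) = fracSymbol s k * coef γ u (k, n) :=
  timeMultiplier_iff hγ _ u a

theorem hasFracDerivAdj_iff (hγ : IsXBasis γ) {s : ℝ} {u a : L2} :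
    HasFracDerivAdj s u a ↔
      ∀ k n, coef γ a (k, n) = (starRingEnd ℂ) (fracSymbol s k) * coef γ u (k, n) :=
  timeMultiplier_iff hγ _ u a

theorem HasFracDeriv.fracDeriv_eq {s : ℝ} {u a : L2} (h : HasFracDeriv s u a) :
    fracDeriv s u = a := by
  have hex : ∃ a, HasFracDeriv s u a := ⟨a, h⟩
  rw [fracDeriv, dif_pos hex]
  refine L2.ext_coef isXBasis_cosB fun i => ?_
  rw [(hasFracDeriv_iff isXBasis_cosB).1 hex.choose_spec i.1 i.2,
    (hasFracDeriv_iff isXBasis_cosB).1 h i.1 i.2]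

theorem HasFracDerivAdj.fracDerivAdj_eq {s : ℝ} {u a : L2} (h : HasFracDerivAdj s u a) :
    fracDerivAdj s u = a := by
  have hex : ∃ a, HasFracDerivAdj s u a := ⟨a, h⟩
  rw [fracDerivAdj, dif_pos hex]
  refine L2.ext_coef isXBasis_cosB fun i => ?_
  rw [(hasFracDerivAdj_iff isXBasis_cosB).1 hex.choose_spec i.1 i.2,
    (hasFracDerivAdj_iff isXBasis_cosB).1 h i.1 i.2]

theorem fracSymbol_one (k : ℤ) : fracSymbol 1 k = 2 * Real.pi * Complex.I * k := by
  simp [fracSymbol]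

theorem fracSymbol_half_sq (k : ℤ) : fracSymbol (1 / 2) k ^ 2 = 2 * Real.pi * Complex.I * k := by
  have := Complex.cpow_nat_inv_pow (2 * Real.pi * Complex.I * k) (n := 2) two_ne_zero
  rw [fracSymbol]
  convert this using 3
  push_cast; norm_num

theorem fracSymbol_neg (s : ℝ) (k : ℤ) :
    fracSymbol s (-k) = (starRingEnd ℂ) (fracSymbol s k) := by
  have harg : (2 * Real.pi * Complex.I * k).arg ≠ Real.pi := by
    intro h
    have := (Complex.arg_eq_pi_iff.1 h).1
    simp at this
  have := Complex.conj_cpow (2 * Real.pi * Complex.I * k) (s : ℂ) harg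
  rw [Complex.conj_ofReal] at this
  rw [fracSymbol, fracSymbol, ← this]
  congr 1
  simp [map_ofNat]

theorem norm_fracSymbol_half_sq (k : ℤ) : ‖fracSymbol (1 / 2) k‖ ^ 2 = 2 * Real.pi * |(k : ℝ)| := by
  rw [← norm_pow, fracSymbol_half_sq]
  simp [abs_of_pos Real.pi_pos]

theorem norm_succ_mul_pi (n : ℕ) : ‖((n + 1) * Real.pi : ℂ)‖ = (n + 1) * Real.pi := by
  have : ((n + 1) * Real.pi : ℂ) = (((n + 1) * Real.pi : ℝ) : ℂ) := by push_cast; ring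
  rw [this, Complex.norm_real, Real.norm_of_nonneg (by positivity)]

/-! ### Space derivatives in terms of coefficients -/

/-- `b = u_x`, in terms of coefficients. -/
def CoefDx (u b : UnitAddCircle × ℝ → ℝ) : Prop :=
  ∀ (k : ℤ) (n : ℕ), coef sinB b (k, n) = -((n + 1) * Real.pi) * coef cosB u (k, n + 1)

/-- `c = p_x` for a function `p` vanishing at `x = 0` and `x = 1`, in terms of coefficients. -/
def CoefDxZero (p c : UnitAddCircle × ℝ → ℝ) : Prop :=
  (∀ k : ℤ, coef cosB c (k, 0) = 0) ∧
    ∀ (k : ℤ) (n : ℕ), coef cosB c (k, n + 1) = (n + 1) * Real.pi * coef sinB p (k, n)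

/-- A sum over the cosine modes without constant modes is a sum over the sine modes. -/
theorem hasSum_succ_iff {E : Type*} [AddCommMonoid E] [TopologicalSpace E] {f : ℤ × ℕ → E} {a : E}
    (h0 : ∀ k, f (k, 0) = 0) :
    HasSum (fun i : ℤ × ℕ => f (i.1, i.2 + 1)) a ↔ HasSum f a := by
  refine Function.Injective.hasSum_iff (g := fun i : ℤ × ℕ => (i.1, i.2 + 1)) ?_ ?_
  · rintro ⟨k, n⟩ ⟨l, m⟩ h
    simpa using h
  · rintro ⟨k, n⟩ h
    cases n with
    | zero => exact h0 k
    | succ n => exact absurd ⟨(k, n), rfl⟩ h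

/-- Integration by parts in `x`, by Parseval's identity. -/
theorem inner_coefDx {u b p c : L2} (h1 : CoefDx u b) (h2 : CoefDxZero p c) :
    (inner ℝ u c : ℝ) = - inner ℝ b p := by
  have e1 := hasSum_coef_mul isXBasis_cosB u c
  rw [← hasSum_succ_iff (fun k => by rw [h2.1 k, mul_zero])] at e1
  have e2 := (hasSum_coef_mul isXBasis_sinB b p).neg
  have : ((inner ℝ u c : ℝ) : ℂ) = -((inner ℝ b p : ℝ) : ℂ) := by
    refine e1.unique (e2.congr_fun fun i => ?_)
    rw [h2.2, h1 i.1 i.2]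
    simp only [map_mul, map_neg, map_add, map_natCast, map_one, Complex.conj_ofReal]
    ring
  exact_mod_cast this

theorem CoefDx.unique {u b b' : L2} (h : CoefDx u b) (h' : CoefDx u b') : b = b' :=
  L2.ext_coef isXBasis_sinB fun i => by rw [h i.1 i.2, h' i.1 i.2]

/-! ### Classically differentiable functions -/

/-- `f` is continuous with a continuous classical `x`-derivative `fx`. -/
structure IsC1x (f fx : UnitAddCircle × ℝ → ℝ) : Prop where
  cont : Continuous f
  contx : Continuous fx
  hasDeriv : ∀ t x, HasDerivAt (fun y => f (t, y)) (fx (t, x)) x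

theorem ae_mem_measQ : ∀ᵐ p ∂measQ, p.2 ∈ Ioo (0 : ℝ) 1 := by
  have : ∀ᵐ x ∂(volume.restrict (Ioo (0 : ℝ) 1)), x ∈ Ioo (0 : ℝ) 1 := ae_restrict_mem
      measurableSet_Ioo
  exact Measure.quasiMeasurePreserving_snd.ae this

theorem exists_bound_of_continuous {E : Type*} [NormedAddCommGroup E]
    {f : UnitAddCircle × ℝ → E} (hf : Continuous f) :
    ∃ C, ∀ t, ∀ x ∈ Icc (0 : ℝ) 1, ‖f (t, x)‖ ≤ C := by
  obtain ⟨C, hC⟩ := (isCompact_univ.prod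
      (isCompact_Icc (a := (0 : ℝ)) (b := 1))).exists_bound_of_continuousOn
    (f := f) hf.continuousOn
  exact ⟨C, fun t x hx => hC (t, x) ⟨mem_univ _, hx⟩⟩

theorem memLp_of_continuous {E : Type*} [NormedAddCommGroup E]
    [SecondCountableTopologyEither (UnitAddCircle × ℝ) E]
    {f : UnitAddCircle × ℝ → E} (hf : Continuous f) (q : ENNReal) : MemLp f q measQ := by
  obtain ⟨C, hC⟩ := exists_bound_of_continuous hf
  refine MemLp.of_bound hf.aestronglyMeasurable C ?_
  filter_upwards [ae_mem_measQ] with p hp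
  exact hC p.1 p.2 (Ioo_subset_Icc_self hp)

theorem coef_eq_iterated (hγ : IsXBasis γ) {f : UnitAddCircle × ℝ → ℝ} (hf : Continuous f)
    (k : ℤ) (n : ℕ) :
    coef γ f (k, n) = ∫ t : UnitAddCircle, (fourier (-k) t : ℂ) *
      ((∫ x in (0 : ℝ)..1, γ n x * f (t, x) : ℝ) : ℂ) := by
  have hγn := hγ.continuous n
  have hi : Integrable (fun p : UnitAddCircle × ℝ =>
      (fourier (-k) p.1 * (γ n p.2 : ℂ) * (f p : ℂ) : ℂ)) measQ :=
    (memLp_of_continuous (by fun_prop) 1).integrable le_rfl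
  rw [coef, coefC, measQ, integral_prod _ hi]
  congr 1; ext t
  rw [intervalIntegral.integral_of_le zero_le_one, integral_Ioc_eq_integral_Ioo,
    ← integral_complex_ofReal, ← integral_const_mul]
  congr 1; ext x
  push_cast; ring

theorem IsC1x.coefDx {f fx : UnitAddCircle × ℝ → ℝ} (h : IsC1x f fx) : CoefDx f fx := by
  intro k n
  rw [coef_eq_iterated isXBasis_sinB h.contx, coef_eq_iterated isXBasis_cosB h.cont,
    ← integral_const_mul]
  congr 1; ext t
  have hc := continuous_cosB (n + 1)
  have h1 := h.cont
  have h2 := h.contx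
  have := intervalIntegral.integral_mul_deriv_eq_deriv_mul (a := 0) (b := 1)
    (fun x _ => hasDerivAt_sinB n x) (fun x _ => h.hasDeriv t x)
    (Continuous.intervalIntegrable (by fun_prop) _ _)
    (Continuous.intervalIntegrable (by fun_prop) _ _)
  rw [this]
  simp only [sinB_at_zero, sinB_at_one, zero_mul, sub_zero, zero_sub, mul_assoc,
    intervalIntegral.integral_const_mul]
  push_cast; ring

theorem IsC1x.coefDxZero {f fx : UnitAddCircle × ℝ → ℝ} (h : IsC1x f fx)
    (h0 : ∀ t, f (t, 0) = 0) (h1 : ∀ t, f (t, 1) = 0) : CoefDxZero f fx := by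
  have hc1 := h.cont
  have hc2 := h.contx
  constructor
  · intro k
    rw [coef_eq_iterated isXBasis_cosB h.contx]
    have : ∀ t, ∫ x in (0 : ℝ)..1, cosB 0 x * fx (t, x) = 0 := by
      intro t
      simp only [cosB_zero, one_mul]
      rw [intervalIntegral.integral_eq_sub_of_hasDerivAt (fun x _ => h.hasDeriv t x)
        (Continuous.intervalIntegrable (by fun_prop) _ _), h0, h1, sub_zero]
    simp only [this, Complex.ofReal_zero, mul_zero, integral_zero]
  · intro k n
    rw [coef_eq_iterated isXBasis_sinB h.cont, coef_eq_iterated isXBasis_cosB h.contx,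
      ← integral_const_mul]
    congr 1; ext t
    have hc := continuous_sinB n
    have := intervalIntegral.integral_mul_deriv_eq_deriv_mul (a := 0) (b := 1)
      (fun x _ => hasDerivAt_cosB_succ n x) (fun x _ => h.hasDeriv t x)
      (Continuous.intervalIntegrable (by fun_prop) _ _)
      (Continuous.intervalIntegrable (by fun_prop) _ _)
    rw [this]
    simp only [h0, h1, mul_zero, sub_zero, zero_sub, mul_assoc, neg_mul,
      intervalIntegral.integral_const_mul, intervalIntegral.integral_neg]
    push_cast; ring

theorem continuous_of_lift {f : UnitAddCircle × ℝ → ℝ}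
    (h : Continuous (fun p : ℝ × ℝ => f ((p.1 : UnitAddCircle), p.2))) : Continuous f := by
  have hq : IsOpenQuotientMap (Prod.map (fun t : ℝ => (t : UnitAddCircle)) (id : ℝ → ℝ)) :=
    (QuotientAddGroup.isOpenQuotientMap_mk).prodMap IsOpenQuotientMap.id
  exact hq.isQuotientMap.continuous_iff.2 h

/-- Test functions are continuously differentiable in space. -/
theorem IsTest.isC1x {φ : UnitAddCircle × ℝ → ℝ} (h : IsTest φ) :
    IsC1x φ (fun p => deriv (fun y => φ (p.1, y)) p.2) := by
  have hd : ∀ (t : ℝ) (x : ℝ), HasDerivAt (fun y => φ ((t : UnitAddCircle), y))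
      (fderiv ℝ (fun p : ℝ × ℝ => φ ((p.1 : UnitAddCircle), p.2)) (t, x) (0, 1)) x := by
    intro t x
    have h1 : HasFDerivAt (fun p : ℝ × ℝ => φ ((p.1 : UnitAddCircle), p.2)) _ (t, x) :=
      (h.smooth.differentiable (by simp) (t, x)).hasFDerivAt
    have h2 : HasDerivAt (fun y : ℝ => (t, y)) ((0 : ℝ), (1 : ℝ)) x :=
      (hasDerivAt_const x t).prodMk (hasDerivAt_id x)
    exact h1.comp_hasDerivAt x h2
  refine ⟨continuous_of_lift h.smooth.continuous, continuous_of_lift ?_, ?_⟩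
  · have : (fun p : ℝ × ℝ => deriv (fun y => φ ((p.1 : UnitAddCircle), y)) p.2) =
        fun p => fderiv ℝ (fun p : ℝ × ℝ => φ ((p.1 : UnitAddCircle), p.2)) p (0, 1) := by
      ext p
      exact (hd p.1 p.2).deriv
    change Continuous (fun p : ℝ × ℝ => deriv (fun y => φ ((p.1 : UnitAddCircle), y)) p.2)
    rw [this]
    exact (h.smooth.continuous_fderiv (by simp)).clm_apply continuous_const
  · intro t x
    obtain ⟨t, rfl⟩ := QuotientAddGroup.mk_surjective t
    exact (hd t x).differentiableAt.hasDerivAt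

theorem IsTest.zero_left {φ : UnitAddCircle × ℝ → ℝ} (h : IsTest φ) (t : UnitAddCircle) :
    φ (t, 0) = 0 := by
  obtain ⟨a, b, ha, hb, h0⟩ := h.compact_support
  exact h0 t 0 (fun h => absurd h.1 (by linarith))

theorem IsTest.zero_right {φ : UnitAddCircle × ℝ → ℝ} (h : IsTest φ) (t : UnitAddCircle) :
    φ (t, 1) = 0 := by
  obtain ⟨a, b, ha, hb, h0⟩ := h.compact_support
  exact h0 t 1 (fun h => absurd h.2 (by linarith))

theorem inner_L2 (u v : L2) : (inner ℝ u v : ℝ) = ∫ p, u p * v p ∂measQ := by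
  rw [L2.inner_def]
  refine integral_congr_ae (.of_forall fun p => ?_)
  simp [mul_comm]

theorem inner_toLp {f : UnitAddCircle × ℝ → ℝ} (hf : MemLp f 2 measQ) (u : L2) :
    (inner ℝ u (hf.toLp f) : ℝ) = ∫ p, u p * f p ∂measQ := by
  rw [inner_L2]
  refine integral_congr_ae ?_
  filter_upwards [hf.coeFn_toLp] with p hp
  rw [hp]

theorem CoefDx.congr {u b u' b' : UnitAddCircle × ℝ → ℝ} (h : CoefDx u b) (hu : u' =ᵐ[measQ] u)
    (hb : b' =ᵐ[measQ] b) : CoefDx u' b' := fun k n => by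
  rw [coef_congr hb, coef_congr hu, h]

theorem CoefDxZero.congr {u b u' b' : UnitAddCircle × ℝ → ℝ} (h : CoefDxZero u b)
    (hu : u' =ᵐ[measQ] u) (hb : b' =ᵐ[measQ] b) : CoefDxZero u' b' :=
  ⟨fun k => by rw [coef_congr hb, h.1], fun k n => by rw [coef_congr hb, coef_congr hu, h.2]⟩

theorem CoefDx.hasDx {u b : L2} (h : CoefDx u b) : HasDx u b := by
  intro φ hφ
  have hc := hφ.isC1x
  have h1 := memLp_of_continuous hc.cont 2
  have h2 := memLp_of_continuous hc.contx 2
  rw [← inner_toLp h1, ← inner_toLp h2]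
  exact inner_coefDx h ((hc.coefDxZero hφ.zero_left hφ.zero_right).congr h1.coeFn_toLp
      h2.coeFn_toLp)

theorem CoefDxZero.hasDx {u b : L2} (h : CoefDxZero u b) : HasDx u b := by
  intro φ hφ
  have hc := hφ.isC1x
  have h1 := memLp_of_continuous hc.cont 2
  have h2 := memLp_of_continuous hc.contx 2
  rw [← inner_toLp h1, ← inner_toLp h2, real_inner_comm, real_inner_comm _ b,
    inner_coefDx (hc.coefDx.congr h1.coeFn_toLp h2.coeFn_toLp) h, neg_neg]

theorem norm_toLp_sq {f : UnitAddCircle × ℝ → ℝ} (hf : MemLp f 2 measQ) :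
    ‖hf.toLp f‖ ^ 2 = ∫ p, f p ^ 2 ∂measQ := by
  rw [← real_inner_self_eq_norm_sq, inner_toLp hf]
  refine integral_congr_ae ?_
  filter_upwards [hf.coeFn_toLp] with p hp
  rw [hp, sq]

/-- Dominated convergence in `L²(Q)`. -/
theorem tendsto_toLp_of_dominated {f : ℕ → UnitAddCircle × ℝ → ℝ} {g B : UnitAddCircle × ℝ → ℝ}
    (hf : ∀ N, MemLp (f N) 2 measQ) (hg : MemLp g 2 measQ) (hB : MemLp B 2 measQ)
    (hle : ∀ N, ∀ᵐ p ∂measQ, |f N p - g p| ≤ B p)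
    (hlim : ∀ᵐ p ∂measQ, Tendsto (fun N => f N p) atTop (𝓝 (g p))) :
    Tendsto (fun N => (hf N).toLp (f N)) atTop (𝓝 (hg.toLp g)) := by
  rw [tendsto_iff_norm_sub_tendsto_zero]
  have h1 : ∀ N, ‖(hf N).toLp (f N) - hg.toLp g‖ ^ 2 = ∫ p, (f N p - g p) ^ 2 ∂measQ := by
    intro N
    rw [← MemLp.toLp_sub, norm_toLp_sq]
    rfl
  have h2 : Tendsto (fun N => ∫ p, (f N p - g p) ^ 2 ∂measQ) atTop (𝓝 (∫ _, (0 : ℝ) ∂measQ)) := by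
    refine tendsto_integral_of_dominated_convergence (fun p => B p ^ 2) ?_ ?_ ?_ ?_
    · exact fun N => (((hf N).1.sub hg.1).pow 2)
    · exact hB.integrable_sq
    · intro N
      filter_upwards [hle N] with p hp
      rw [Real.norm_eq_abs, abs_of_nonneg (sq_nonneg _), ← sq_abs]
      gcongr
    · filter_upwards [hlim] with p hp
      have : Tendsto (fun N => (f N p - g p) ^ 2) atTop (𝓝 ((g p - g p) ^ 2)) :=
        (hp.sub_const _).pow 2
      simpa using this
  have h3 : (fun N => ‖(hf N).toLp (f N) - hg.toLp g‖) =
      fun N => √(∫ p, (f N p - g p) ^ 2 ∂measQ) := by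
    ext N
    rw [← h1, Real.sqrt_sq (norm_nonneg _)]
  rw [h3]
  simpa using h2.sqrt

/-! ### Cutting off the sine modes -/

/-- The bounds that make `x ↦ smoothTransition (N x - 1)` a good cut-off: the derivative is
bounded, and it is supported where `y + 1` is of order one. -/
theorem exists_bound_deriv_smoothTransition :
    ∃ M, ∀ y, |deriv Real.smoothTransition y| ≤ M ∧
      |(y + 1) * deriv Real.smoothTransition y| ≤ 2 * M := by
  have hc : Continuous (deriv Real.smoothTransition) :=
    Real.smoothTransition.contDiff.continuous_deriv (n := 1) le_rfl
  obtain ⟨M, hM⟩ := (isCompact_Icc (a := (0 : ℝ)) (b := 1)).exists_bound_of_continuousOn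
    (f := deriv Real.smoothTransition) hc.continuousOn
  have hM0 : 0 ≤ M := (norm_nonneg _).trans (hM 0 (by simp))
  refine ⟨M, fun y => ?_⟩
  by_cases hy : y ∈ Icc (0 : ℝ) 1
  · have h1 : |deriv Real.smoothTransition y| ≤ M := hM y hy
    refine ⟨h1, ?_⟩
    rw [abs_mul]
    have h2 : |y + 1| ≤ 2 := abs_le.2 ⟨by linarith [hy.1], by linarith [hy.2]⟩
    gcongr
  · have h0 : deriv Real.smoothTransition y = 0 := by
      rcases not_and_or.1 hy with h | h
      · have : Real.smoothTransition =ᶠ[𝓝 y] fun _ => 0 := by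
          filter_upwards [Iio_mem_nhds (not_le.1 h)] with z hz
          exact Real.smoothTransition.zero_of_nonpos (le_of_lt hz)
        rw [this.deriv_eq]; simp
      · have : Real.smoothTransition =ᶠ[𝓝 y] fun _ => 1 := by
          filter_upwards [Ioi_mem_nhds (not_le.1 h)] with z hz
          exact Real.smoothTransition.one_of_one_le (le_of_lt hz)
        rw [this.deriv_eq]; simp
    rw [h0]; simp [hM0]

theorem contDiff_sinB (n : ℕ) : ContDiff ℝ ∞ (sinB n) := by
  unfold sinB; fun_prop

theorem abs_sinB_sub_le (n : ℕ) (x y : ℝ) :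
    |sinB n y - sinB n x| ≤ 2 * ((n + 1) * Real.pi) * |y - x| := by
  refine Convex.norm_image_sub_le_of_norm_hasDerivWithin_le (s := univ)
    (fun x _ => (hasDerivAt_sinB n x).hasDerivWithinAt) (fun x _ => ?_) convex_univ
    (mem_univ _) (mem_univ _)
  have := abs_cosB_le (n + 1) x
  have hp := Real.pi_pos
  rw [Real.norm_eq_abs, abs_mul, abs_of_nonneg (by positivity : (0 : ℝ) ≤ (n + 1) * Real.pi)]
  nlinarith [mul_le_mul_of_nonneg_left this (by positivity : (0 : ℝ) ≤ (n + 1) * Real.pi)]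

/-- Smooth cut-offs of a sine mode near `x = 0` and `x = 1`. Their derivatives stay bounded since
the sine mode vanishes linearly there. -/
theorem exists_cutoff_sinB (n : ℕ) : ∃ (η : ℕ → ℝ → ℝ) (C : ℝ),
    (∀ N, ContDiff ℝ ∞ (η N)) ∧
    (∀ N, ∃ a b : ℝ, 0 < a ∧ b < 1 ∧ ∀ x, x ∉ Icc a b → η N x = 0) ∧
    (∀ N x, |η N x| ≤ C) ∧ (∀ N x, |deriv (η N) x| ≤ C) ∧
    ∀ x ∈ Ioo (0 : ℝ) 1, ∀ᶠ N in atTop, η N =ᶠ[𝓝 x] sinB n := by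
  obtain ⟨M, hM⟩ := exists_bound_deriv_smoothTransition
  have hM0 : 0 ≤ M := (abs_nonneg _).trans (hM 0).1
  set L : ℝ := 2 * ((n + 1) * Real.pi) with hL
  have hL0 : 0 ≤ L := by positivity
  have hL2 : 2 ≤ L := by
    have := Real.pi_gt_three
    rw [hL]
    nlinarith [mul_nonneg (Nat.cast_nonneg n : (0 : ℝ) ≤ n) Real.pi_pos.le]
  -- `A N` cuts off near `x = 0` and `B N` near `x = 1`, at scale `1 / (N + 1)`
  let A : ℕ → ℝ → ℝ := fun N x => Real.smoothTransition ((N + 1) * x - 1)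
  let B : ℕ → ℝ → ℝ := fun N x => Real.smoothTransition ((N + 1) * (1 - x) - 1)
  have hσ : ContDiff ℝ ∞ Real.smoothTransition := Real.smoothTransition.contDiff
  have hσd : ∀ y, HasDerivAt Real.smoothTransition (deriv Real.smoothTransition y) y :=
    fun y => (hσ.differentiable (by simp) y).hasDerivAt
  have hA01 : ∀ N x, |A N x| ≤ 1 := fun N x => by
    rw [abs_of_nonneg (Real.smoothTransition.nonneg _)]; exact Real.smoothTransition.le_one _
  have hB01 : ∀ N x, |B N x| ≤ 1 := fun N x => by
    rw [abs_of_nonneg (Real.smoothTransition.nonneg _)]; exact Real.smoothTransition.le_one _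
  refine ⟨fun N x => sinB n x * (A N x * B N x), L + 4 * L * M, ?_, ?_, ?_, ?_, ?_⟩
  · intro N
    have := contDiff_sinB n
    have h1 : ContDiff ℝ ∞ (A N) := hσ.comp (by fun_prop)
    have h2 : ContDiff ℝ ∞ (B N) := hσ.comp (by fun_prop)
    fun_prop
  · intro N
    have hN : (0 : ℝ) < N + 1 := by positivity
    refine ⟨1 / (N + 1), 1 - 1 / (N + 1), by positivity, by simp; positivity, ?_⟩
    intro x hx
    rcases not_and_or.1 hx with h | h
    · have : A N x = 0 := Real.smoothTransition.zero_of_nonpos (by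
        rw [not_le, lt_div_iff₀ hN] at h; linarith)
      simp [this]
    · have : B N x = 0 := Real.smoothTransition.zero_of_nonpos (by
        rw [not_le] at h
        have : 1 - x < 1 / (N + 1) := by linarith
        rw [lt_div_iff₀ hN] at this; linarith)
      simp [this]
  · intro N x
    rw [abs_mul, abs_mul]
    have h1 := abs_sinB_le n x
    calc |sinB n x| * (|A N x| * |B N x|) ≤ 2 * (1 * 1) := by
          gcongr
          · exact hA01 N x
          · exact hB01 N x
      _ ≤ L + 4 * L * M := by nlinarith [mul_nonneg hL0 hM0]
  · intro N x
    have hN : (0 : ℝ) < N + 1 := by positivity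
    have dA : HasDerivAt (A N) (deriv Real.smoothTransition ((N + 1) * x - 1) * (N + 1)) x := by
      have : HasDerivAt (fun x : ℝ => (N + 1) * x - 1) ((N : ℝ) + 1) x := by
        simpa using ((hasDerivAt_id x).const_mul ((N : ℝ) + 1)).sub_const 1
      exact (hσd _).comp x this
    have dB : HasDerivAt (B N)
        (deriv Real.smoothTransition ((N + 1) * (1 - x) - 1) * (-(N + 1))) x := by
      have : HasDerivAt (fun x : ℝ => (N + 1) * (1 - x) - 1) (-((N : ℝ) + 1)) x := by
        simpa using (((hasDerivAt_id x).const_sub 1).const_mul ((N : ℝ) + 1)).sub_const 1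
      exact (hσd _).comp x this
    have dd := (hasDerivAt_sinB n x).mul (dA.mul dB)
    change |deriv (sinB n * (A N * B N)) x| ≤ _
    rw [dd.deriv]
    set a := deriv Real.smoothTransition ((N + 1) * x - 1) with ha
    set b := deriv Real.smoothTransition ((N + 1) * (1 - x) - 1) with hb
    have e1 : |sinB n x| ≤ L * |x| := by
      have := abs_sinB_sub_le n 0 x
      simpa using this
    have e2 : |sinB n x| ≤ L * |1 - x| := by
      have := abs_sinB_sub_le n 1 x
      rw [sinB_at_one, sub_zero, abs_sub_comm x 1] at this
      exact this
    -- the factor `N + 1` from the cut-off is absorbed by the distance of `x` to the boundary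
    have e3 : |sinB n x * (a * (N + 1))| ≤ L * (2 * M) := by
      have h := (hM ((N + 1) * x - 1)).2
      rw [sub_add_cancel, abs_mul, abs_mul, abs_of_pos hN, ← ha] at h
      rw [abs_mul, abs_mul, abs_of_pos hN]
      calc |sinB n x| * (|a| * (N + 1)) ≤ L * |x| * (|a| * (N + 1)) := by gcongr
        _ = L * ((N + 1) * |x| * |a|) := by ring
        _ ≤ _ := by gcongr
    have e4 : |sinB n x * (b * (N + 1))| ≤ L * (2 * M) := by
      have h := (hM ((N + 1) * (1 - x) - 1)).2
      rw [sub_add_cancel, abs_mul, abs_mul, abs_of_pos hN, ← hb] at h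
      rw [abs_mul, abs_mul, abs_of_pos hN]
      calc |sinB n x| * (|b| * (N + 1)) ≤ L * |1 - x| * (|b| * (N + 1)) := by gcongr
        _ = L * ((N + 1) * |1 - x| * |b|) := by ring
        _ ≤ _ := by gcongr
    have e5 : |(n + 1) * Real.pi * cosB (n + 1) x| ≤ L := by
      have := abs_cosB_le (n + 1) x
      rw [abs_mul, abs_of_nonneg (by positivity : (0 : ℝ) ≤ (n + 1) * Real.pi)]
      rw [hL]
      nlinarith [mul_le_mul_of_nonneg_left this (by positivity : (0 : ℝ) ≤ (n + 1) * Real.pi)]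
    have e6 : (n + 1) * Real.pi * cosB (n + 1) x * (A N * B N) x +
        sinB n x * (a * (N + 1) * B N x + A N x * (b * -(N + 1))) =
        (n + 1) * Real.pi * cosB (n + 1) x * (A N x * B N x) +
        (sinB n x * (a * (N + 1))) * B N x - (sinB n x * (b * (N + 1))) * A N x := by
      simp only [Pi.mul_apply]; ring
    rw [e6]
    have f1 : |(n + 1) * Real.pi * cosB (n + 1) x * (A N x * B N x)| ≤ L * (1 * 1) := by
      rw [abs_mul, abs_mul (A N x)]
      gcongr
      · exact hA01 N x
      · exact hB01 N x
    have f2 : |(sinB n x * (a * (N + 1))) * B N x| ≤ L * (2 * M) * 1 := by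
      rw [abs_mul]
      gcongr
      exact hB01 N x
    have f3 : |(sinB n x * (b * (N + 1))) * A N x| ≤ L * (2 * M) * 1 := by
      rw [abs_mul]
      gcongr
      exact hA01 N x
    calc _ ≤ |(n + 1) * Real.pi * cosB (n + 1) x * (A N x * B N x)| +
          |(sinB n x * (a * (N + 1))) * B N x| + |(sinB n x * (b * (N + 1))) * A N x| :=
          (abs_sub _ _).trans (by gcongr; exact abs_add_le _ _)
      _ ≤ _ := by linarith
  · intro x hx
    have h1 : ∀ᶠ N : ℕ in atTop, 2 < (N + 1) * x := by
      have : Tendsto (fun N : ℕ => ((N : ℝ) + 1) * x) atTop atTop :=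
        (tendsto_natCast_atTop_atTop.atTop_add tendsto_const_nhds).atTop_mul_const hx.1
      exact this.eventually_gt_atTop 2
    have h2 : ∀ᶠ N : ℕ in atTop, 2 < (N + 1) * (1 - x) := by
      have : Tendsto (fun N : ℕ => ((N : ℝ) + 1) * (1 - x)) atTop atTop :=
        (tendsto_natCast_atTop_atTop.atTop_add tendsto_const_nhds).atTop_mul_const
          (by linarith [hx.2])
      exact this.eventually_gt_atTop 2
    filter_upwards [h1, h2] with N hN1 hN2
    have c1 : ∀ᶠ y in 𝓝 x, 2 < ((N : ℝ) + 1) * y :=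
      (continuous_const.mul continuous_id).continuousAt.eventually (lt_mem_nhds hN1)
    have c2 : ∀ᶠ y in 𝓝 x, 2 < ((N : ℝ) + 1) * (1 - y) :=
      (continuous_const.mul (continuous_const.sub continuous_id)).continuousAt.eventually
        (lt_mem_nhds hN2)
    filter_upwards [c1, c2] with y hy1 hy2
    have a1 : A N y = 1 := Real.smoothTransition.one_of_one_le (by linarith)
    have a2 : B N y = 1 := Real.smoothTransition.one_of_one_le (by linarith)
    rw [a1, a2]; ring

/-- The function `Re (z e^{2πikt}) η(x)`. -/
def reTensor (z : ℂ) (k : ℤ) (η : ℝ → ℝ) (p : UnitAddCircle × ℝ) : ℝ :=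
  (z * fourier k p.1).re * η p.2

theorem reMode_eq_reTensor (z : ℂ) (i : ℤ × ℕ) : reMode γ z i = reTensor z i.1 (γ i.2) := by
  ext p
  rw [reMode, modeFun, reTensor, ← mul_assoc, Complex.re_mul_ofReal]

theorem continuous_reTensor (z : ℂ) (k : ℤ) {η : ℝ → ℝ} (hη : Continuous η) :
    Continuous (reTensor z k η) := by
  unfold reTensor
  exact (Complex.continuous_re.comp (by fun_prop)).mul (by fun_prop)

theorem abs_re_mul_fourier_le (z : ℂ) (k : ℤ) (t : UnitAddCircle) :
    |(z * fourier k t).re| ≤ ‖z‖ :=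
  (Complex.abs_re_le_norm _).trans (by rw [norm_mul, norm_fourier_apply, mul_one])

theorem abs_reTensor_le (z : ℂ) (k : ℤ) {η : ℝ → ℝ} {C : ℝ} (hη : ∀ x, |η x| ≤ C)
    (p : UnitAddCircle × ℝ) : |reTensor z k η p| ≤ ‖z‖ * C := by
  rw [reTensor, abs_mul]
  gcongr
  · exact abs_re_mul_fourier_le z k p.1
  · exact hη _

theorem isTest_reTensor (z : ℂ) (k : ℤ) {η : ℝ → ℝ} (hη : ContDiff ℝ ∞ η)
    (hs : ∃ a b : ℝ, 0 < a ∧ b < 1 ∧ ∀ x, x ∉ Icc a b → η x = 0) :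
    IsTest (reTensor z k η) where
  smooth := by
    unfold reTensor
    have h1 : ContDiff ℝ ∞ (fun p : ℝ × ℝ => (z * fourier k (p.1 : UnitAddCircle)).re) := by
      have h0 : ContDiff ℝ ∞ (fun p : ℝ × ℝ => (p.1 : ℂ)) :=
        Complex.ofRealCLM.contDiff.comp contDiff_fst
      have h1 : ContDiff ℝ ∞ (fun p : ℝ × ℝ => z * fourier (T := 1) k (p.1 : UnitAddCircle)) := by
        simp only [fourier_coe_apply]
        fun_prop
      exact Complex.reCLM.contDiff.comp h1
    exact h1.mul (hη.comp contDiff_snd)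
  compact_support := by
    obtain ⟨a, b, ha, hb, h⟩ := hs
    exact ⟨a, b, ha, hb, fun t x hx => by rw [reTensor, h x hx, mul_zero]⟩

theorem deriv_reTensor (z : ℂ) (k : ℤ) {η : ℝ → ℝ} (hη : ContDiff ℝ ∞ η)
    (p : UnitAddCircle × ℝ) :
    deriv (fun y => reTensor z k η (p.1, y)) p.2 = reTensor z k (deriv η) p := by
  unfold reTensor
  simp only
  exact (((hη.differentiable (by simp)) p.2).hasDerivAt.const_mul _).deriv

theorem coef_eq_integral_reMode (hγ : IsXBasis γ) (u : L2) (k : ℤ) (n : ℕ) :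
    coef γ u (k, n) = ((∫ p, u p * reTensor 1 (-k) (γ n) p ∂measQ : ℝ) : ℂ) +
      Complex.I * ((∫ p, u p * reTensor (-Complex.I) (-k) (γ n) p ∂measQ : ℝ) : ℂ) := by
  have hi : ∀ z : ℂ, Integrable (fun p => ((u p * reTensor z (-k) (γ n) p : ℝ) : ℂ)) measQ := by
    intro z
    refine Integrable.ofReal ((integrable_L2 u).mul_bdd (c := ‖z‖ * 2)
      (continuous_reTensor z (-k) (hγ.continuous n)).aestronglyMeasurable
      (.of_forall (abs_reTensor_le z (-k) (hγ.bound n))))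
  rw [← integral_complex_ofReal, ← integral_complex_ofReal, ← integral_const_mul,
    ← integral_add (hi _) ((hi _).const_mul _), coef, coefC]
  congr 1; ext p
  simp only [reTensor]
  have : (fourier (-k) p.1 : ℂ) = (((1 : ℂ) * fourier (-k) p.1).re : ℂ) +
      Complex.I * ((((-Complex.I) * fourier (-k) p.1).re : ℝ) : ℂ) := by
    apply Complex.ext <;> simp
  conv_lhs => rw [this]
  push_cast; ring

theorem tendsto_integral_reTensor (u : L2) (z : ℂ) (k : ℤ) {η : ℕ → ℝ → ℝ} {η' : ℝ → ℝ} {C : ℝ}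
    (hc : ∀ N, Continuous (η N)) (hb : ∀ N x, |η N x| ≤ C)
    (hlim : ∀ x ∈ Ioo (0 : ℝ) 1, Tendsto (fun N => η N x) atTop (𝓝 (η' x))) :
    Tendsto (fun N => ∫ p, u p * reTensor z k (η N) p ∂measQ) atTop
      (𝓝 (∫ p, u p * reTensor z k η' p ∂measQ)) := by
  refine tendsto_integral_of_dominated_convergence (fun p => |u p| * (‖z‖ * C)) ?_ ?_ ?_ ?_
  · exact fun N => (integrable_L2 u).1.mul (continuous_reTensor z k (hc N)).aestronglyMeasurable
  · exact (integrable_L2 u).abs.mul_const _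
  · intro N
    refine .of_forall fun p => ?_
    rw [Real.norm_eq_abs, abs_mul]
    gcongr
    exact abs_reTensor_le z k (hb N) p
  · filter_upwards [ae_mem_measQ] with p hp
    exact (((hlim p.2 hp).const_mul _).const_mul _)

/-- The weak derivative determines the sine coefficients: test with the cut-off sine modes and
pass to the limit. -/
theorem HasDx.coefDx {u b : L2} (h : HasDx u b) : CoefDx u b := by
  intro k n
  obtain ⟨η, C, hη, hs, hC, hC', hlim⟩ := exists_cutoff_sinB n
  have key : ∀ z : ℂ, ∫ p, u p * reTensor z (-k) (fun x => (n + 1) * Real.pi * cosB (n + 1) x) p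
      ∂measQ =
      - ∫ p, b p * reTensor z (-k) (sinB n) p ∂measQ := by
    intro z
    have h1 := tendsto_integral_reTensor u z (-k) (η := fun N => deriv (η N))
      (η' := fun x => (n + 1) * Real.pi * cosB (n + 1) x)
      (fun N => (hη N).continuous_deriv (by simp)) hC' (fun x hx => by
        refine tendsto_const_nhds.congr' ?_
        filter_upwards [hlim x hx] with N hN
        rw [hN.deriv_eq, (hasDerivAt_sinB n x).deriv])
    have h2 := tendsto_integral_reTensor b z (-k) (η := η) (η' := sinB n)
      (fun N => (hη N).continuous) hC (fun x hx => by
        refine tendsto_const_nhds.congr' ?_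
        filter_upwards [hlim x hx] with N hN
        rw [hN.eq_of_nhds])
    refine tendsto_nhds_unique h1 (h2.neg.congr fun N => ?_)
    have := h _ (isTest_reTensor z (-k) (hη N) (hs N))
    simp only [deriv_reTensor z (-k) (hη N)] at this
    exact this.symm
  have key2 : ∀ z : ℂ, ∫ p, b p * reTensor z (-k) (sinB n) p ∂measQ = - ((n + 1) * Real.pi) *
      ∫ p, u p * reTensor z (-k) (cosB (n + 1)) p ∂measQ := by
    intro z
    rw [← neg_eq_iff_eq_neg.2 (key z), ← integral_const_mul, ← integral_neg]
    congr 1; ext p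
    unfold reTensor
    ring
  rw [coef_eq_integral_reMode isXBasis_sinB, coef_eq_integral_reMode isXBasis_cosB, key2, key2]
  push_cast; ring

theorem hasDx_iff {u b : L2} : HasDx u b ↔ CoefDx u b := ⟨HasDx.coefDx, CoefDx.hasDx⟩

theorem HasDx.dx_eq {u b : L2} (h : HasDx u b) : dx u = b := by
  have hex : ∃ b, HasDx u b := ⟨b, h⟩
  rw [dx, dif_pos hex]
  exact hex.choose_spec.coefDx.unique h.coefDx

theorem HasDx.sub {u b v c : L2} (h : HasDx u b) (h' : HasDx v c) : HasDx (u - v) (b - c) := by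
  rw [hasDx_iff] at *
  intro k n
  rw [coef_sub isXBasis_sinB, coef_sub isXBasis_cosB, h, h']; ring

theorem HasDx.add {u b v c : L2} (h : HasDx u b) (h' : HasDx v c) : HasDx (u + v) (b + c) := by
  rw [hasDx_iff] at *
  intro k n
  rw [coef_add isXBasis_sinB, coef_add isXBasis_cosB, h, h']; ring

theorem HasDx.smul {u b : L2} (r : ℝ) (h : HasDx u b) : HasDx (r • u) (r • b) := by
  rw [hasDx_iff] at *
  intro k n
  rw [coef_smul isXBasis_sinB, coef_smul isXBasis_cosB, h]; ring

theorem HasFracDeriv.add {s : ℝ} {u b v c : L2} (h : HasFracDeriv s u b) (h' : HasFracDeriv s v c) :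
    HasFracDeriv s (u + v) (b + c) := by
  rw [hasFracDeriv_iff isXBasis_cosB] at *
  intro k n
  rw [coef_add isXBasis_cosB, coef_add isXBasis_cosB, h, h']; ring

theorem HasFracDeriv.sub {s : ℝ} {u b v c : L2} (h : HasFracDeriv s u b) (h' : HasFracDeriv s v c) :
    HasFracDeriv s (u - v) (b - c) := by
  rw [hasFracDeriv_iff isXBasis_cosB] at *
  intro k n
  rw [coef_sub isXBasis_cosB, coef_sub isXBasis_cosB, h, h']; ring

theorem HasFracDeriv.smul {s : ℝ} {u b : L2} (r : ℝ) (h : HasFracDeriv s u b) :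
    HasFracDeriv s (r • u) (r • b) := by
  rw [hasFracDeriv_iff isXBasis_cosB] at *
  intro k n
  rw [coef_smul isXBasis_cosB, coef_smul isXBasis_cosB, h]; ring

/-! ### The space `H^{1/2,1}_0(Q)` in terms of coefficients -/

theorem IsTest.add {φ ψ : UnitAddCircle × ℝ → ℝ} (h : IsTest φ) (h' : IsTest ψ) :
    IsTest (φ + ψ) where
  smooth := h.smooth.add h'.smooth
  compact_support := by
    obtain ⟨a, b, ha, hb, h0⟩ := h.compact_support
    obtain ⟨c, d, hc, hd, h1⟩ := h'.compact_support
    refine ⟨min a c, max b d, lt_min ha hc, max_lt hb hd, fun t x hx => ?_⟩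
    rw [Pi.add_apply, h0 t x fun hx' => hx (Icc_subset_Icc (min_le_left _ _) (le_max_left _ _) hx'),
      h1 t x fun hx' => hx (Icc_subset_Icc (min_le_right _ _) (le_max_right _ _) hx'), add_zero]

theorem IsTest.smul {φ : UnitAddCircle × ℝ → ℝ} (r : ℝ) (h : IsTest φ) : IsTest (r • φ) where
  smooth := h.smooth.const_smul r
  compact_support := by
    obtain ⟨a, b, ha, hb, h0⟩ := h.compact_support
    exact ⟨a, b, ha, hb, fun t x hx => by rw [Pi.smul_apply, h0 t x hx, smul_zero]⟩

theorem isTest_zero : IsTest 0 where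
  smooth := contDiff_const
  compact_support := ⟨1 / 2, 1 / 2, by norm_num, by norm_num, fun _ _ _ => rfl⟩

/-- The triples `(f, D^{1/2} f, f_x)` for test functions `f`. The membership in `H` is membership
of `(u, D^{1/2} u, u_x)` in the closure of this subspace. -/
def testGraph : Submodule ℝ (L2 × L2 × L2) where
  carrier := {q | (∃ φ, IsTest φ ∧ q.1 =ᵐ[measQ] φ) ∧ HasFracDeriv (1 / 2) q.1 q.2.1 ∧
    HasDx q.1 q.2.2}
  add_mem' := by
    rintro p q ⟨⟨φ, hφ, h1⟩, h2, h3⟩ ⟨⟨ψ, hψ, h4⟩, h5, h6⟩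
    refine ⟨⟨φ + ψ, hφ.add hψ, ?_⟩, h2.add h5, h3.add h6⟩
    exact (Lp.coeFn_add _ _).trans (h1.add h4)
  zero_mem' := by
    refine ⟨⟨0, isTest_zero, Lp.coeFn_zero _ _ _⟩, ?_, ?_⟩
    · rw [hasFracDeriv_iff isXBasis_cosB]
      intro k n
      have := coef_smul isXBasis_cosB 0 0 (k, n)
      simp only [smul_zero, Complex.ofReal_zero, zero_mul] at this
      simp only [Prod.fst_zero, Prod.snd_zero]
      rw [this, mul_zero]
    · have := (HasDx.smul (u := 0) (b := 0) 0 (by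
        intro φ _
        have h0 := Lp.coeFn_zero ℝ 2 measQ
        rw [integral_eq_zero_of_ae, integral_eq_zero_of_ae, neg_zero]
        · filter_upwards [h0] with p hp
          rw [hp]; simp
        · filter_upwards [h0] with p hp
          rw [hp]; simp))
      simpa using this
  smul_mem' := by
    rintro r q ⟨⟨φ, hφ, h1⟩, h2, h3⟩
    refine ⟨⟨r • φ, hφ.smul r, ?_⟩, h2.smul r, h3.smul r⟩
    exact (Lp.coeFn_smul _ _).trans (h1.const_smul r)

theorem integral_fourier_mul_re (z : ℂ) (k l : ℤ) :
    ∫ t : UnitAddCircle, (fourier (-l) t : ℂ) * (((z * fourier k t).re : ℝ) : ℂ) =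
      ((if l = k then z else 0) + (if -l = k then (starRingEnd ℂ) z else 0)) / 2 := by
  have h2 : ∀ i j : ℤ, ∫ t : UnitAddCircle, (fourier (-i) t * fourier j t : ℂ) =
      if i = j then 1 else 0 := by
    intro i j
    have := fourierCoeff_fourier (T := 1) j
    have h3 := congrFun this i
    rw [fourierCoeff, ← volume_eq_haar] at h3
    simp only [smul_eq_mul] at h3
    rw [h3, Pi.single_apply]
  have e : ∀ t : UnitAddCircle, (fourier (-l) t : ℂ) * (((z * fourier k t).re : ℝ) : ℂ) =
      z / 2 * (fourier (-l) t * fourier k t) +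
      (starRingEnd ℂ) z / 2 * (fourier (-l) t * fourier (-k) t) := by
    intro t
    rw [Complex.re_eq_add_conj, map_mul, ← fourier_neg]; ring
  have hi : ∀ i j : ℤ, Integrable (fun t : UnitAddCircle => (fourier i t * fourier j t : ℂ)) :=
    fun i j => Continuous.integrable_of_hasCompactSupport (by fun_prop)
      (HasCompactSupport.of_compactSpace _)
  simp_rw [e]
  rw [integral_add ((hi _ _).const_mul _) ((hi _ _).const_mul _), integral_const_mul,
    integral_const_mul, h2, h2]
  split_ifs <;> first | ring1 | (exfalso; omega)

theorem coef_reTensor (z : ℂ) (k : ℤ) (η : ℝ → ℝ) (l : ℤ) (m : ℕ) :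
    coef γ (reTensor z k η) (l, m) =
      ((if l = k then z else 0) + (if -l = k then (starRingEnd ℂ) z else 0)) / 2 *
      ((∫ x in Ioo (0 : ℝ) 1, γ m x * η x : ℝ) : ℂ) := by
  rw [← integral_fourier_mul_re, ← integral_complex_ofReal, coef, coefC, measQ,
    ← integral_prod_mul (fun t : UnitAddCircle => (fourier (-l) t : ℂ) *
      (((z * fourier k t).re : ℝ) : ℂ)) (fun x : ℝ => ((γ m x * η x : ℝ) : ℂ))]
  congr 1; ext p
  rw [reTensor]
  push_cast; ring

theorem memLp_reTensor (z : ℂ) (k : ℤ) {η : ℝ → ℝ} (hη : Continuous η) :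
    MemLp (reTensor z k η) 2 measQ := memLp_of_continuous (continuous_reTensor z k hη) 2

theorem hasFracDeriv_reTensor (z : ℂ) (k : ℤ) {η : ℝ → ℝ} (hη : Continuous η) (s : ℝ) :
    HasFracDeriv s ((memLp_reTensor z k hη).toLp _)
      ((memLp_reTensor (fracSymbol s k * z) k hη).toLp _) := by
  rw [hasFracDeriv_iff isXBasis_cosB]
  intro l m
  rw [coef_congr (MemLp.coeFn_toLp _), coef_congr (MemLp.coeFn_toLp _), coef_reTensor,
    coef_reTensor, ← mul_assoc]
  congr 1
  by_cases h1 : l = k <;> by_cases h3 : -l = k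
  · subst h1
    have := fracSymbol_neg s l
    rw [h3] at this
    simp only [h3, if_true, map_mul, ← this]; ring
  · rw [if_pos h1, if_pos h1, if_neg h3, if_neg h3, h1]; ring
  · have : l = -k := by omega
    subst this
    rw [if_neg h1, if_neg h1, if_pos h3, if_pos h3, fracSymbol_neg, map_mul]; ring
  · simp [h1, h3]

theorem isC1x_reTensor (z : ℂ) (k : ℤ) {η η' : ℝ → ℝ} (hη' : Continuous η')
    (hd : ∀ x, HasDerivAt η (η' x) x) : IsC1x (reTensor z k η) (reTensor z k η') where
  cont := continuous_reTensor z k (continuous_iff_continuousAt.2 fun x => (hd x).continuousAt)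
  contx := continuous_reTensor z k hη'
  hasDeriv t x := (hd x).const_mul (z * fourier k t).re

theorem IsC1x.hasDx {f fx : UnitAddCircle × ℝ → ℝ} (h : IsC1x f fx) :
    HasDx ((memLp_of_continuous h.cont 2).toLp f) ((memLp_of_continuous h.contx 2).toLp fx) :=
  (h.coefDx.congr (MemLp.coeFn_toLp _) (MemLp.coeFn_toLp _)).hasDx

theorem reModeL_eq_toLp (hγ : IsXBasis γ) (z : ℂ) (i : ℤ × ℕ) :
    reModeL hγ z i = (memLp_reTensor z i.1 (hγ.continuous i.2)).toLp _ := by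
  ext1
  have h1 := coeFn_reModeL hγ z i
  rw [reMode_eq_reTensor] at h1
  exact h1.trans (MemLp.coeFn_toLp _).symm

theorem tendsto_reTensor (z : ℂ) (k : ℤ) {η : ℕ → ℝ → ℝ} {η' : ℝ → ℝ} {C : ℝ}
    (hc : ∀ N, Continuous (η N)) (hc' : Continuous η') (hb : ∀ N x, |η N x| ≤ C)
    (hlim : ∀ x ∈ Ioo (0 : ℝ) 1, Tendsto (fun N => η N x) atTop (𝓝 (η' x))) :
    Tendsto (fun N => (memLp_reTensor z k (hc N)).toLp _) atTop
      (𝓝 ((memLp_reTensor z k hc').toLp _)) := by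
  refine tendsto_toLp_of_dominated (B := fun _ => ‖z‖ * (C + C)) _ _ (memLp_const _) ?_ ?_
  · intro N
    filter_upwards [ae_mem_measQ] with p hp
    have h1 : |η' p.2| ≤ C := le_of_tendsto (hlim p.2 hp).abs (.of_forall fun N => hb N p.2)
    rw [reTensor, reTensor, ← mul_sub, abs_mul]
    gcongr
    · exact abs_re_mul_fourier_le z k p.1
    · exact (abs_sub _ _).trans (add_le_add (hb N _) h1)
  · filter_upwards [ae_mem_measQ] with p hp
    exact (hlim p.2 hp).const_mul _

/-- A single sine mode belongs to the closure of the test functions. -/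
theorem sineMode_mem_closure (z : ℂ) (k : ℤ) (n : ℕ) :
    (reModeL isXBasis_sinB z (k, n), reModeL isXBasis_sinB (fracSymbol (1 / 2) k * z) (k, n),
      reModeL isXBasis_cosB ((n + 1) * Real.pi * z) (k, n + 1)) ∈ testGraph.topologicalClosure := by
  obtain ⟨η, C, hη, hs, hC, hC', hlim⟩ := exists_cutoff_sinB n
  have hcont : ∀ N, Continuous (η N) := fun N => (hη N).continuous
  have hcont' : ∀ N, Continuous (deriv (η N)) := fun N => (hη N).continuous_deriv (by simp)
  have hl : ∀ x ∈ Ioo (0 : ℝ) 1, Tendsto (fun N => η N x) atTop (𝓝 (sinB n x)) := fun x hx => by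
    refine tendsto_const_nhds.congr' ?_
    filter_upwards [hlim x hx] with N hN
    rw [hN.eq_of_nhds]
  have hl' : ∀ x ∈ Ioo (0 : ℝ) 1, Tendsto (fun N => deriv (η N) x) atTop
      (𝓝 ((n + 1) * Real.pi * cosB (n + 1) x)) := fun x hx => by
    refine tendsto_const_nhds.congr' ?_
    filter_upwards [hlim x hx] with N hN
    rw [hN.deriv_eq, (hasDerivAt_sinB n x).deriv]
  have hcc : Continuous (fun x => (n + 1) * Real.pi * cosB (n + 1) x) :=
    continuous_const.mul (continuous_cosB (n + 1))
  have t1 := tendsto_reTensor z k hcont (continuous_sinB n) hC hl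
  have t2 := tendsto_reTensor (fracSymbol (1 / 2) k * z) k hcont (continuous_sinB n) hC hl
  have t3 := tendsto_reTensor z k hcont' hcc hC' hl'
  have e3 : reModeL isXBasis_cosB ((n + 1) * Real.pi * z) (k, n + 1) =
      (memLp_reTensor z k hcc).toLp _ := by
    rw [reModeL_eq_toLp]
    congr 1; ext p
    unfold reTensor
    have : ((n + 1) * Real.pi * z * fourier k p.1 : ℂ) =
      (((n + 1) * Real.pi : ℝ) : ℂ) * (z * fourier k p.1) := by push_cast; ring
    rw [this, Complex.re_ofReal_mul]; ring
  rw [e3, reModeL_eq_toLp, reModeL_eq_toLp]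
  refine isClosed_closure.mem_of_tendsto (t1.prodMk_nhds (t2.prodMk_nhds t3))
    (.of_forall fun N => subset_closure ?_)
  refine ⟨⟨_, isTest_reTensor z k (hη N) (hs N),
    MemLp.coeFn_toLp (memLp_reTensor z k (hcont N))⟩,
    hasFracDeriv_reTensor z k (hcont N) _, ?_⟩
  exact (isC1x_reTensor z k (hcont' N)
    (fun x => ((hη N).differentiable (by simp) x).hasDerivAt)).hasDx

theorem reModeL_zero (hγ : IsXBasis γ) (i : ℤ × ℕ) : reModeL hγ 0 i = 0 := by
  simp [reModeL]

/-- The sine expansion of `w` converges simultaneously in `L²(Q)` for `w`, `D^{1/2} w`, `w_x`. -/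
theorem mem_closure_testGraph {w a b : L2} (ha : HasFracDeriv (1 / 2) w a) (hb : CoefDxZero w b) :
    (w, a, b) ∈ testGraph.topologicalClosure := by
  have h1 := hasSum_reModeL isXBasis_sinB w
  have h2 := hasSum_reModeL isXBasis_sinB a
  have h3 := hasSum_reModeL isXBasis_cosB b
  rw [← hasSum_succ_iff (fun k => by rw [hb.1, reModeL_zero])] at h3
  refine isClosed_closure.mem_of_tendsto (h1.prodMk (h2.prodMk h3)) (.of_forall fun S => ?_)
  refine Submodule.sum_mem testGraph.topologicalClosure fun i _ => ?_
  have := sineMode_mem_closure (coef sinB w i) i.1 i.2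
  rw [← (hasFracDeriv_iff isXBasis_sinB).1 ha, ← hb.2] at this
  exact this

theorem mem_H_of_mem_closure {w a b : L2} (ha : HasFracDeriv (1 / 2) w a) (hb : HasDx w b)
    (h : (w, a, b) ∈ testGraph.topologicalClosure) : w ∈ H := by
  refine ⟨⟨⟨a, ha⟩, ⟨b, hb⟩⟩, fun ε hε => ?_⟩
  obtain ⟨⟨f, a', b'⟩, ⟨hf, hfa, hfb⟩, hd⟩ := Metric.mem_closure_iff.1 h (ε / 2) (by positivity)
  refine ⟨f, hf, ?_⟩
  rw [Prod.dist_eq, Prod.dist_eq, max_lt_iff, max_lt_iff, dist_eq_norm, dist_eq_norm,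
    dist_eq_norm] at hd
  rw [normHalfOne, (ha.sub hfa).fracDeriv_eq, (hb.sub hfb).dx_eq, Real.sqrt_lt' hε]
  obtain ⟨d1, d2, d3⟩ := hd
  have q : ∀ r : ℝ, 0 ≤ r → r < ε / 2 → r ^ 2 ≤ ε ^ 2 / 4 := fun r h0 h => by nlinarith
  have := q _ (norm_nonneg _) d1
  have := q _ (norm_nonneg _) d2
  have := q _ (norm_nonneg _) d3
  have : 0 < ε ^ 2 := by positivity
  linarith

theorem norm_coef_le (hγ : IsXBasis γ) (u : L2) (i : ℤ × ℕ) : ‖coef γ u i‖ ≤ ‖u‖ := by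
  have h := le_hasSum (hasSum_sq_coef hγ u) i (fun j _ => by positivity)
  exact le_of_sq_le_sq (by simpa using h) (norm_nonneg _)

/-- The relation `CoefDxZero` holds for test functions and is closed in `H^{1/2,1}(Q)`. -/
theorem coefDxZero_of_mem_H {w : L2} (hw : w ∈ H) : CoefDxZero w (dx w) := by
  obtain ⟨⟨_, b, hb⟩, happ⟩ := hw
  rw [hb.dx_eq]
  -- it suffices to bound the defect of each relation by the distance to the test functions
  have key : ∀ (k : ℤ) (n : ℕ) (α : ℝ) (F : L2 → L2 → ℂ),
      (∀ u v c d : L2, F (u - v) (c - d) = F u c - F v d) →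
      (∀ u c : L2, ‖F u c‖ ≤ ‖c‖ + α * ‖u‖) → 0 ≤ α →
      (∀ f c : L2, CoefDxZero f c → F f c = 0) → F w b = 0 := by
    intro k n α F hsub hle hα hF
    have hε : ∀ ε > 0, ‖F w b‖ ≤ ε * (1 + α) := by
      intro ε hε
      obtain ⟨f, ⟨φ, hφ, hfφ⟩, hlt⟩ := happ ε hε
      have hc := hφ.isC1x
      have hz := hc.coefDxZero hφ.zero_left hφ.zero_right
      let c : L2 := (memLp_of_continuous hc.contx 2).toLp _
      have hz' : CoefDxZero f c := hz.congr hfφ (MemLp.coeFn_toLp _)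
      have hd := hb.sub hz'.hasDx
      have h1 := hsub w f b c
      rw [hF f c hz', sub_zero] at h1
      rw [← h1]
      have h2 : ‖w - f‖ ≤ normHalfOne (w - f) := Real.le_sqrt_of_sq_le (by
        nlinarith [sq_nonneg ‖fracDeriv (1 / 2) (w - f)‖, sq_nonneg ‖dx (w - f)‖])
      have h3 : ‖b - c‖ ≤ normHalfOne (w - f) := Real.le_sqrt_of_sq_le (by
        rw [hd.dx_eq]
        nlinarith [sq_nonneg ‖fracDeriv (1 / 2) (w - f)‖, sq_nonneg ‖w - f‖])
      calc _ ≤ ‖b - c‖ + α * ‖w - f‖ := hle _ _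
        _ ≤ ε + α * ε := by gcongr <;> linarith
        _ = _ := by ring
    have hlim : Tendsto (fun ε : ℝ => ε * (1 + α)) (𝓝[>] 0) (𝓝 0) := by
      have : Continuous (fun ε : ℝ => ε * (1 + α)) := by fun_prop
      simpa using (this.tendsto 0).mono_left nhdsWithin_le_nhds
    exact norm_le_zero_iff.1 (ge_of_tendsto hlim (by
      filter_upwards [self_mem_nhdsWithin] with ε h using hε ε h))
  constructor
  · intro k
    refine key k 0 0 (fun u c => coef cosB c (k, 0)) ?_ ?_ le_rfl (fun f c h => h.1 k)
    · intro u v c d; exact coef_sub isXBasis_cosB _ _ _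
    · intro u c; simpa using norm_coef_le isXBasis_cosB c (k, 0)
  · intro k n
    have hπ := Real.pi_pos
    refine sub_eq_zero.1 (key k n ((n + 1) * Real.pi) (fun u c => coef cosB c (k, n + 1) -
      (n + 1) * Real.pi * coef sinB u (k, n)) ?_ ?_ (by positivity)
      (fun f c h => sub_eq_zero.2 (h.2 k n)))
    · intro u v c d
      simp only [coef_sub isXBasis_cosB, coef_sub isXBasis_sinB]; ring
    · intro u c
      refine (norm_sub_le _ _).trans (add_le_add (norm_coef_le isXBasis_cosB c _) ?_)
      rw [norm_mul, norm_succ_mul_pi]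
      gcongr
      exact norm_coef_le isXBasis_sinB u _

/-- The relation `CoefDxZero` encodes the vanishing boundary values: together with the existence of
`D^{1/2} w` it characterizes `H^{1/2,1}_0(Q)`. -/
theorem mem_H_of_coef {w a b : L2} (ha : HasFracDeriv (1 / 2) w a) (hb : CoefDxZero w b) :
    w ∈ H := mem_H_of_mem_closure ha hb.hasDx (mem_closure_testGraph ha hb)

/-! ### The embedding of `H^{1/2,1}_0(Q)` into `L⁴(Q)` -/

/-- The anisotropic weight `1 + |k| + m²` of the mode `e^{2πikt} e^{iπmx}`. -/
def weight (i : ℤ × ℤ) : ℝ := 1 + |(i.1 : ℝ)| + (i.2 : ℝ) ^ 2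

theorem one_le_weight (i : ℤ × ℤ) : 1 ≤ weight i := by
  unfold weight; nlinarith [abs_nonneg (i.1 : ℝ), sq_nonneg (i.2 : ℝ)]

theorem weight_pos (i : ℤ × ℤ) : 0 < weight i := one_pos.trans_le (one_le_weight i)

theorem summable_one_add_abs_rpow {a : ℝ} (ha : 1 < a) :
    Summable fun k : ℤ => (1 + |(k : ℝ)|) ^ (-a) := by
  have h : Summable fun n : ℕ => (1 + (n : ℝ)) ^ (-a) := by
    have h1 : Summable fun n : ℕ => (n : ℝ) ^ (-a) := Real.summable_nat_rpow.2 (by linarith)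
    have h2 := (summable_nat_add_iff 1).2 h1
    refine h2.congr fun n => ?_
    push_cast; rw [add_comm]
  refine Summable.of_nat_of_neg ?_ ?_
  · simpa using h
  · simpa using h

theorem summable_inv_weight_sq : Summable fun i : ℤ × ℤ => (weight i ^ 2)⁻¹ := by
  have h1 := summable_one_add_abs_rpow (a := 5 / 4) (by norm_num)
  have h2 := (summable_one_add_abs_rpow (a := 3 / 2) (by norm_num)).mul_left
    (2 ^ (3 / 4 : ℝ) : ℝ)
  have h3 := h1.mul_of_nonneg h2 (fun k => by positivity) (fun k => by positivity)
  refine h3.of_nonneg_of_le (fun i => by have := weight_pos i; positivity) fun i => ?_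
  have hω := weight_pos i
  set A : ℝ := 1 + |(i.1 : ℝ)| with hA
  set B : ℝ := 1 + |(i.2 : ℝ)| with hB
  have hA0 : 0 < A := by positivity
  have hB0 : 0 < B := by positivity
  have hAω : A ≤ weight i := by unfold weight; nlinarith [sq_nonneg (i.2 : ℝ)]
  have hBω : B ^ 2 / 2 ≤ weight i := by
    unfold weight
    nlinarith [sq_abs (i.2 : ℝ), sq_nonneg (|(i.2 : ℝ)| - 1), abs_nonneg (i.1 : ℝ)]
  -- split `weight²` so that each factor is summable in its own variable
  have e : (weight i ^ 2) = weight i ^ (5 / 4 : ℝ) * weight i ^ (3 / 4 : ℝ) := by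
    rw [← Real.rpow_add hω, ← Real.rpow_natCast]; norm_num
  have e2 : A ^ (-(5 / 4) : ℝ) * (2 ^ (3 / 4 : ℝ) * B ^ (-(3 / 2) : ℝ)) =
      (A ^ (5 / 4 : ℝ) * (B ^ 2 / 2) ^ (3 / 4 : ℝ))⁻¹ := by
    rw [Real.div_rpow (by positivity) (by norm_num), Real.rpow_neg hA0.le, Real.rpow_neg hB0.le,
      ← Real.rpow_natCast B 2, ← Real.rpow_mul hB0.le]
    norm_num
    field_simp
  rw [e2, e]
  gcongr

/-- The constant of the `L⁴` estimate. -/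
def weightConst : ℝ := ∑' i : ℤ × ℤ, (weight i ^ 2)⁻¹

theorem weightConst_nonneg : 0 ≤ weightConst :=
  tsum_nonneg fun i => by have := weight_pos i; positivity

section Quadruple
variable {ι : Type*}

/-- A fixed frequency `m` is a sum of two frequencies in boundedly many ways, in the weighted
sense. -/
theorem sum_inv_weight_mul_le {κ : ι → ℤ × ℤ} (hκ : Function.Injective κ) (S : Finset ι)
    (m : ℤ × ℤ) :
    ∑ r ∈ S ×ˢ S, (if κ r.1 + κ r.2 = m then (weight (κ r.1) * weight (κ r.2))⁻¹ else 0) ≤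
      weightConst := by
  have hle : ∑ i ∈ S, (weight (κ i) ^ 2)⁻¹ ≤ weightConst := by
    have h1 : ∑ i ∈ S, (weight (κ i) ^ 2)⁻¹ = ∑ i ∈ S.map ⟨κ, hκ⟩, (weight i ^ 2)⁻¹ := by
      rw [Finset.sum_map]; rfl
    rw [h1]
    exact summable_inv_weight_sq.sum_le_tsum _ fun i _ => by have := weight_pos i; positivity
  have hone : ∀ (c : ℝ), 0 ≤ c → ∀ (P : ι → Prop) [DecidablePred P],
      (∀ i j, P i → P j → i = j) → ∑ i ∈ S, (if P i then c else 0) ≤ c := by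
    intro c hc P _ hP
    rw [← Finset.sum_filter, Finset.sum_const, nsmul_eq_mul]
    have : (S.filter P).card ≤ 1 := Finset.card_le_one.2 fun i hi j hj =>
      hP i j (Finset.mem_filter.1 hi).2 (Finset.mem_filter.1 hj).2
    have h2 : ((S.filter P).card : ℝ) ≤ 1 := by exact_mod_cast this
    nlinarith
  have hpt : ∀ r ∈ S ×ˢ S,
      (if κ r.1 + κ r.2 = m then (weight (κ r.1) * weight (κ r.2))⁻¹ else 0) ≤
      (1 / 2) * (if κ r.1 + κ r.2 = m then (weight (κ r.1) ^ 2)⁻¹ else 0) +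
      (1 / 2) * (if κ r.1 + κ r.2 = m then (weight (κ r.2) ^ 2)⁻¹ else 0) := by
    intro r _
    split_ifs
    · rw [mul_inv, ← inv_pow, ← inv_pow]
      nlinarith [sq_nonneg ((weight (κ r.1))⁻¹ - (weight (κ r.2))⁻¹)]
    · simp
  refine (Finset.sum_le_sum hpt).trans ?_
  rw [Finset.sum_add_distrib, ← Finset.mul_sum, ← Finset.mul_sum, Finset.sum_product,
    Finset.sum_product_right]
  have a1 : ∑ i ∈ S, ∑ j ∈ S, (if κ i + κ j = m then (weight (κ i) ^ 2)⁻¹ else 0) ≤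
      weightConst := by
    refine (Finset.sum_le_sum fun i _ => ?_).trans hle
    refine hone _ (by have := weight_pos (κ i); positivity) (fun j => κ i + κ j = m) ?_
    intro j j' h h'
    exact hκ (add_left_cancel (h.trans h'.symm))
  have a2 : ∑ j ∈ S, ∑ i ∈ S, (if κ i + κ j = m then (weight (κ j) ^ 2)⁻¹ else 0) ≤
      weightConst := by
    refine (Finset.sum_le_sum fun i _ => ?_).trans hle
    refine hone _ (by have := weight_pos (κ i); positivity) (fun j => κ j + κ i = m) ?_
    intro j j' h h'
    exact hκ (add_right_cancel (h.trans h'.symm))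
  linarith

/-- The quadruple sum that computes an `L⁴` norm is controlled by the weighted `ℓ²` norm. -/
theorem sum_quadruple_le {κ : ι → ℤ × ℤ} (hκ : Function.Injective κ) (S : Finset ι)
    (β : ι → ℝ) :
    ∑ q ∈ S ×ˢ S, ∑ r ∈ S ×ˢ S,
      (if κ q.1 + κ q.2 = κ r.1 + κ r.2 then (β q.1 * β q.2) * (β r.1 * β r.2) else 0) ≤
      weightConst * (∑ i ∈ S, weight (κ i) * β i ^ 2) ^ 2 := by
  let W : ι × ι → ℝ := fun q => weight (κ q.1) * weight (κ q.2)
  let b : ι × ι → ℝ := fun q => β q.1 * β q.2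
  let s : ι × ι → ℤ × ℤ := fun q => κ q.1 + κ q.2
  have hW : ∀ q, 0 < W q := fun q => mul_pos (weight_pos _) (weight_pos _)
  have hpt : ∀ q r, (if s q = s r then b q * b r else 0) ≤
      (1 / 2) * ((b q ^ 2 * W q) * (if s r = s q then (W r)⁻¹ else 0)) +
      (1 / 2) * ((b r ^ 2 * W r) * (if s q = s r then (W q)⁻¹ else 0)) := by
    intro q r
    by_cases h : s q = s r
    · rw [if_pos h, if_pos h, if_pos h.symm]
      have h1 := hW q
      have h2 := hW r
      have e : (1 / 2) * ((b q ^ 2 * W q) * (W r)⁻¹) + (1 / 2) * ((b r ^ 2 * W r) * (W q)⁻¹) -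
          b q * b r = (1 / 2) * (b q * W q - b r * W r) ^ 2 * ((W q)⁻¹ * (W r)⁻¹) := by
        field_simp
        ring
      have : 0 ≤ (1 / 2) * (b q * W q - b r * W r) ^ 2 * ((W q)⁻¹ * (W r)⁻¹) := by positivity
      linarith
    · rw [if_neg h, if_neg h, if_neg (Ne.symm h)]; simp
  have hT : ∀ q, ∑ r ∈ S ×ˢ S, (if s r = s q then (W r)⁻¹ else 0) ≤ weightConst :=
    fun q => sum_inv_weight_mul_le hκ S (s q)
  have hmain : ∑ q ∈ S ×ˢ S, (b q ^ 2 * W q) * ∑ r ∈ S ×ˢ S, (if s r = s q then (W r)⁻¹ else 0) ≤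
      weightConst * (∑ i ∈ S, weight (κ i) * β i ^ 2) ^ 2 := by
    calc _ ≤ ∑ q ∈ S ×ˢ S, (b q ^ 2 * W q) * weightConst := by
          refine Finset.sum_le_sum fun q _ => ?_
          have := hW q
          exact mul_le_mul_of_nonneg_left (hT q) (by positivity)
      _ = _ := by
          rw [← Finset.sum_mul, mul_comm, sq, Finset.sum_mul_sum, Finset.sum_product]
          congr 1
          refine Finset.sum_congr rfl fun i _ => Finset.sum_congr rfl fun j _ => ?_
          simp only [b, W]; ring
  calc _ ≤ ∑ q ∈ S ×ˢ S, ∑ r ∈ S ×ˢ S,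
        ((1 / 2) * ((b q ^ 2 * W q) * (if s r = s q then (W r)⁻¹ else 0)) +
        (1 / 2) * ((b r ^ 2 * W r) * (if s q = s r then (W q)⁻¹ else 0))) :=
        Finset.sum_le_sum fun q _ => Finset.sum_le_sum fun r _ => hpt q r
    _ = (1 / 2) * ∑ q ∈ S ×ˢ S, (b q ^ 2 * W q) *
          ∑ r ∈ S ×ˢ S, (if s r = s q then (W r)⁻¹ else 0) +
        (1 / 2) * ∑ r ∈ S ×ˢ S, (b r ^ 2 * W r) *
          ∑ q ∈ S ×ˢ S, (if s q = s r then (W q)⁻¹ else 0) := by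
        simp only [Finset.sum_add_distrib, Finset.mul_sum]
        congr 1
        rw [Finset.sum_comm]
    _ ≤ _ := by linarith

end Quadruple

/-- The measure `dt dx` on `𝕋 × (-1,1)`, a period of the functions `e^{2πikt} e^{iπmx}`. -/
def measDouble : Measure (UnitAddCircle × ℝ) :=
  (volume : Measure UnitAddCircle).prod ((volume : Measure ℝ).restrict (Ioo (-1) 1))

instance : IsFiniteMeasure measDouble := by
  unfold measDouble; infer_instance

/-- The function `e^{2πikt} e^{iπmx}`. -/
def expMode (i : ℤ × ℤ) (p : UnitAddCircle × ℝ) : ℂ :=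
  fourier i.1 p.1 * Complex.exp (Real.pi * Complex.I * i.2 * p.2)

theorem continuous_expMode (i : ℤ × ℤ) : Continuous (expMode i) := by
  unfold expMode; fun_prop

theorem expMode_add (i j : ℤ × ℤ) (p : UnitAddCircle × ℝ) :
    expMode (i + j) p = expMode i p * expMode j p := by
  simp only [expMode, Prod.fst_add, Prod.snd_add, fourier_add]
  push_cast
  rw [mul_add, add_mul, Complex.exp_add]; ring

theorem conj_expMode (i : ℤ × ℤ) (p : UnitAddCircle × ℝ) :
    (starRingEnd ℂ) (expMode i p) = expMode (-i) p := by
  simp only [expMode, map_mul, Prod.fst_neg, Prod.snd_neg, fourier_neg, ← Complex.exp_conj,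
    Complex.conj_ofReal, Complex.conj_I, map_intCast]
  push_cast
  congr 2; ring

theorem norm_expMode (i : ℤ × ℤ) (p : UnitAddCircle × ℝ) : ‖expMode i p‖ = 1 := by
  rw [expMode, norm_mul, norm_fourier_apply, one_mul,
    show (Real.pi * Complex.I * i.2 * p.2 : ℂ) = ((Real.pi * i.2 * p.2 : ℝ) : ℂ) * Complex.I by
      push_cast; ring, Complex.norm_exp_ofReal_mul_I]

theorem integrable_expMode (c : ℂ) (i : ℤ × ℤ) :
    Integrable (fun p => c * expMode i p) measDouble :=
  Integrable.of_bound (continuous_const.mul (continuous_expMode i)).aestronglyMeasurable ‖c‖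
    (.of_forall fun p => by rw [norm_mul, norm_expMode, mul_one])

theorem integral_expMode (i : ℤ × ℤ) :
    ∫ p, expMode i p ∂measDouble = if i = 0 then 2 else 0 := by
  have h1 : ∫ t : UnitAddCircle, (fourier i.1 t : ℂ) = if i.1 = 0 then 1 else 0 := by
    have h3 := congrFun (fourierCoeff_fourier (T := 1) i.1) 0
    rw [fourierCoeff, ← volume_eq_haar] at h3
    simp only [neg_zero, fourier_zero, one_smul, Pi.single_apply] at h3
    simpa [eq_comm] using h3
  have h2 : ∫ x in Ioo (-1 : ℝ) 1, Complex.exp (Real.pi * Complex.I * i.2 * x) =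
      if i.2 = 0 then 2 else 0 := by
    rw [← integral_Ioc_eq_integral_Ioo, ← intervalIntegral.integral_of_le (by norm_num)]
    split_ifs with h
    · rw [h]; simp; norm_num
    · have hc : (Real.pi * Complex.I * i.2 : ℂ) ≠ 0 := by
        simp [h, Real.pi_ne_zero]
      rw [integral_exp_mul_complex hc, div_eq_zero_iff]
      left
      rw [sub_eq_zero, Complex.exp_eq_exp_iff_exists_int]
      exact ⟨i.2, by push_cast; ring⟩
  unfold expMode measDouble
  rw [integral_prod_mul (fun t : UnitAddCircle => (fourier i.1 t : ℂ))
    (fun x : ℝ => Complex.exp (Real.pi * Complex.I * i.2 * x)), h1, h2]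
  by_cases ha : i.1 = 0 <;> by_cases hb : i.2 = 0 <;> simp [ha, hb, Prod.ext_iff]

/-- Orthogonality: only pairs of equal frequencies contribute to the `L²` norm. -/
theorem integral_normSq_sum_expMode_le {ι : Type*} (T : Finset ι) (B : ι → ℂ) (s : ι → ℤ × ℤ) :
    ∫ p, ‖∑ q ∈ T, B q * expMode (s q) p‖ ^ 2 ∂measDouble ≤
      2 * ∑ q ∈ T, ∑ r ∈ T, (if s q = s r then ‖B q‖ * ‖B r‖ else 0) := by
  have e : ∀ p, ((‖∑ q ∈ T, B q * expMode (s q) p‖ ^ 2 : ℝ) : ℂ) =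
      ∑ q ∈ T, ∑ r ∈ T, (B q * (starRingEnd ℂ) (B r)) * expMode (s q - s r) p := by
    intro p
    rw [← Complex.normSq_eq_norm_sq, ← Complex.mul_conj, map_sum, Finset.sum_mul_sum]
    refine Finset.sum_congr rfl fun q _ => Finset.sum_congr rfl fun r _ => ?_
    rw [map_mul, conj_expMode, sub_eq_add_neg, expMode_add]; ring
  have h : ((∫ p, ‖∑ q ∈ T, B q * expMode (s q) p‖ ^ 2 ∂measDouble : ℝ) : ℂ) =
      ∑ q ∈ T, ∑ r ∈ T, (B q * (starRingEnd ℂ) (B r)) * (if s q = s r then 2 else 0) := by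
    rw [← integral_complex_ofReal]
    simp_rw [e]
    rw [integral_finsetSum _ fun q _ => integrable_finsetSum _ fun r _ => integrable_expMode _ _]
    refine Finset.sum_congr rfl fun q _ => ?_
    rw [integral_finsetSum _ fun r _ => integrable_expMode _ _]
    refine Finset.sum_congr rfl fun r _ => ?_
    rw [integral_const_mul, integral_expMode]
    simp only [sub_eq_zero]
  refine (Real.le_norm_self _).trans ?_
  rw [← Complex.norm_real, h, Finset.mul_sum]
  refine (norm_sum_le _ _).trans (Finset.sum_le_sum fun q _ => ?_)
  rw [Finset.mul_sum]
  refine (norm_sum_le _ _).trans (Finset.sum_le_sum fun r _ => ?_)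
  split_ifs
  · rw [norm_mul, norm_mul, RCLike.norm_conj]
    simp; linarith
  · simp

/-- The `L⁴` estimate for trigonometric polynomials. -/
theorem integral_norm_pow_four_sum_expMode_le {ι : Type*} {κ : ι → ℤ × ℤ}
    (hκ : Function.Injective κ) (S : Finset ι) (b : ι → ℂ) :
    ∫ p, ‖∑ i ∈ S, b i * expMode (κ i) p‖ ^ 4 ∂measDouble ≤
      2 * weightConst * (∑ i ∈ S, weight (κ i) * ‖b i‖ ^ 2) ^ 2 := by
  have e : ∀ p, ‖∑ i ∈ S, b i * expMode (κ i) p‖ ^ 4 =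
      ‖∑ q ∈ S ×ˢ S, (b q.1 * b q.2) * expMode (κ q.1 + κ q.2) p‖ ^ 2 := by
    intro p
    rw [show 4 = 2 * 2 from rfl, pow_mul, ← norm_pow, sq (∑ i ∈ S, _), Finset.sum_mul_sum,
      Finset.sum_product]
    congr 2
    refine Finset.sum_congr rfl fun q _ => Finset.sum_congr rfl fun r _ => ?_
    rw [expMode_add]; ring
  simp_rw [e]
  refine (integral_normSq_sum_expMode_le _ _ _).trans ?_
  rw [mul_assoc]
  refine mul_le_mul_of_nonneg_left ?_ zero_le_two
  simp only [norm_mul]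
  exact sum_quadruple_le hκ S fun i => ‖b i‖

/-- The weight of the sine mode `e^{2πikt} sin ((n+1)πx)`. -/
def sinWeight (i : ℤ × ℕ) : ℝ := weight (i.1, (i.2 + 1 : ℕ))

theorem sinWeight_pos (i : ℤ × ℕ) : 0 < sinWeight i := weight_pos _

theorem sinWeight_eq (i : ℤ × ℕ) : sinWeight i = 1 + |(i.1 : ℝ)| + ((i.2 : ℝ) + 1) ^ 2 := by
  simp [sinWeight, weight]

/-- Finite sums of real parts of modes. -/
def partialSum (γ : ℕ → ℝ → ℝ) (d : ℤ × ℕ → ℂ) (S : Finset (ℤ × ℕ)) (p : UnitAddCircle × ℝ) : ℝ :=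
  ∑ i ∈ S, reMode γ (d i) i p

theorem continuous_reMode (hγ : ∀ n, Continuous (γ n)) (z : ℂ) (i : ℤ × ℕ) :
    Continuous (reMode γ z i) := by
  rw [reMode_eq_reTensor]; exact continuous_reTensor _ _ (hγ _)

theorem continuous_partialSum (hγ : ∀ n, Continuous (γ n)) (d : ℤ × ℕ → ℂ) (S : Finset (ℤ × ℕ)) :
    Continuous (partialSum γ d S) :=
  continuous_finsetSum _ fun i _ => continuous_reMode hγ (d i) i

theorem coeFn_sum_reModeL (hγ : IsXBasis γ) (d : ℤ × ℕ → ℂ) (S : Finset (ℤ × ℕ)) :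
    ((∑ i ∈ S, reModeL hγ (d i) i : L2) : UnitAddCircle × ℝ → ℝ) =ᵐ[measQ] partialSum γ d S := by
  classical
  induction S using Finset.induction_on with
  | empty =>
    simp only [Finset.sum_empty]
    filter_upwards [Lp.coeFn_zero ℝ 2 measQ] with p hp
    rw [hp]; simp [partialSum]
  | insert i S hi ih =>
    rw [Finset.sum_insert hi]
    filter_upwards [Lp.coeFn_add (reModeL hγ (d i) i) (∑ i ∈ S, reModeL hγ (d i) i), ih,
      coeFn_reModeL hγ (d i) i] with p h1 h2 h3
    rw [h1, Pi.add_apply, h2, h3, partialSum, partialSum, Finset.sum_insert hi]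

theorem measQ_le_measDouble : measQ ≤ measDouble :=
  Measure.prod_mono le_rfl (Measure.restrict_mono (Ioo_subset_Ioo (by norm_num) le_rfl) le_rfl)

/-- Sine modes as combinations of two exponential modes. -/
theorem modeFun_sinB (i : ℤ × ℕ) (p : UnitAddCircle × ℝ) :
    modeFun sinB i p = (√2 / (2 * Complex.I)) * expMode (i.1, (i.2 + 1 : ℕ)) p -
      (√2 / (2 * Complex.I)) * expMode (i.1, -(i.2 + 1 : ℕ)) p := by
  simp only [modeFun, sinB, expMode, Complex.ofReal_mul, Complex.ofReal_sin, Complex.sin]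
  push_cast
  have e1 : Complex.exp (-((i.2 + 1) * Real.pi * p.2) * Complex.I) =
    Complex.exp (Real.pi * Complex.I * (-1 + -i.2) * p.2) := by congr 1; ring
  have e2 : Complex.exp ((i.2 + 1) * Real.pi * p.2 * Complex.I) =
    Complex.exp (Real.pi * Complex.I * (i.2 + 1) * p.2) := by congr 1; ring
  rw [show (-(i.2 + 1) : ℂ) = -1 + -i.2 by ring, e1, e2]
  field_simp
  rw [Complex.I_sq]
  ring

/-- The `L⁴` estimate for finite sums of sine modes. -/
theorem integral_partialSum_sinB_pow_four_le (d : ℤ × ℕ → ℂ) (S : Finset (ℤ × ℕ)) :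
    ∫ p, (partialSum sinB d S p) ^ 4 ∂measQ ≤
      32 * weightConst * (∑ i ∈ S, sinWeight i * ‖d i‖ ^ 2) ^ 2 := by
  let κ₁ : ℤ × ℕ → ℤ × ℤ := fun i => (i.1, (i.2 + 1 : ℕ))
  let κ₂ : ℤ × ℕ → ℤ × ℤ := fun i => (i.1, -(i.2 + 1 : ℕ))
  have hκ₁ : Function.Injective κ₁ := by
    rintro ⟨k, n⟩ ⟨l, m⟩ h
    simp only [κ₁, Prod.mk.injEq] at h
    ext <;> simp <;> omega
  have hκ₂ : Function.Injective κ₂ := by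
    rintro ⟨k, n⟩ ⟨l, m⟩ h
    simp only [κ₂, Prod.mk.injEq] at h
    ext <;> simp <;> omega
  let b : ℤ × ℕ → ℂ := fun i => d i * (√2 / (2 * Complex.I))
  have hb : ∀ i, ‖b i‖ ^ 2 ≤ ‖d i‖ ^ 2 := by
    intro i
    have : ‖(√2 / (2 * Complex.I) : ℂ)‖ ≤ 1 := by
      rw [norm_div, norm_mul, Complex.norm_I, Complex.norm_real, Real.norm_of_nonneg
          (by positivity)]
      have := sqrt_two_le_two
      simp; linarith
    simp only [b, norm_mul]
    gcongr
    exact mul_le_of_le_one_right (norm_nonneg _) this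
  let P : (ℤ × ℕ → ℤ × ℤ) → UnitAddCircle × ℝ → ℂ := fun κ p => ∑ i ∈ S, b i * expMode (κ i) p
  have hP : ∀ κ, Continuous (P κ) := fun κ =>
    continuous_finsetSum _ fun i _ => continuous_const.mul (continuous_expMode _)
  have hPi : ∀ κ, Integrable (fun p => ‖P κ p‖ ^ 4) measDouble := by
    intro κ
    have hbd : ∀ p, ‖P κ p‖ ≤ ∑ i ∈ S, ‖b i‖ := fun p =>
      (norm_sum_le _ _).trans (Finset.sum_le_sum fun i _ => by
        rw [norm_mul, norm_expMode, mul_one])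
    refine Integrable.of_bound ((hP κ).norm.pow 4).aestronglyMeasurable ((∑ i ∈ S, ‖b i‖) ^ 4)
      (.of_forall fun p => ?_)
    rw [Real.norm_of_nonneg (by positivity)]
    gcongr
    exact hbd p
  have hpt : ∀ p, (partialSum sinB d S p) ^ 4 ≤ 8 * ‖P κ₁ p‖ ^ 4 + 8 * ‖P κ₂ p‖ ^ 4 := by
    intro p
    have h1 : partialSum sinB d S p = (P κ₁ p - P κ₂ p).re := by
      simp only [partialSum, reMode, P, ← Finset.sum_sub_distrib, Complex.re_sum, b]
      refine Finset.sum_congr rfl fun i _ => ?_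
      rw [modeFun_sinB]
      congr 1; simp only [κ₁, κ₂]; ring
    have h2 : |partialSum sinB d S p| ≤ ‖P κ₁ p‖ + ‖P κ₂ p‖ := by
      rw [h1]
      exact (Complex.abs_re_le_norm _).trans (norm_sub_le _ _)
    have h3 : (partialSum sinB d S p) ^ 4 ≤ (‖P κ₁ p‖ + ‖P κ₂ p‖) ^ 4 := by
      rw [← Even.pow_abs (by decide : Even 4)]
      gcongr
    refine h3.trans ?_
    set x := ‖P κ₁ p‖
    set y := ‖P κ₂ p‖
    nlinarith [sq_nonneg (x - y), sq_nonneg (x + y), mul_nonneg (sq_nonneg (x - y))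
        (sq_nonneg (x + y)),
      sq_nonneg (x ^ 2 - y ^ 2), mul_nonneg (sq_nonneg (x - y)) (sq_nonneg (x - y))]
  have hsum : ∀ κ : ℤ × ℕ → ℤ × ℤ, Function.Injective κ → (∀ i, weight (κ i) = sinWeight i) →
      ∫ p, ‖P κ p‖ ^ 4 ∂measDouble ≤
        2 * weightConst * (∑ i ∈ S, sinWeight i * ‖d i‖ ^ 2) ^ 2 := by
    intro κ hκ hw
    refine (integral_norm_pow_four_sum_expMode_le hκ S b).trans ?_
    have hC := weightConst_nonneg
    have h0 : ∀ i, 0 ≤ sinWeight i := fun i => (sinWeight_pos i).le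
    simp only [hw]
    gcongr with i
    · exact Finset.sum_nonneg fun i _ => mul_nonneg (h0 i) (sq_nonneg _)
    · exact h0 i
    · exact le_of_sq_le_sq (hb i) (norm_nonneg _)
  calc ∫ p, (partialSum sinB d S p) ^ 4 ∂measQ
      ≤ ∫ p, (8 * ‖P κ₁ p‖ ^ 4 + 8 * ‖P κ₂ p‖ ^ 4) ∂measQ := by
        refine integral_mono_of_nonneg (.of_forall fun p => by positivity) ?_ (.of_forall hpt)
        exact (((hPi _).const_mul 8).add ((hPi _).const_mul 8)).mono_measure measQ_le_measDouble
    _ ≤ ∫ p, (8 * ‖P κ₁ p‖ ^ 4 + 8 * ‖P κ₂ p‖ ^ 4) ∂measDouble :=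
        integral_mono_measure measQ_le_measDouble (.of_forall fun p => by positivity)
          (((hPi _).const_mul 8).add ((hPi _).const_mul 8))
    _ = 8 * ∫ p, ‖P κ₁ p‖ ^ 4 ∂measDouble + 8 * ∫ p, ‖P κ₂ p‖ ^ 4 ∂measDouble := by
        rw [integral_add ((hPi _).const_mul 8) ((hPi _).const_mul 8), integral_const_mul,
          integral_const_mul]
    _ ≤ _ := by
        have h1 := hsum κ₁ hκ₁ (fun i => rfl)
        have h2 := hsum κ₂ hκ₂ (fun i => by simp [sinWeight, weight, κ₂]; ring)
        linarith

theorem eLpNorm_partialSum_sinB_le (d : ℤ × ℕ → ℂ) (S : Finset (ℤ × ℕ)) :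
    eLpNorm (partialSum sinB d S) 4 measQ ≤
      ENNReal.ofReal ((32 * weightConst * (∑ i ∈ S, sinWeight i * ‖d i‖ ^ 2) ^ 2) ^ (1 / 4 : ℝ))
          := by
  have hm := memLp_of_continuous (continuous_partialSum continuous_sinB d S) 4
  rw [hm.eLpNorm_eq_integral_rpow_norm (by norm_num) (by norm_num)]
  have e : ∀ p, ‖partialSum sinB d S p‖ ^ (ENNReal.toReal 4) = (partialSum sinB d S p) ^ 4 := by
    intro p
    rw [show ENNReal.toReal 4 = ((4 : ℕ) : ℝ) by simp, Real.rpow_natCast, Real.norm_eq_abs,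
      Even.pow_abs (by decide)]
  simp_rw [e]
  refine ENNReal.ofReal_le_ofReal ?_
  rw [show (ENNReal.toReal 4)⁻¹ = (1 / 4 : ℝ) by simp]
  exact Real.rpow_le_rpow (integral_nonneg fun p => by positivity)
    (integral_partialSum_sinB_pow_four_le d S) (by norm_num)

/-- Lower semicontinuity of the `L⁴` norm under `L²` convergence. -/
theorem eLpNorm_le_of_tendsto {f : ℕ → L2} {g : L2} (h : Tendsto f atTop (𝓝 g)) {K : ENNReal}
    (hK : ∀ᶠ N in atTop, eLpNorm (f N) 4 measQ ≤ K) : eLpNorm g 4 measQ ≤ K := by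
  have hm : TendstoInMeasure measQ (fun N => (f N : UnitAddCircle × ℝ → ℝ)) atTop g :=
    tendstoInMeasure_of_tendsto_Lp h
  obtain ⟨ns, hns, hae⟩ := hm.exists_seq_tendsto_ae
  refine (Lp.eLpNorm_lim_le_liminf_eLpNorm (fun n => (Lp.aestronglyMeasurable _)) _ hae).trans ?_
  refine liminf_le_of_frequently_le' ?_
  exact (hns.tendsto_atTop.eventually hK).frequently

/-- Exhausting boxes of indices of sine modes. -/
def sinBox (N : ℕ) : Finset (ℤ × ℕ) := Finset.Icc (-N : ℤ) N ×ˢ Finset.range N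

/-- Exhausting boxes of indices of cosine modes, with one more mode in space than `sinBox N`, so
that differentiation in space maps cosine sums over `cosBox N` to sine sums over `sinBox N`. -/
def cosBox (N : ℕ) : Finset (ℤ × ℕ) := Finset.Icc (-N : ℤ) N ×ˢ Finset.range (N + 1)

theorem tendsto_sinBox : Tendsto sinBox atTop atTop := by
  refine tendsto_atTop_finset_of_monotone (fun N M h => ?_) fun i => ⟨i.1.natAbs + i.2 + 1, ?_⟩
  · exact Finset.product_subset_product (Finset.Icc_subset_Icc (by omega) (by omega))
      (Finset.range_subset_range.2 h)
  · simp only [sinBox, Finset.mem_product, Finset.mem_Icc, Finset.mem_range]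
    omega

theorem tendsto_cosBox : Tendsto cosBox atTop atTop := by
  refine tendsto_atTop_finset_of_monotone (fun N M h => ?_) fun i => ⟨i.1.natAbs + i.2 + 1, ?_⟩
  · exact Finset.product_subset_product (Finset.Icc_subset_Icc (by omega) (by omega))
      (Finset.range_subset_range.2 (by omega))
  · simp only [cosBox, Finset.mem_product, Finset.mem_Icc, Finset.mem_range]
    omega

theorem eLpNorm_sub_partialSum_le (u : L2)
    (hs : Summable fun i => sinWeight i * ‖coef sinB u i‖ ^ 2) (S : Finset (ℤ × ℕ)) :
    eLpNorm (fun p => u p - partialSum sinB (coef sinB u) S p) 4 measQ ≤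
      ENNReal.ofReal ((32 * weightConst * ((∑' i, sinWeight i * ‖coef sinB u i‖ ^ 2) -
        ∑ i ∈ S, sinWeight i * ‖coef sinB u i‖ ^ 2) ^ 2) ^ (1 / 4 : ℝ)) := by
  classical
  have hnn : ∀ i, 0 ≤ sinWeight i * ‖coef sinB u i‖ ^ 2 := fun i =>
    mul_nonneg (sinWeight_pos i).le (sq_nonneg _)
  let part : Finset (ℤ × ℕ) → L2 := fun T => ∑ i ∈ T, reModeL isXBasis_sinB (coef sinB u i) i
  have h1 : Tendsto (fun N => part (sinBox N) - part S) atTop (𝓝 (u - part S)) :=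
    ((hasSum_reModeL isXBasis_sinB u).comp tendsto_sinBox).sub_const _
  have hcong : (u - part S : L2) =ᵐ[measQ] fun p => u p - partialSum sinB (coef sinB u) S p := by
    filter_upwards [Lp.coeFn_sub u (part S), coeFn_sum_reModeL isXBasis_sinB (coef sinB u) S]
      with p a1 a2
    rw [a1, Pi.sub_apply, a2]
  rw [← eLpNorm_congr_ae hcong]
  refine eLpNorm_le_of_tendsto h1 ?_
  filter_upwards [tendsto_sinBox.eventually_ge_atTop S] with N hN
  have e : part (sinBox N) - part S = part (sinBox N \ S) := by
    rw [sub_eq_iff_eq_add]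
    exact (Finset.sum_sdiff hN).symm
  rw [e, eLpNorm_congr_ae (coeFn_sum_reModeL isXBasis_sinB (coef sinB u) (sinBox N \ S))]
  refine (eLpNorm_partialSum_sinB_le _ _).trans (ENNReal.ofReal_le_ofReal ?_)
  have hC := weightConst_nonneg
  have h2 : ∑ i ∈ sinBox N \ S, sinWeight i * ‖coef sinB u i‖ ^ 2 ≤
      (∑' i, sinWeight i * ‖coef sinB u i‖ ^ 2) -
        ∑ i ∈ S, sinWeight i * ‖coef sinB u i‖ ^ 2 := by
    rw [le_sub_iff_add_le, Finset.sum_sdiff hN]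
    exact hs.sum_le_tsum _ fun i _ => hnn i
  have h3 : 0 ≤ ∑ i ∈ sinBox N \ S, sinWeight i * ‖coef sinB u i‖ ^ 2 :=
    Finset.sum_nonneg fun i _ => hnn i
  gcongr

theorem memLp_four_of_summable (u : L2)
    (hs : Summable fun i => sinWeight i * ‖coef sinB u i‖ ^ 2) : MemLp u 4 measQ := by
  refine ⟨(Lp.memLp u).1, ?_⟩
  have := eLpNorm_sub_partialSum_le u hs ∅
  simp only [partialSum, Finset.sum_empty, sub_zero] at this
  exact this.trans_lt ENNReal.ofReal_lt_top

theorem tendsto_partialSum_four (u : L2)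
    (hs : Summable fun i => sinWeight i * ‖coef sinB u i‖ ^ 2) :
    Tendsto (fun N => eLpNorm (fun p => u p - partialSum sinB (coef sinB u) (sinBox N) p) 4 measQ)
      atTop (𝓝 0) := by
  have h1 : Tendsto (fun N => (∑' i, sinWeight i * ‖coef sinB u i‖ ^ 2) -
      ∑ i ∈ sinBox N, sinWeight i * ‖coef sinB u i‖ ^ 2) atTop (𝓝 0) := by
    have := (hs.hasSum.comp tendsto_sinBox).const_sub (∑' i, sinWeight i * ‖coef sinB u i‖ ^ 2)
    rwa [sub_self] at this
  have h2 : Tendsto (fun x : ℝ => ENNReal.ofReal ((32 * weightConst * x ^ 2) ^ (1 / 4 : ℝ)))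
      (𝓝 0) (𝓝 0) := by
    have : Continuous (fun x : ℝ => ENNReal.ofReal ((32 * weightConst * x ^ 2) ^ (1 / 4 : ℝ))) := by
      refine ENNReal.continuous_ofReal.comp ?_
      exact (by fun_prop : Continuous fun x : ℝ => 32 * weightConst * x ^ 2).rpow_const
        (fun x => Or.inr (by norm_num))
    simpa using this.tendsto 0
  exact tendsto_of_tendsto_of_tendsto_of_le_of_le tendsto_const_nhds (h2.comp h1)
    (fun _ => zero_le) (fun N => eLpNorm_sub_partialSum_le u hs (sinBox N))

/-- The norm of `H^{1/2,1}_0(Q)` is a weighted `ℓ²` norm of the sine coefficients. -/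
theorem summable_sinWeight_of_mem_H {w : L2} (hw : w ∈ H) :
    Summable fun i => sinWeight i * ‖coef sinB w i‖ ^ 2 := by
  have hz := coefDxZero_of_mem_H hw
  obtain ⟨⟨⟨a, ha⟩, -⟩, -⟩ := hw
  have h0 := (hasSum_sq_coef isXBasis_sinB w).summable
  have h1 := (hasSum_sq_coef isXBasis_sinB a).summable
  have h2 := (hasSum_sq_coef isXBasis_cosB (dx w)).summable
  have h3 : Summable fun i : ℤ × ℕ => ‖coef cosB (dx w) (i.1, i.2 + 1)‖ ^ 2 :=
    ((hasSum_succ_iff (f := fun i => ‖coef cosB (dx w) i‖ ^ 2)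
      (fun k => by simp [hz.1])).2 h2.hasSum).summable
  refine ((h0.add h1).add h3).of_nonneg_of_le
    (fun i => mul_nonneg (sinWeight_pos i).le (sq_nonneg _)) fun i => ?_
  rw [hz.2, (hasFracDeriv_iff isXBasis_sinB).1 ha i.1 i.2, norm_mul, norm_mul, mul_pow, mul_pow,
    norm_fracSymbol_half_sq, sinWeight_eq]
  rw [norm_succ_mul_pi]
  have hp := Real.pi_gt_three
  have hs := sq_nonneg ‖coef sinB w (i.1, i.2)‖
  have q1 : |(i.1 : ℝ)| ≤ 2 * Real.pi * |(i.1 : ℝ)| := by nlinarith [abs_nonneg (i.1 : ℝ)]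
  have q2 : ((i.2 : ℝ) + 1) ^ 2 ≤ ((i.2 + 1) * Real.pi) ^ 2 := by
    rw [mul_pow]; exact le_mul_of_one_le_right (sq_nonneg _) (by nlinarith)
  calc _ ≤ (1 + 2 * Real.pi * |(i.1 : ℝ)| + ((i.2 + 1) * Real.pi) ^ 2) *
        ‖coef sinB w (i.1, i.2)‖ ^ 2 := by gcongr
    _ = _ := by ring

/-- The embedding of `H^{1/2,1}_0(Q)` into `L⁴(Q)`. -/
theorem memLp_four_of_mem_H {w : L2} (hw : w ∈ H) : MemLp w 4 measQ :=
  memLp_four_of_summable w (summable_sinWeight_of_mem_H hw)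

instance : ENNReal.HolderTriple 4 4 2 :=
  ⟨by
    rw [show (4 : ENNReal) = 2 * 2 by norm_num, ENNReal.mul_inv (by simp) (by simp), ← mul_add,
      ENNReal.inv_two_add_inv_two, mul_one]⟩

theorem memLp_mul_of_four {f g : UnitAddCircle × ℝ → ℝ} (hf : MemLp f 4 measQ)
    (hg : MemLp g 4 measQ) : MemLp (fun p => f p * g p) 2 measQ := hg.mul hf

/-! ### The space `H^{1,2}_N(Q)` -/

/-- `W ∈ H^{1,2}_N(Q)` with `a = W_t`, `b = W_x`, `c = W_xx`, in terms of coefficients. -/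
structure HasDerivs (W a b c : UnitAddCircle × ℝ → ℝ) : Prop where
  time : ∀ (k : ℤ) (n : ℕ),
    coef cosB a (k, n) = 2 * Real.pi * Complex.I * k * coef cosB W (k, n)
  space : CoefDx W b
  space₂ : CoefDxZero b c

/-- `f` is classically differentiable with derivatives `ft`, `fx`, `fxx`, and satisfies the
Neumann condition. -/
structure IsNeumannC2 (f ft fx fxx : UnitAddCircle × ℝ → ℝ) : Prop where
  c1 : IsC1x f fx
  c2 : IsC1x fx fxx
  contt : Continuous ft
  hasDerivt : ∀ (t x : ℝ), HasDerivAt (fun s : ℝ => f ((s : UnitAddCircle), x))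
    (ft ((t : UnitAddCircle), x)) t
  zero_left : ∀ t, fx (t, 0) = 0
  zero_right : ∀ t, fx (t, 1) = 0

theorem fourierCoeff_of_hasDerivAt {f f' : UnitAddCircle → ℝ} (hf' : Continuous f')
    (hd : ∀ t : ℝ, HasDerivAt (fun s : ℝ => f s) (f' t) t) (k : ℤ) :
    fourierCoeff (T := 1) (fun t => (f' t : ℂ)) k =
      2 * Real.pi * Complex.I * k * fourierCoeff (T := 1) (fun t => (f t : ℂ)) k := by
  rw [fourierCoeff_eq_intervalIntegral _ _ 0, fourierCoeff_eq_intervalIntegral _ _ 0]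
  have hq : Continuous (fun s : ℝ => (s : UnitAddCircle)) := AddCircle.continuous_mk' 1
  have h1 : ∀ t : ℝ, HasDerivAt (fun s : ℝ => (f s : ℂ)) (f' t : ℂ) t := fun t =>
    (hd t).ofReal_comp
  have h2 := intervalIntegral.integral_mul_deriv_eq_deriv_mul (a := 0) (b := 1)
    (fun x _ => hasDerivAt_fourier_neg 1 k x) (fun x _ => h1 x)
    (Continuous.intervalIntegrable (by
      have : Continuous (fun x : ℝ => fourier (-k) (x : UnitAddCircle)) := by fun_prop
      fun_prop) _ _)
    (Continuous.intervalIntegrable (by fun_prop) _ _)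
  simp only [zero_add, smul_eq_mul, one_div, inv_one, one_smul]
  rw [h2]
  have e1 : ((1 : ℝ) : UnitAddCircle) = ((0 : ℝ) : UnitAddCircle) := by
    simp
  rw [e1, sub_self, zero_sub, ← intervalIntegral.integral_neg,
    ← intervalIntegral.integral_const_mul]
  congr 1; ext t
  push_cast; ring

/-- Classical derivatives have the expected coefficients. -/
theorem IsNeumannC2.hasDerivs {f ft fx fxx : UnitAddCircle × ℝ → ℝ}
    (h : IsNeumannC2 f ft fx fxx) : HasDerivs f ft fx fxx where
  time k n := by
    have hf := h.c1.cont
    have hft := h.contt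
    have i1 : Integrable (fun p => (f p : ℂ)) measQ :=
      (memLp_of_continuous (Complex.continuous_ofReal.comp hf) 1).integrable le_rfl
    have i2 : Integrable (fun p => (ft p : ℂ)) measQ :=
      (memLp_of_continuous (Complex.continuous_ofReal.comp hft) 1).integrable le_rfl
    rw [coef, coef, ← integral_timeCoeffC isXBasis_cosB i1, ← integral_timeCoeffC isXBasis_cosB i2,
      ← integral_const_mul]
    congr 1; ext x
    have := fourierCoeff_of_hasDerivAt (f := fun t => f (t, x)) (f' := fun t => ft (t, x))
      (by fun_prop) (fun t => h.hasDerivt t x) k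
    rw [this]; ring
  space := h.c1.coefDx
  space₂ := h.c2.coefDxZero h.zero_left h.zero_right

theorem HasDerivs.congr {W a b c W' a' b' c' : UnitAddCircle × ℝ → ℝ} (h : HasDerivs W a b c)
    (hW : W' =ᵐ[measQ] W) (ha : a' =ᵐ[measQ] a) (hb : b' =ᵐ[measQ] b) (hc : c' =ᵐ[measQ] c) :
    HasDerivs W' a' b' c' where
  time k n := by rw [coef_congr ha, coef_congr hW, h.time]
  space := h.space.congr hW hb
  space₂ := h.space₂.congr hb hc

/-- Being the derivatives of a function in `H^{1,2}_N(Q)` is preserved under limits. -/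
theorem HasDerivs.of_tendsto {W a b c : ℕ → L2} {W' a' b' c' : L2}
    (h : ∀ N, HasDerivs (W N) (a N) (b N) (c N)) (hW : Tendsto W atTop (𝓝 W'))
    (ha : Tendsto a atTop (𝓝 a')) (hb : Tendsto b atTop (𝓝 b')) (hc : Tendsto c atTop (𝓝 c')) :
    HasDerivs W' a' b' c' := by
  have lim : ∀ {γ} (hγ : IsXBasis γ) {u : ℕ → L2} {u' : L2} (i : ℤ × ℕ), Tendsto u atTop (𝓝 u') →
      Tendsto (fun N => coef γ (u N) i) atTop (𝓝 (coef γ u' i)) := by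
    intro γ hγ u u' i hu
    simp only [← coefL_apply hγ]
    exact ((coefL hγ i).continuous.tendsto u').comp hu
  refine ⟨fun k n => ?_, fun k n => ?_, fun k => ?_, fun k n => ?_⟩
  · refine tendsto_nhds_unique (lim isXBasis_cosB (k, n) ha) ?_
    simp only [fun N => (h N).time k n]
    exact (lim isXBasis_cosB (k, n) hW).const_mul _
  · refine tendsto_nhds_unique (lim isXBasis_sinB (k, n) hb) ?_
    simp only [fun N => (h N).space k n]
    exact (lim isXBasis_cosB (k, n + 1) hW).const_mul _
  · refine tendsto_nhds_unique (lim isXBasis_cosB (k, 0) hc) ?_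
    simp only [fun N => (h N).space₂.1 k]
    exact tendsto_const_nhds
  · refine tendsto_nhds_unique (lim isXBasis_cosB (k, n + 1) hc) ?_
    simp only [fun N => (h N).space₂.2 k n]
    exact (lim isXBasis_sinB (k, n) hb).const_mul _

/-! ### Approximation of `H^{1,2}_N(Q)` by trigonometric polynomials -/

theorem sum_cosBox {E : Type*} [AddCommMonoid E] {g : ℤ × ℕ → E} (h0 : ∀ k, g (k, 0) = 0) (N : ℕ) :
    ∑ i ∈ cosBox N, g i = ∑ i ∈ sinBox N, g (i.1, i.2 + 1) := by
  rw [cosBox, sinBox, Finset.sum_product, Finset.sum_product]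
  refine Finset.sum_congr rfl fun k _ => ?_
  rw [Finset.sum_range_succ', h0, add_zero]

theorem hasDerivAt_reMode_time (γ : ℕ → ℝ → ℝ) (z : ℂ) (i : ℤ × ℕ) (t x : ℝ) :
    HasDerivAt (fun s : ℝ => reMode γ z i ((s : UnitAddCircle), x))
      (reMode γ (2 * Real.pi * Complex.I * i.1 * z) i ((t : UnitAddCircle), x)) t := by
  simp only [reMode_eq_reTensor, reTensor]
  have h1 := (hasDerivAt_fourier 1 i.1 t).const_mul z
  have h2 := (Complex.reCLM.hasFDerivAt.comp_hasDerivAt t h1).mul_const (γ i.2 x)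
  refine HasDerivAt.congr_deriv h2 ?_
  simp only [Complex.ofReal_one, div_one, Complex.reCLM_apply]
  congr 2
  ring

theorem reMode_zero (γ : ℕ → ℝ → ℝ) (i : ℤ × ℕ) (p : UnitAddCircle × ℝ) : reMode γ 0 i p = 0 := by
  simp [reMode]

theorem CoefDxZero.isC1x_partialSum {b c : UnitAddCircle × ℝ → ℝ} (h : CoefDxZero b c) (N : ℕ) :
    IsC1x (partialSum sinB (coef sinB b) (sinBox N))
      (partialSum cosB (coef cosB c) (cosBox N)) where
  cont := continuous_partialSum continuous_sinB _ _
  contx := continuous_partialSum continuous_cosB _ _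
  hasDeriv := fun t x => by
    unfold partialSum
    rw [sum_cosBox (g := fun i => reMode cosB (coef cosB c i) i (t, x))
      (fun k => by rw [h.1, reMode_zero])]
    refine HasDerivAt.fun_sum fun i _ => ?_
    simp only [reMode_eq_reTensor, reTensor]
    have := (hasDerivAt_sinB i.2 x).const_mul (coef sinB b i * fourier i.1 t : ℂ).re
    refine HasDerivAt.congr_deriv this ?_
    rw [h.2, show ((i.2 + 1) * Real.pi * coef sinB b (i.1, i.2) *
        fourier i.1 t : ℂ) = (((i.2 + 1) * Real.pi : ℝ) : ℂ) *
          (coef sinB b i * fourier i.1 t) by push_cast; ring,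
        Complex.re_ofReal_mul]
    ring

theorem isNeumannC2_partialSum {W a b c : UnitAddCircle × ℝ → ℝ} (h : HasDerivs W a b c) (N : ℕ) :
    IsNeumannC2 (partialSum cosB (coef cosB W) (cosBox N))
        (partialSum cosB (coef cosB a) (cosBox N))
      (partialSum sinB (coef sinB b) (sinBox N)) (partialSum cosB (coef cosB c) (cosBox N)) where
  c1 :=
    { cont := continuous_partialSum continuous_cosB _ _
      contx := continuous_partialSum continuous_sinB _ _
      hasDeriv := fun t x => by
        unfold partialSum
        have e : ∀ y, ∑ i ∈ cosBox N, reMode cosB (coef cosB W i) i (t, y) =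
            ∑ k ∈ Finset.Icc (-N : ℤ) N, reMode cosB (coef cosB W (k, 0)) (k, 0) (t, y) +
            ∑ i ∈ sinBox N, reMode cosB (coef cosB W (i.1, i.2 + 1)) (i.1, i.2 + 1) (t, y) := by
          intro y
          rw [cosBox, sinBox, Finset.sum_product, Finset.sum_product, ← Finset.sum_add_distrib]
          refine Finset.sum_congr rfl fun k _ => ?_
          rw [Finset.sum_range_succ', add_comm]
        simp only [e]
        have h0 : HasDerivAt (fun y => ∑ k ∈ Finset.Icc (-N : ℤ) N,
            reMode cosB (coef cosB W (k, 0)) (k, 0) (t, y)) 0 x := by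
          simp only [reMode, modeFun, cosB_zero]
          exact hasDerivAt_const _ _
        have h1 : HasDerivAt (fun y => ∑ i ∈ sinBox N,
            reMode cosB (coef cosB W (i.1, i.2 + 1)) (i.1, i.2 + 1) (t, y))
            (∑ i ∈ sinBox N, reMode sinB (coef sinB b i) i (t, x)) x := by
          refine HasDerivAt.fun_sum fun i _ => ?_
          simp only [reMode_eq_reTensor, reTensor]
          have := (hasDerivAt_cosB_succ i.2 x).const_mul
            (coef cosB W (i.1, i.2 + 1) * fourier i.1 t : ℂ).re
          refine HasDerivAt.congr_deriv this ?_
          rw [h.space i.1 i.2, show (-((i.2 + 1) * Real.pi) * coef cosB W (i.1, i.2 + 1) *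
            fourier i.1 t : ℂ) = ((-((i.2 + 1) * Real.pi) : ℝ) : ℂ) *
              (coef cosB W (i.1, i.2 + 1) * fourier i.1 t) by push_cast; ring,
            Complex.re_ofReal_mul]
          ring
        exact (h0.fun_add h1).congr_deriv (zero_add _) }
  c2 := h.space₂.isC1x_partialSum N
  contt := continuous_partialSum continuous_cosB _ _
  hasDerivt t x := by
    unfold partialSum
    refine HasDerivAt.fun_sum fun i _ => ?_
    rw [h.time]
    exact hasDerivAt_reMode_time _ _ _ _ _
  zero_left t := by simp [partialSum, reMode, modeFun]
  zero_right t := by simp [partialSum, reMode, modeFun]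

/-- The norm of `H^{1,2}_N(Q)` is a weighted `ℓ²` norm of the cosine coefficients. -/
theorem summable_weight_sq {W a b c : L2} (h : HasDerivs W a b c) :
    Summable fun i : ℤ × ℕ => weight (i.1, i.2) ^ 2 * ‖coef cosB W i‖ ^ 2 := by
  have h0 := (hasSum_sq_coef isXBasis_cosB W).summable
  have h1 := (hasSum_sq_coef isXBasis_cosB a).summable
  have h2 := (hasSum_sq_coef isXBasis_cosB c).summable
  refine (((h0.add h1).add h2).mul_left 3).of_nonneg_of_le
    (fun i => by positivity) fun i => ?_
  obtain ⟨k, n⟩ := i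
  have hp := Real.pi_gt_three
  have ec : ‖coef cosB c (k, n)‖ = ((n : ℝ) * Real.pi) ^ 2 * ‖coef cosB W (k, n)‖ := by
    cases n with
    | zero => simp [h.space₂.1]
    | succ n =>
      rw [h.space₂.2, h.space k n, ← mul_assoc, norm_mul]
      congr 1
      have : ((n + 1) * Real.pi * -((n + 1) * Real.pi) : ℂ) =
        ((-(((n + 1) * Real.pi) ^ 2) : ℝ) : ℂ) := by push_cast; ring
      rw [this, Complex.norm_real, norm_neg, Real.norm_of_nonneg (by positivity)]
      push_cast; ring
  have ea : ‖coef cosB a (k, n)‖ = 2 * Real.pi * |(k : ℝ)| * ‖coef cosB W (k, n)‖ := by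
    rw [h.time, norm_mul]
    simp [abs_of_pos Real.pi_pos]
  rw [ea, ec, mul_pow, mul_pow]
  simp only [weight]
  set x := |(k : ℝ)|
  set y := (n : ℝ) ^ 2 with hy
  have hx : 0 ≤ x := abs_nonneg _
  have hy0 : 0 ≤ y := sq_nonneg _
  have hs := sq_nonneg ‖coef cosB W (k, n)‖
  push_cast
  rw [← hy]
  have q : (1 + x + y) ^ 2 ≤ 3 * (1 + (2 * Real.pi * x) ^ 2 + (((n : ℝ) * Real.pi) ^ 2) ^ 2) := by
    have q1 : (1 + x + y) ^ 2 ≤ 3 * (1 + x ^ 2 + y ^ 2) := by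
      nlinarith [sq_nonneg (1 - x), sq_nonneg (1 - y), sq_nonneg (x - y)]
    have q2 : x ^ 2 ≤ (2 * Real.pi * x) ^ 2 := by
      gcongr; nlinarith
    have q3 : y ^ 2 ≤ (((n : ℝ) * Real.pi) ^ 2) ^ 2 := by
      rw [mul_pow, ← hy]
      gcongr
      exact le_mul_of_one_le_right hy0 (by nlinarith)
    linarith
  calc _ ≤ 3 * (1 + (2 * Real.pi * x) ^ 2 + (((n : ℝ) * Real.pi) ^ 2) ^ 2) *
        ‖coef cosB W (k, n)‖ ^ 2 := by gcongr
    _ = _ := by ring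

/-- Absolute convergence of the cosine series, by the Cauchy-Schwarz inequality against the square
summable family `1 / weight`. -/
theorem summable_norm_coef {W a b c : L2} (h : HasDerivs W a b c) :
    Summable fun i : ℤ × ℕ => ‖coef cosB W i‖ := by
  have h1 : Summable fun i : ℤ × ℕ => (weight (i.1, (i.2 : ℤ)) ^ 2)⁻¹ :=
    summable_inv_weight_sq.comp_injective (i := fun i : ℤ × ℕ => ((i.1, (i.2 : ℤ)) : ℤ × ℤ)) (by
      rintro ⟨k, n⟩ ⟨l, m⟩ h
      simpa using h)
  refine ((h1.add (summable_weight_sq h)).mul_left (1 / 2)).of_nonneg_of_le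
    (fun i => norm_nonneg _) fun i => ?_
  have hw := weight_pos (i.1, (i.2 : ℤ))
  set w := weight (i.1, (i.2 : ℤ))
  have e : w⁻¹ * (w * ‖coef cosB W i‖) = ‖coef cosB W i‖ := by field_simp
  have : (w ^ 2)⁻¹ = w⁻¹ ^ 2 := by rw [inv_pow]
  rw [this, ← mul_pow]
  nlinarith [sq_nonneg (w⁻¹ - w * ‖coef cosB W i‖)]

theorem summable_sinWeight_of_hasDerivs {W a b c : L2} (h : HasDerivs W a b c) :
    Summable fun i => sinWeight i * ‖coef sinB b i‖ ^ 2 := by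
  have h1 := (summable_weight_sq h).comp_injective
    (i := fun i : ℤ × ℕ => ((i.1, i.2 + 1) : ℤ × ℕ)) (by
      rintro ⟨k, n⟩ ⟨l, m⟩ h
      simpa using h)
  refine (h1.mul_left (Real.pi ^ 2)).of_nonneg_of_le
    (fun i => mul_nonneg (sinWeight_pos i).le (sq_nonneg _)) fun i => ?_
  have e : ‖coef sinB b i‖ = (i.2 + 1) * Real.pi * ‖coef cosB W (i.1, i.2 + 1)‖ := by
    rw [h.space i.1 i.2, norm_mul]
    congr 1
    have : (-((i.2 + 1) * Real.pi) : ℂ) = ((-((i.2 + 1) * Real.pi) : ℝ) : ℂ) := by push_cast; ring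
    rw [this, Complex.norm_real, norm_neg, Real.norm_of_nonneg (by positivity)]
  have hw : ((i.2 : ℝ) + 1) ^ 2 ≤ sinWeight i := by
    rw [sinWeight_eq]; linarith [abs_nonneg (i.1 : ℝ)]
  have h0 := sinWeight_pos i
  simp only [Function.comp]
  change _ ≤ Real.pi ^ 2 * (sinWeight i ^ 2 * _)
  rw [e]
  calc sinWeight i * ((i.2 + 1) * Real.pi * ‖coef cosB W (i.1, i.2 + 1)‖) ^ 2
      = Real.pi ^ 2 * (sinWeight i * ((i.2 : ℝ) + 1) ^ 2 * ‖coef cosB W (i.1, i.2 + 1)‖ ^ 2) := by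
        ring
    _ ≤ Real.pi ^ 2 * (sinWeight i * sinWeight i * ‖coef cosB W (i.1, i.2 + 1)‖ ^ 2) := by
        gcongr
    _ = _ := by ring

/-- The continuous representative of a function in `H^{1,2}_N(Q)`. -/
def contRep (W : UnitAddCircle × ℝ → ℝ) (p : UnitAddCircle × ℝ) : ℝ :=
  ∑' i, reMode cosB (coef cosB W i) i p

theorem abs_reMode_cosB_le (z : ℂ) (i : ℤ × ℕ) (p : UnitAddCircle × ℝ) :
    ‖reMode cosB z i p‖ ≤ ‖z‖ * 2 := by
  rw [reMode_eq_reTensor]; exact abs_reTensor_le _ _ (abs_cosB_le i.2) p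

theorem continuous_contRep {W a b c : L2} (h : HasDerivs W a b c) : Continuous (contRep W) :=
  continuous_tsum (fun i => continuous_reMode continuous_cosB _ i)
    ((summable_norm_coef h).mul_right 2) fun i p => abs_reMode_cosB_le _ i p

theorem tendstoUniformly_contRep {W a b c : L2} (h : HasDerivs W a b c) :
    TendstoUniformly (fun N => partialSum cosB (coef cosB W) (cosBox N)) (contRep W) atTop := by
  have h1 := tendstoUniformly_tsum ((summable_norm_coef h).mul_right 2)
    (fun i p => abs_reMode_cosB_le (coef cosB W i) i p)
  intro u hu
  exact tendsto_cosBox.eventually (h1 u hu)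

theorem tendsto_toLp_partialSum (hγ : IsXBasis γ) (u : L2) {box : ℕ → Finset (ℤ × ℕ)}
    (hbox : Tendsto box atTop atTop) :
    Tendsto (fun N => (memLp_of_continuous
      (continuous_partialSum hγ.continuous (coef γ u) (box N)) 2).toLp _) atTop (𝓝 u) := by
  refine ((hasSum_reModeL hγ u).comp hbox).congr fun N => ?_
  ext1
  exact (coeFn_sum_reModeL hγ _ _).trans (MemLp.coeFn_toLp _).symm

theorem ae_eq_contRep {W a b c : L2} (h : HasDerivs W a b c) : W =ᵐ[measQ] contRep W := by
  have hm := tendstoInMeasure_of_tendsto_Lp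
    (tendsto_toLp_partialSum isXBasis_cosB W tendsto_cosBox)
  obtain ⟨ns, hns, hae⟩ := hm.exists_seq_tendsto_ae
  have hall : ∀ᵐ p ∂measQ, ∀ N, (memLp_of_continuous
      (continuous_partialSum isXBasis_cosB.continuous (coef cosB W) (cosBox N)) 2).toLp _ p =
      partialSum cosB (coef cosB W) (cosBox N) p := ae_all_iff.2 fun N => MemLp.coeFn_toLp _
  filter_upwards [hae, hall] with p h1 h2
  simp only [h2] at h1
  exact tendsto_nhds_unique h1 (((tendstoUniformly_contRep h).tendsto_at p).comp hns.tendsto_atTop)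

/-! ### The chain rule in `H^{1,2}_N(Q)` -/

/-- Products of uniformly convergent and `L²` convergent sequences converge in `L²`. -/
theorem tendsto_L2_mul {u P : ℕ → L2} {u' P' : L2} {h : ℕ → UnitAddCircle × ℝ → ℝ}
    {h' : UnitAddCircle × ℝ → ℝ} {M : ℝ} (hu : Tendsto u atTop (𝓝 u'))
    (hP : ∀ N, P N =ᵐ[measQ] fun p => h N p * u N p) (hP' : P' =ᵐ[measQ] fun p => h' p * u' p)
    (hh : TendstoUniformly h h' atTop) (hM : ∀ p, |h' p| ≤ M) : Tendsto P atTop (𝓝 P') := by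
  have hM0 : 0 ≤ M := (abs_nonneg _).trans (hM (0, 0))
  have hle : ∀ ε > 0, ε ≤ 1 → ∀ᶠ N in atTop,
      ‖P N - P'‖ ≤ (M + 1) * ‖u N - u'‖ + ε * ‖u'‖ := by
    intro ε hε hε1
    filter_upwards [Metric.tendstoUniformly_iff.1 hh ε hε] with N hN
    have h1 : ‖P N - P'‖ ≤ ‖(M + 1) • |u N - u'| + ε • |u'|‖ := by
      refine Lp.norm_le_norm_of_ae_le ?_
      filter_upwards [hP N, hP', Lp.coeFn_sub (P N) P', Lp.coeFn_sub (u N) u',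
        Lp.coeFn_add ((M + 1) • |u N - u'|) (ε • |u'|), Lp.coeFn_smul (M + 1) |u N - u'|,
        Lp.coeFn_smul ε |u'|, Lp.coeFn_abs (u N - u'), Lp.coeFn_abs u']
        with p a1 a2 a3 a4 a5 a6 a7 a8 a9
      rw [a3, Pi.sub_apply, a1, a2, a5, Pi.add_apply, a6, a7, Pi.smul_apply, Pi.smul_apply, a8, a9,
        a4, Pi.sub_apply, smul_eq_mul, smul_eq_mul, Real.norm_eq_abs, Real.norm_eq_abs]
      have b1 : |h N p - h' p| ≤ ε := by
        have := hN p
        rw [dist_comm, Real.dist_eq] at this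
        exact this.le
      have b2 : |h N p| ≤ M + 1 := by
        have := abs_sub_abs_le_abs_sub (h N p) (h' p)
        have := hM p
        linarith
      rw [abs_of_nonneg (by positivity : 0 ≤ (M + 1) * |u N p - u' p| + ε * |u' p|),
        show h N p * u N p - h' p * u' p = h N p * (u N p - u' p) + (h N p - h' p) * u' p by ring]
      refine (abs_add_le _ _).trans ?_
      rw [abs_mul, abs_mul]
      gcongr
    refine h1.trans ((norm_add_le _ _).trans ?_)
    rw [norm_smul, norm_smul, norm_abs_eq_norm, norm_abs_eq_norm, Real.norm_of_nonneg
        (by positivity),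
      Real.norm_of_nonneg hε.le]
  rw [tendsto_iff_norm_sub_tendsto_zero] at hu ⊢
  rw [Metric.tendsto_atTop'] at *
  intro δ hδ
  set ε := min 1 (δ / (2 * (‖u'‖ + 1))) with hεd
  have hε : 0 < ε := by positivity
  have hε2 : ε * ‖u'‖ ≤ δ / 2 := by
    calc ε * ‖u'‖ ≤ δ / (2 * (‖u'‖ + 1)) * (‖u'‖ + 1) := by
          gcongr
          · exact min_le_right _ _
          · linarith
      _ = δ / 2 := by field_simp
  obtain ⟨N1, h1⟩ := hu (δ / (2 * (M + 1))) (by positivity)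
  obtain ⟨N2, h2⟩ := eventually_atTop.1 (hle ε hε (min_le_left _ _))
  refine ⟨max N1 N2, fun N hN => ?_⟩
  have a1 := h1 N (lt_of_le_of_lt (le_max_left _ _) hN)
  have a2 := h2 N (le_of_lt (lt_of_le_of_lt (le_max_right _ _) hN))
  rw [Real.dist_eq, sub_zero, abs_of_nonneg (norm_nonneg _)] at a1 ⊢
  rw [lt_div_iff₀ (by positivity)] at a1
  nlinarith

/-- The squares of the partial sums of `W_x` converge in `L²(Q)`, by the `L⁴` estimate. -/
theorem tendsto_sq_partialSum {b : L2}
    (hs : Summable fun i => sinWeight i * ‖coef sinB b i‖ ^ 2)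
    {sqN : ℕ → L2} {sq' : L2}
    (hN : ∀ N, sqN N =ᵐ[measQ] fun p => (partialSum sinB (coef sinB b) (sinBox N) p) ^ 2)
    (h' : sq' =ᵐ[measQ] fun p => (b p) ^ 2) : Tendsto sqN atTop (𝓝 sq') := by
  have hb4 := memLp_four_of_summable b hs
  have ht := tendsto_partialSum_four b hs
  rw [Lp.tendsto_Lp_iff_tendsto_eLpNorm']
  have hm : ∀ N, AEStronglyMeasurable
      (fun p => b p - partialSum sinB (coef sinB b) (sinBox N) p) measQ := fun N =>
    (Lp.aestronglyMeasurable b).sub (continuous_partialSum continuous_sinB _ _).aestronglyMeasurable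
  have hle : ∀ N, eLpNorm (⇑(sqN N) - ⇑sq') 2 measQ ≤
      eLpNorm (fun p => b p - partialSum sinB (coef sinB b) (sinBox N) p) 4 measQ *
      (2 * eLpNorm b 4 measQ +
        eLpNorm (fun p => b p - partialSum sinB (coef sinB b) (sinBox N) p) 4 measQ) := by
    intro N
    set d := fun p => b p - partialSum sinB (coef sinB b) (sinBox N) p with hd
    have e : ⇑(sqN N) - ⇑sq' =ᵐ[measQ] d • (d - (2 : ℝ) • (b : _ → ℝ)) := by
      filter_upwards [hN N, h'] with p a1 a2
      simp only [Pi.sub_apply, a1, a2, Pi.smul_apply', Pi.smul_apply, smul_eq_mul, hd]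
      ring
    rw [eLpNorm_congr_ae e]
    have hb2 : AEStronglyMeasurable ((2 : ℝ) • (b : _ → ℝ)) measQ :=
      (Lp.aestronglyMeasurable b).const_smul 2
    refine (eLpNorm_smul_le_mul_eLpNorm (p := 4) (q := 4) (r := 2) ((hm N).sub hb2) (hm N)).trans ?_
    gcongr
    refine (eLpNorm_sub_le (hm N) hb2 (by norm_num)).trans ?_
    rw [eLpNorm_const_smul, add_comm]
    gcongr
    rw [Real.enorm_eq_ofReal (by norm_num)]; norm_num
  have hlim : Tendsto (fun N =>
      eLpNorm (fun p => b p - partialSum sinB (coef sinB b) (sinBox N) p) 4 measQ *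
      (2 * eLpNorm b 4 measQ +
        eLpNorm (fun p => b p - partialSum sinB (coef sinB b) (sinBox N) p) 4 measQ))
      atTop (𝓝 (0 * (2 * eLpNorm b 4 measQ + 0))) := by
    have hfin : 2 * eLpNorm b 4 measQ + 0 ≠ ⊤ := by
      rw [add_zero]; exact ENNReal.mul_ne_top (by norm_num) hb4.2.ne
    exact ENNReal.Tendsto.mul ht (Or.inr hfin) (tendsto_const_nhds.add ht)
      (Or.inr (by norm_num))
  rw [zero_mul] at hlim
  exact tendsto_of_tendsto_of_tendsto_of_le_of_le tendsto_const_nhds hlim (fun _ => zero_le) hle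

theorem abs_partialSum_cosB_le {W a b c : L2} (h : HasDerivs W a b c) (S : Finset (ℤ × ℕ))
    (p : UnitAddCircle × ℝ) :
    |partialSum cosB (coef cosB W) S p| ≤ ∑' i, ‖coef cosB W i‖ * 2 := by
  refine (norm_sum_le _ _).trans ((Finset.sum_le_sum fun i _ => abs_reMode_cosB_le _ i p).trans ?_)
  exact ((summable_norm_coef h).mul_right 2).sum_le_tsum _ fun i _ => by positivity

theorem IsNeumannC2.comp {f ft fx fxx : UnitAddCircle × ℝ → ℝ} (h : IsNeumannC2 f ft fx fxx)
    {F F' F'' : ℝ → ℝ} (hF : ∀ y, HasDerivAt F (F' y) y) (hF' : ∀ y, HasDerivAt F' (F'' y) y)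
    (hF'' : Continuous F'') :
    IsNeumannC2 (fun p => F (f p)) (fun p => F' (f p) * ft p) (fun p => F' (f p) * fx p)
      (fun p => F'' (f p) * fx p ^ 2 + F' (f p) * fxx p) := by
  have c0 : Continuous F := continuous_iff_continuousAt.2 fun y => (hF y).continuousAt
  have c1 : Continuous F' := continuous_iff_continuousAt.2 fun y => (hF' y).continuousAt
  have d0 := h.c1.cont
  have d1 := h.c1.contx
  have d2 := h.c2.contx
  have d3 := h.contt
  refine ⟨⟨by fun_prop, by fun_prop, fun t x => ?_⟩, ⟨by fun_prop, by fun_prop, fun t x => ?_⟩,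
    by fun_prop, fun t x => ?_, fun t => ?_, fun t => ?_⟩
  · exact (hF _).comp x (h.c1.hasDeriv t x)
  · have := ((hF' _).comp x (h.c1.hasDeriv t x)).mul (h.c2.hasDeriv t x)
    refine HasDerivAt.congr_deriv this ?_
    simp only [Function.comp]; ring
  · exact (hF _).comp t (h.hasDerivt t x)
  · rw [h.zero_left, mul_zero]
  · rw [h.zero_right, mul_zero]

/-- The chain rule for `H^{1,2}_N(Q)`. -/
theorem HasDerivs.comp {W a b c : L2} (h : HasDerivs W a b c) {F F' F'' : ℝ → ℝ}
    (hF : ∀ y, HasDerivAt F (F' y) y) (hF' : ∀ y, HasDerivAt F' (F'' y) y) (hF'' : Continuous F'') :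
    ∃ φ a' b' c' : L2, HasDerivs φ a' b' c' ∧ (φ =ᵐ[measQ] fun p => F (W p)) ∧
      (a' =ᵐ[measQ] fun p => F' (W p) * a p) ∧ (b' =ᵐ[measQ] fun p => F' (W p) * b p) ∧
      (c' =ᵐ[measQ] fun p => F'' (W p) * b p ^ 2 + F' (W p) * c p) := by
  have c0 : Continuous F := continuous_iff_continuousAt.2 fun y => (hF y).continuousAt
  have c1 : Continuous F' := continuous_iff_continuousAt.2 fun y => (hF' y).continuousAt
  set g := contRep W with hg
  have hgc : Continuous g := continuous_contRep h
  have hWg : W =ᵐ[measQ] g := ae_eq_contRep h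
  set R : ℝ := ∑' i, ‖coef cosB W i‖ * 2 with hR
  let f : ℕ → UnitAddCircle × ℝ → ℝ := fun N => partialSum cosB (coef cosB W) (cosBox N)
  have hfR : ∀ N p, f N p ∈ Icc (-R) R := fun N p => abs_le.1 (abs_partialSum_cosB_le h _ p)
  have hunif : TendstoUniformly f g atTop := tendstoUniformly_contRep h
  have hgR : ∀ p, g p ∈ Icc (-R) R := fun p =>
    isClosed_Icc.mem_of_tendsto (hunif.tendsto_at p) (.of_forall fun N => hfR N p)
  have comp : ∀ G : ℝ → ℝ, Continuous G →
      TendstoUniformly (fun N p => G (f N p)) (fun p => G (g p)) atTop ∧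
      ∃ M, ∀ p, |G (g p)| ≤ M := by
    intro G hG
    refine ⟨(isCompact_Icc.uniformContinuousOn_of_continuous
      hG.continuousOn).comp_tendstoUniformly (s := Icc (-R) R) hfR hgR hunif, ?_⟩
    obtain ⟨M, hM⟩ := isCompact_Icc.exists_bound_of_continuousOn (s := Icc (-R) R) hG.continuousOn
    exact ⟨M, fun p => hM _ (hgR p)⟩
  have hmul : ∀ G : ℝ → ℝ, Continuous G → ∀ u : L2, MemLp (fun p => G (g p) * u p) 2 measQ := by
    intro G hG u
    obtain ⟨M, hM⟩ := (comp G hG).2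
    exact (Lp.memLp u).of_le_mul (c := M)
      ((hG.comp hgc).aestronglyMeasurable.mul (Lp.aestronglyMeasurable u))
      (.of_forall fun p => by rw [norm_mul]; gcongr; exact hM p)
  let one : L2 := (memLp_const (1 : ℝ)).toLp _
  have hone : one =ᵐ[measQ] fun _ => (1 : ℝ) := MemLp.coeFn_toLp _
  have hs := summable_sinWeight_of_hasDerivs h
  have hb4 := memLp_four_of_summable b hs
  have hsq : MemLp (fun p => b p ^ 2) 2 measQ := by
    simpa only [sq] using memLp_mul_of_four hb4 hb4
  let sq' : L2 := hsq.toLp _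
  have hsq' : sq' =ᵐ[measQ] fun p => b p ^ 2 := MemLp.coeFn_toLp _
  -- the approximations and their images under `F`
  have hN := fun N => (isNeumannC2_partialSum h N).comp hF hF' hF''
  let toL : ∀ {u : UnitAddCircle × ℝ → ℝ}, Continuous u → L2 :=
    fun {u} hu => (memLp_of_continuous hu 2).toLp u
  have htoL : ∀ {u : UnitAddCircle × ℝ → ℝ} (hu : Continuous u), toL hu =ᵐ[measQ] u :=
    fun hu => MemLp.coeFn_toLp _
  have hHD : ∀ N, HasDerivs (toL (hN N).c1.cont) (toL (hN N).contt) (toL (hN N).c1.contx)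
      (toL (hN N).c2.contx) := fun N =>
    (hN N).hasDerivs.congr (htoL (hN N).c1.cont) (htoL (hN N).contt) (htoL (hN N).c1.contx)
      (htoL (hN N).c2.contx)
  have ta := tendsto_toLp_partialSum isXBasis_cosB a tendsto_cosBox
  have tb := tendsto_toLp_partialSum isXBasis_sinB b tendsto_sinBox
  have tc := tendsto_toLp_partialSum isXBasis_cosB c tendsto_cosBox
  have csq : ∀ N, Continuous (fun p => (partialSum sinB (coef sinB b) (sinBox N) p) ^ 2) :=
    fun N => (continuous_partialSum continuous_sinB _ _).pow 2
  have tsq : Tendsto (fun N => toL (csq N)) atTop (𝓝 sq') :=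
    tendsto_sq_partialSum hs (fun N => htoL (csq N)) hsq'
  obtain ⟨u0, M0, m0⟩ := comp F c0
  obtain ⟨u1, M1, m1⟩ := comp F' c1
  obtain ⟨u2, M2, m2⟩ := comp F'' hF''
  let φ : L2 := (hmul F c0 one).toLp _
  let a' : L2 := (hmul F' c1 a).toLp _
  let b' : L2 := (hmul F' c1 b).toLp _
  let c'₁ : L2 := (hmul F'' hF'' sq').toLp _
  let c'₂ : L2 := (hmul F' c1 c).toLp _
  have eφ : φ =ᵐ[measQ] fun p => F (g p) * one p := MemLp.coeFn_toLp _
  have ea : a' =ᵐ[measQ] fun p => F' (g p) * a p := MemLp.coeFn_toLp _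
  have eb : b' =ᵐ[measQ] fun p => F' (g p) * b p := MemLp.coeFn_toLp _
  have ec1 : c'₁ =ᵐ[measQ] fun p => F'' (g p) * sq' p := MemLp.coeFn_toLp _
  have ec2 : c'₂ =ᵐ[measQ] fun p => F' (g p) * c p := MemLp.coeFn_toLp _
  have tφ : Tendsto (fun N => toL (hN N).c1.cont) atTop (𝓝 φ) := by
    refine tendsto_L2_mul (u := fun _ => one) tendsto_const_nhds (fun N => ?_) eφ u0 m0
    filter_upwards [htoL (hN N).c1.cont, hone] with p h1 h2
    rw [h1, h2, mul_one]
  have ta' : Tendsto (fun N => toL (hN N).contt) atTop (𝓝 a') := by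
    refine tendsto_L2_mul ta (fun N => ?_) ea u1 m1
    filter_upwards [htoL (hN N).contt, MemLp.coeFn_toLp (memLp_of_continuous
      (continuous_partialSum isXBasis_cosB.continuous (coef cosB a) (cosBox N)) 2)] with p h1 h2
    rw [h1, h2]
  have tb' : Tendsto (fun N => toL (hN N).c1.contx) atTop (𝓝 b') := by
    refine tendsto_L2_mul tb (fun N => ?_) eb u1 m1
    filter_upwards [htoL (hN N).c1.contx, MemLp.coeFn_toLp (memLp_of_continuous
      (continuous_partialSum isXBasis_sinB.continuous (coef sinB b) (sinBox N)) 2)] with p h1 h2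
    rw [h1, h2]
  have cf : ∀ N, Continuous (f N) := fun N => continuous_partialSum continuous_cosB _ _
  have cc1 : ∀ N, Continuous (fun p => F'' (f N p) *
      (partialSum sinB (coef sinB b) (sinBox N) p) ^ 2) := fun N =>
    (hF''.comp (cf N)).mul (csq N)
  have cc2 : ∀ N, Continuous (fun p => F' (f N p) *
      (partialSum cosB (coef cosB c) (cosBox N) p)) := fun N =>
    (c1.comp (cf N)).mul (continuous_partialSum continuous_cosB _ _)
  have tc1 : Tendsto (fun N => toL (cc1 N)) atTop (𝓝 c'₁) := by
    refine tendsto_L2_mul tsq (fun N => ?_) ec1 u2 m2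
    filter_upwards [htoL (cc1 N), htoL (csq N)] with p h1 h2
    rw [h1, h2]
  have tc2 : Tendsto (fun N => toL (cc2 N)) atTop (𝓝 c'₂) := by
    refine tendsto_L2_mul tc (fun N => ?_) ec2 u1 m1
    filter_upwards [htoL (cc2 N), MemLp.coeFn_toLp (memLp_of_continuous
      (continuous_partialSum isXBasis_cosB.continuous (coef cosB c) (cosBox N)) 2)] with p h1 h2
    rw [h1, h2]
  have tc' : Tendsto (fun N => toL (hN N).c2.contx) atTop (𝓝 (c'₁ + c'₂)) :=
    (tc1.add tc2).congr fun N => (MemLp.toLp_add _ _).symm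
  refine ⟨φ, a', b', c'₁ + c'₂, HasDerivs.of_tendsto hHD tφ ta' tb' tc', ?_, ?_, ?_, ?_⟩
  · filter_upwards [eφ, hone, hWg] with p h1 h2 h3
    rw [h1, h2, h3, mul_one]
  · filter_upwards [ea, hWg] with p h1 h3
    rw [h1, h3]
  · filter_upwards [eb, hWg] with p h1 h3
    rw [h1, h3]
  · filter_upwards [ec1, ec2, hsq', hWg, Lp.coeFn_add c'₁ c'₂] with p h1 h2 h3 h4 h5
    rw [h5, Pi.add_apply, h1, h2, h3, h4]

/-! ### Primitives in space and boundary values -/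

theorem ae_fst {P : UnitAddCircle → Prop} (h : ∀ᵐ t : UnitAddCircle, P t) : ∀ᵐ p ∂measQ, P p.1 :=
  Measure.quasiMeasurePreserving_fst.ae h

theorem ae_of_ae_fst {P : UnitAddCircle → Prop} (h : ∀ᵐ p ∂measQ, P p.1) :
    ∀ᵐ t : UnitAddCircle, P t := by
  have h1 := Measure.ae_ae_of_ae_prod h
  filter_upwards [h1] with t ht
  exact ht.exists.choose_spec

theorem ae_integrableOn_section (u : L2) :
    ∀ᵐ t : UnitAddCircle, IntegrableOn (fun y => u (t, y)) (Ioc 0 1) := by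
  have := (integrable_L2 u).prod_right_ae
  filter_upwards [this] with t ht
  rwa [IntegrableOn, ← Measure.restrict_congr_set (Ioo_ae_eq_Ioc (a := (0 : ℝ)) (b := 1))]

theorem tendsto_integral_of_lintegral {f : ℕ → ℝ → ℝ} {g : ℝ → ℝ}
    (hf : ∀ N, IntegrableOn (f N) (Ioc 0 1)) (hg : IntegrableOn g (Ioc 0 1))
    (h : Tendsto (fun N => ∫⁻ y in Ioc (0 : ℝ) 1, ‖f N y - g y‖ₑ) atTop (𝓝 0)) {x : ℝ}
    (hx : x ∈ Icc (0 : ℝ) 1) :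
    Tendsto (fun N => ∫ y in (0 : ℝ)..x, f N y) atTop (𝓝 (∫ y in (0 : ℝ)..x, g y)) := by
  have hs : Ioc 0 x ⊆ Ioc (0 : ℝ) 1 := Ioc_subset_Ioc_right hx.2
  simp only [intervalIntegral.integral_of_le hx.1]
  refine tendsto_integral_of_L1 _ (hg.mono_set hs).1 (.of_forall fun N => (hf N).mono_set hs) ?_
  exact tendsto_of_tendsto_of_tendsto_of_le_of_le tendsto_const_nhds h (fun _ => zero_le)
    fun N => lintegral_mono_set hs

/-- Along a subsequence, the primitives in space of an `L²` convergent sequence converge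
everywhere on almost every time slice. -/
theorem exists_seq_tendsto_primitive {B : ℕ → UnitAddCircle × ℝ → ℝ} (hB : ∀ N, Continuous (B N))
    {b : L2} (h : Tendsto (fun N => (memLp_of_continuous (hB N) 2).toLp (B N)) atTop (𝓝 b)) :
    ∃ ns : ℕ → ℕ, StrictMono ns ∧ ∀ᵐ t : UnitAddCircle, ∀ x ∈ Icc (0 : ℝ) 1,
      Tendsto (fun N => ∫ y in (0 : ℝ)..x, B (ns N) (t, y)) atTop
        (𝓝 (∫ y in (0 : ℝ)..x, b (t, y))) := by
  have hm : ∀ N, AEStronglyMeasurable (fun p => B N p - b p) measQ := fun N =>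
    (hB N).aestronglyMeasurable.sub (Lp.aestronglyMeasurable b)
  have h1 : Tendsto (fun N => ∫⁻ p, ‖B N p - b p‖ₑ ∂measQ) atTop (𝓝 0) := by
    have h2 := (Lp.tendsto_Lp_iff_tendsto_eLpNorm' _ _).1 h
    refine tendsto_of_tendsto_of_tendsto_of_le_of_le tendsto_const_nhds h2 (fun _ => zero_le)
      fun N => ?_
    change _ ≤ eLpNorm (_ - _) 2 measQ
    have e : (⇑((memLp_of_continuous (hB N) 2).toLp (B N)) - ⇑b) =ᵐ[measQ]
        fun p => B N p - b p := by
      filter_upwards [(memLp_of_continuous (hB N) 2).coeFn_toLp] with p hp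
      rw [Pi.sub_apply, hp]
    rw [eLpNorm_congr_ae e, ← eLpNorm_one_eq_lintegral_enorm]
    exact eLpNorm_le_eLpNorm_of_exponent_le one_le_two (hm N)
  obtain ⟨ns, hns, hs⟩ := extraction_forall_of_eventually (P := fun n k =>
    ∫⁻ p, ‖B k p - b p‖ₑ ∂measQ ≤ ENNReal.ofReal ((1 / 2) ^ n))
    fun n => h1.eventually_le_const (ENNReal.ofReal_pos.2 (by positivity))
  refine ⟨ns, hns, ?_⟩
  -- the subsequence is so fast that the `L¹` distances on almost every slice are summable
  have hfin : ∫⁻ t : UnitAddCircle, ∑' N, ∫⁻ y in Ioo (0 : ℝ) 1, ‖B (ns N) (t, y) - b (t, y)‖ₑ ≠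
      ⊤ := by
    rw [lintegral_tsum fun N => (hm (ns N)).enorm.lintegral_prod_right']
    have e : ∀ N, ∫⁻ t : UnitAddCircle, ∫⁻ y in Ioo (0 : ℝ) 1, ‖B (ns N) (t, y) - b (t, y)‖ₑ =
        ∫⁻ p, ‖B (ns N) p - b p‖ₑ ∂measQ := fun N => (lintegral_prod _ (hm (ns N)).enorm).symm
    simp only [e]
    refine ne_top_of_le_ne_top ?_ (ENNReal.tsum_le_tsum hs)
    exact summable_geometric_two.tsum_ofReal_ne_top
  have hae := ae_lt_top' (AEMeasurable.tsum fun N =>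
    (hm (ns N)).enorm.lintegral_prod_right') hfin
  filter_upwards [hae, ae_integrableOn_section b] with t ht hbt x hx
  refine tendsto_integral_of_lintegral (fun N => ?_) hbt ?_ hx
  · have := hB (ns N)
    exact (Continuous.integrableOn_Icc (by fun_prop)).mono_set Ioc_subset_Icc_self
  · have := ENNReal.tendsto_atTop_zero_of_tsum_ne_top ht.ne
    simpa only [Measure.restrict_congr_set (Ioo_ae_eq_Ioc (a := (0 : ℝ)) (b := 1))] using this

theorem exists_seq_tendsto_ae {B : ℕ → UnitAddCircle × ℝ → ℝ} (hB : ∀ N, Continuous (B N))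
    {b : L2} (h : Tendsto (fun N => (memLp_of_continuous (hB N) 2).toLp (B N)) atTop (𝓝 b)) :
    ∃ ns : ℕ → ℕ, StrictMono ns ∧ ∀ᵐ p ∂measQ, Tendsto (fun N => B (ns N) p) atTop (𝓝 (b p)) := by
  obtain ⟨ns, hns, hae⟩ := (tendstoInMeasure_of_tendsto_Lp h).exists_seq_tendsto_ae
  refine ⟨ns, hns, ?_⟩
  have hall : ∀ᵐ p ∂measQ, ∀ N, (memLp_of_continuous (hB N) 2).toLp (B N) p = B N p :=
    ae_all_iff.2 fun N => MemLp.coeFn_toLp _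
  filter_upwards [hae, hall] with p h1 h2
  simpa only [h2] using h1

theorem IsC1x.integral_eq {f fx : UnitAddCircle × ℝ → ℝ} (h : IsC1x f fx) (t : UnitAddCircle)
    (x : ℝ) : ∫ y in (0 : ℝ)..x, fx (t, y) = f (t, x) - f (t, 0) := by
  have := h.contx
  exact intervalIntegral.integral_eq_sub_of_hasDerivAt (fun y _ => h.hasDeriv t y)
    (Continuous.intervalIntegrable (by fun_prop) _ _)

/-- A function in `L²(𝕋, H¹₀(I))` is the primitive from `0` of its derivative, whose
integrals over `I` vanish. -/
theorem CoefDxZero.ae_eq_primitive {b c : L2} (h : CoefDxZero b c) :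
    (∀ᵐ p ∂measQ, b p = ∫ y in (0 : ℝ)..p.2, c (p.1, y)) ∧
      ∀ᵐ t : UnitAddCircle, ∫ y in (0 : ℝ)..1, c (t, y) = 0 := by
  have hC := fun N => (h.isC1x_partialSum N).contx
  have hB := fun N => (h.isC1x_partialSum N).cont
  obtain ⟨ns, hns, hprim⟩ := exists_seq_tendsto_primitive hC
    (tendsto_toLp_partialSum isXBasis_cosB c tendsto_cosBox)
  have hb := (tendsto_toLp_partialSum isXBasis_sinB b tendsto_sinBox).comp hns.tendsto_atTop
  obtain ⟨ms, hms, hae⟩ := exists_seq_tendsto_ae (fun N => hB (ns N)) hb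
  have hint : ∀ N (t : UnitAddCircle) x, ∫ y in (0 : ℝ)..x,
      partialSum cosB (coef cosB c) (cosBox N) (t, y) =
      partialSum sinB (coef sinB b) (sinBox N) (t, x) := fun N t x => by
    rw [(h.isC1x_partialSum N).integral_eq]
    simp [partialSum, reMode, modeFun]
  simp only [hint] at hprim
  constructor
  · filter_upwards [hae, ae_fst hprim, ae_mem_measQ] with p h1 h2 h3
    exact tendsto_nhds_unique h1 ((h2 p.2 (Ioo_subset_Icc_self h3)).comp hms.tendsto_atTop)
  · filter_upwards [hprim] with t ht
    refine tendsto_nhds_unique (ht 1 (by simp)) ?_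
    simp [partialSum, reMode, modeFun]

theorem coef_cosB_zero (c : L2) (k : ℤ) : coef cosB c (k, 0) =
    ∫ t : UnitAddCircle, (fourier (-k) t : ℂ) * ((∫ y in (0 : ℝ)..1, c (t, y) : ℝ) : ℂ) := by
  have hi : Integrable (fun p : UnitAddCircle × ℝ =>
      (fourier (-k) p.1 * (cosB 0 p.2 : ℂ) * (c p : ℂ) : ℂ)) measQ :=
    integrable_bdd_mul (g := fun p => fourier (-k) p.1 * (cosB 0 p.2 : ℂ)) (C := 2)
      (by have := continuous_cosB 0; fun_prop)
      (fun p => by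
        rw [norm_mul, norm_fourier_apply, one_mul, Complex.norm_real]; exact abs_cosB_le _ _)
      (integrable_ofReal c)
  rw [coef, coefC]
  refine (integral_prod _ hi).trans ?_
  congr 1; ext t
  simp only [cosB_zero, Complex.ofReal_one, mul_one]
  rw [integral_const_mul, integral_complex_ofReal, intervalIntegral.integral_of_le zero_le_one,
    Measure.restrict_congr_set (Ioo_ae_eq_Ioc (a := (0 : ℝ)) (b := 1))]

/-- A function in `L²(𝕋, H¹(I))` with vanishing traces has a derivative in the sense of
`CoefDxZero`. -/
theorem coefDxZero_of_traces {b c : L2} (h0 : ∀ᵐ p ∂measQ, b p = ∫ y in (0 : ℝ)..p.2, c (p.1, y))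
    (h1 : ∀ᵐ p ∂measQ, b p = ∫ y in (1 : ℝ)..p.2, c (p.1, y)) : CoefDxZero b c := by
  have hz : ∀ᵐ t : UnitAddCircle, ∫ y in (0 : ℝ)..1, c (t, y) = 0 := by
    refine ae_of_ae_fst (P := fun t => ∫ y in (0 : ℝ)..1, c (t, y) = 0) ?_
    filter_upwards [h0, h1, ae_fst (ae_integrableOn_section c), ae_mem_measQ] with p e0 e1 hi hp
    have i1 : IntervalIntegrable (fun y => c (p.1, y)) volume 0 1 :=
      (intervalIntegrable_iff_integrableOn_Ioc_of_le zero_le_one).2 hi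
    have hsub : uIcc 1 p.2 ⊆ uIcc (0 : ℝ) 1 :=
      uIcc_subset_uIcc (by simp) (by rw [uIcc_of_le zero_le_one]; exact Ioo_subset_Icc_self hp)
    have := intervalIntegral.integral_add_adjacent_intervals i1 (i1.mono_set hsub)
    linarith
  have hc0 : ∀ k, coef cosB c (k, 0) = 0 := fun k => by
    rw [coef_cosB_zero]
    refine integral_eq_zero_of_ae ?_
    filter_upwards [hz] with t ht
    simp [ht]
  -- the candidate for `b` is the function whose sine coefficients are read off from `c`
  set d : ℤ × ℕ → ℂ := fun i => coef cosB c (i.1, i.2 + 1) / ((i.2 + 1) * Real.pi) with hd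
  have hpi : ∀ n : ℕ, ((n + 1) * Real.pi : ℂ) = (((n + 1) * Real.pi : ℝ) : ℂ) := fun n => by
    push_cast; ring
  have hne : ∀ n : ℕ, ((n + 1) * Real.pi : ℂ) ≠ 0 := fun n => by
    rw [hpi, Complex.ofReal_ne_zero]; positivity
  have hsymm : ConjSymm d := fun k n => by
    simp only [hd]
    rw [conjSymm_coef c k, map_div₀, hpi, Complex.conj_ofReal]
  have hsum : Summable fun i => ‖d i‖ ^ 2 := by
    have h2 := (hasSum_sq_coef isXBasis_cosB c).summable
    have h3 : Summable fun i : ℤ × ℕ => ‖coef cosB c (i.1, i.2 + 1)‖ ^ 2 :=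
      ((hasSum_succ_iff (f := fun i => ‖coef cosB c i‖ ^ 2) (fun k => by simp [hc0])).2
        h2.hasSum).summable
    refine h3.of_nonneg_of_le (fun i => by positivity) fun i => ?_
    gcongr
    rw [hd, norm_div, hpi, Complex.norm_real, Real.norm_of_nonneg (by positivity)]
    refine div_le_self (norm_nonneg _) ?_
    have := Real.pi_gt_three
    nlinarith [(Nat.cast_nonneg i.2 : (0 : ℝ) ≤ i.2)]
  obtain ⟨b', hb'⟩ := exists_coef_eq isXBasis_sinB hsymm hsum
  have hz' : CoefDxZero b' c := ⟨hc0, fun k n => by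
    rw [hb', hd, mul_div_cancel₀ _ (hne n)]⟩
  have : b = b' := by
    ext1
    filter_upwards [h0, hz'.ae_eq_primitive.1] with p e0 e1
    rw [e0, e1]
  rwa [this]

theorem HasDerivs.dt_eq {W a b c : L2} (h : HasDerivs W a b c) : dt W = a :=
  HasFracDeriv.fracDeriv_eq ((hasFracDeriv_iff isXBasis_cosB).2 fun k n => by
    rw [h.time, fracSymbol_one])

theorem HasDerivs.dx_eq {W a b c : L2} (h : HasDerivs W a b c) : dx W = b := h.space.hasDx.dx_eq

theorem HasDerivs.dx_dx_eq {W a b c : L2} (h : HasDerivs W a b c) : dx (dx W) = c := by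
  rw [h.dx_eq, h.space₂.hasDx.dx_eq]

/-- The description of `H^{1,2}_N(Q)` by coefficients implies the one by weak derivatives and
traces. -/
theorem HasDerivs.mem_sobolevN {W a b c : L2} (h : HasDerivs W a b c) : W ∈ sobolevN := by
  have e : dx b = c := h.space₂.hasDx.dx_eq
  obtain ⟨h0, h1⟩ := h.space₂.ae_eq_primitive
  refine ⟨⟨⟨a, (hasFracDeriv_iff isXBasis_cosB).2 fun k n => by rw [h.time, fracSymbol_one]⟩,
    b, h.space.hasDx, c, h.space₂.hasDx⟩, ?_, ?_⟩
  · rw [ZeroTraceAt, h.dx_eq, e]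
    exact h0
  · rw [ZeroTraceAt, h.dx_eq, e]
    filter_upwards [h0, ae_fst h1, ae_fst (ae_integrableOn_section c), ae_mem_measQ]
      with p e0 e1 hi hp
    have i1 : IntervalIntegrable (fun y => c (p.1, y)) volume 0 1 :=
      (intervalIntegrable_iff_integrableOn_Ioc_of_le zero_le_one).2 hi
    have hsub : uIcc 1 p.2 ⊆ uIcc (0 : ℝ) 1 :=
      uIcc_subset_uIcc (by simp) (by rw [uIcc_of_le zero_le_one]; exact Ioo_subset_Icc_self hp)
    have := intervalIntegral.integral_add_adjacent_intervals i1 (i1.mono_set hsub)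
    linarith

/-- Conversely, weak derivatives and vanishing traces of `W_x` determine all coefficients. -/
theorem hasDerivs_of_mem_sobolevN {W : L2} (h : W ∈ sobolevN) :
    HasDerivs W (dt W) (dx W) (dx (dx W)) := by
  obtain ⟨⟨⟨a, ha⟩, b, hb, c, hc⟩, h0, h1⟩ := h
  rw [hb.dx_eq, ZeroTraceAt, hc.dx_eq] at h0 h1
  rw [hb.dx_eq, hc.dx_eq, dt, ha.fracDeriv_eq]
  refine ⟨fun k n => ?_, hb.coefDx, coefDxZero_of_traces h0 h1⟩
  rw [(hasFracDeriv_iff isXBasis_cosB).1 ha, fracSymbol_one]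

/-- The representation `W(t,x) = ∫₀ˣ W_x(t,y) dy - h(t)` with `h` continuous. -/
theorem HasDerivs.ae_eq_primitive {W a b c : L2} (h : HasDerivs W a b c) :
    ∀ᵐ p ∂measQ, W p = (∫ y in (0 : ℝ)..p.2, b (p.1, y)) - -contRep W (p.1, 0) := by
  have hN := fun N => (isNeumannC2_partialSum h N).c1
  obtain ⟨ns, hns, hprim⟩ := exists_seq_tendsto_primitive (fun N => (hN N).contx)
    (tendsto_toLp_partialSum isXBasis_sinB b tendsto_sinBox)
  filter_upwards [ae_fst hprim, ae_mem_measQ, ae_eq_contRep h] with p h1 h2 h3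
  have h4 := h1 p.2 (Ioo_subset_Icc_self h2)
  simp only [(hN _).integral_eq] at h4
  have hu := fun q => ((tendstoUniformly_contRep h).tendsto_at q).comp hns.tendsto_atTop
  have := tendsto_nhds_unique h4 ((hu (p.1, p.2)).sub (hu (p.1, 0)))
  rw [this, h3]; ring

/-! ### Coefficients of solutions of the Burgers equation -/

theorem coef_const (K : ℝ) (i : ℤ × ℕ) :
    coef cosB (fun _ => K) i = if i = (0, 0) then (K : ℂ) else 0 := by
  have h1 : coefC cosB (fun _ => 1) i = if i = (0, 0) then 1 else 0 := by
    rw [← coefC_mode isXBasis_cosB]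
    refine coefC_congr ?_ _
    filter_upwards [(memLp_modeFun isXBasis_cosB (0, 0)).coeFn_toLp] with p hp
    rw [mode, hp]
    simp [modeFun]
  rw [coef, coefC, integral_mul_const]
  have h2 : coefC cosB (fun _ => 1) i =
      ∫ p, fourier (-i.1) p.1 * (cosB i.2 p.2 : ℂ) ∂measQ := by simp [coefC]
  rw [← h2, h1]
  split_ifs <;> simp

/-- The constant function `K` in `L²(Q)`. -/
def constL (K : ℝ) : L2 := (memLp_const K).toLp fun _ => K

theorem coeFn_constL (K : ℝ) : constL K =ᵐ[measQ] fun _ => K := MemLp.coeFn_toLp _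

theorem coef_constL (K : ℝ) (i : ℤ × ℕ) :
    coef cosB (constL K) i = if i = (0, 0) then (K : ℂ) else 0 := by
  rw [coef_congr (coeFn_constL K), coef_const]

/-- A family indexed by the sine modes, as a family indexed by the cosine modes. -/
def shiftMode {E : Type*} [Zero E] (g : ℤ × ℕ → E) : ℤ × ℕ → E
  | (_, 0) => 0
  | (k, n + 1) => g (k, n)

theorem summable_shiftMode {g : ℤ × ℕ → ℝ} (h : Summable g) : Summable (shiftMode g) :=
  ((hasSum_succ_iff (f := shiftMode g) fun _ => rfl).1 h.hasSum).summable

theorem succ_mul_pi_ne_zero (n : ℕ) : ((n + 1) * Real.pi : ℂ) ≠ 0 := by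
  rw [← norm_ne_zero_iff, norm_succ_mul_pi]; positivity

/-- Membership in `H^{1/2,1}_0(Q)` is a weighted summability condition. -/
theorem mem_H_of_summable {w : L2} (h : Summable fun i => sinWeight i * ‖coef sinB w i‖ ^ 2) :
    w ∈ H := by
  obtain ⟨a, ha⟩ := exists_coef_eq isXBasis_sinB
    (d := fun i => fracSymbol (1 / 2) i.1 * coef sinB w i)
    (fun k n => by simp only [fracSymbol_neg, conjSymm_coef w k n, map_mul])
    ((h.mul_left (2 * Real.pi)).of_nonneg_of_le (fun i => by positivity) fun i => by
      rw [norm_mul, mul_pow, norm_fracSymbol_half_sq, mul_assoc, mul_assoc, mul_assoc]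
      have : |(i.1 : ℝ)| ≤ sinWeight i := by
        rw [sinWeight_eq]; nlinarith [sq_nonneg ((i.2 : ℝ) + 1)]
      have := Real.pi_pos
      gcongr)
  obtain ⟨b, hb⟩ := exists_coef_eq isXBasis_cosB
    (d := shiftMode fun i => (i.2 + 1) * Real.pi * coef sinB w i)
    (fun k n => by
      cases n with
      | zero => simp [shiftMode]
      | succ n => simp [shiftMode, conjSymm_coef w k n])
    ((summable_shiftMode (h.mul_left (Real.pi ^ 2))).of_nonneg_of_le (fun i => by positivity)
      fun i => by
        obtain ⟨k, n⟩ := i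
        cases n with
        | zero => simp [shiftMode]
        | succ n =>
          simp only [shiftMode]
          rw [norm_mul, norm_succ_mul_pi, mul_pow, mul_pow, mul_comm (((n : ℝ) + 1) ^ 2), mul_assoc]
          have : ((n : ℝ) + 1) ^ 2 ≤ sinWeight (k, n) := by
            rw [sinWeight_eq]; simp only; linarith [abs_nonneg (k : ℝ)]
          gcongr)
  refine mem_H_of_coef (a := a) (b := b) ((hasFracDeriv_iff isXBasis_sinB).2 fun k n => ha (k, n))
    ⟨fun k => hb (k, 0), fun k n => hb (k, n + 1)⟩

theorem HasFracDeriv.exists_adj {s : ℝ} {w a : L2} (h : HasFracDeriv s w a) :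
    ∃ e, HasFracDerivAdj s w e := by
  rw [hasFracDeriv_iff isXBasis_sinB] at h
  obtain ⟨e, he⟩ := exists_coef_eq isXBasis_sinB
    (d := fun i => (starRingEnd ℂ) (fracSymbol s i.1) * coef sinB w i)
    (fun k n => by simp only [fracSymbol_neg, conjSymm_coef w k n, map_mul])
    ((hasSum_sq_coef isXBasis_sinB a).summable.congr fun i => by
      rw [h i.1 i.2, norm_mul, norm_mul, RCLike.norm_conj])
  exact ⟨e, (hasFracDerivAdj_iff isXBasis_sinB).2 fun k n => he (k, n)⟩

/-- The sine coefficients of the distribution `w_t - G_x`. -/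
def residual (w G : L2) (i : ℤ × ℕ) : ℂ :=
  2 * Real.pi * Complex.I * i.1 * coef sinB w i + (i.2 + 1) * Real.pi * coef cosB G (i.1, i.2 + 1)

theorem conjSymm_residual (w G : L2) : ConjSymm (residual w G) := fun k n => by
  simp only [residual, conjSymm_coef w k n, conjSymm_coef G k (n + 1)]
  simp [map_ofNat]

/-- The pairing of `w_t - G_x` with `χ`, in terms of coefficients. -/
theorem hasSum_residual {w G χ : L2} (hw : w ∈ H) (hχ : χ ∈ H) :
    HasSum (fun i => (starRingEnd ℂ) (residual w G i) * coef sinB χ i)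
      (((inner ℝ (fracDeriv (1 / 2) w) (fracDerivAdj (1 / 2) χ) + inner ℝ G (dx χ) : ℝ)) : ℂ) := by
  have hz := coefDxZero_of_mem_H hχ
  obtain ⟨⟨⟨a, ha⟩, -⟩, -⟩ := hw
  obtain ⟨⟨⟨e', he'⟩, -⟩, -⟩ := hχ
  obtain ⟨e, he⟩ := he'.exists_adj
  rw [ha.fracDeriv_eq, he.fracDerivAdj_eq]
  rw [hasFracDeriv_iff isXBasis_sinB] at ha
  rw [hasFracDerivAdj_iff isXBasis_sinB] at he
  have h1 := hasSum_coef_mul isXBasis_sinB a e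
  have h2 := hasSum_coef_mul isXBasis_cosB G (dx χ)
  rw [← hasSum_succ_iff (fun k => by rw [hz.1 k, mul_zero])] at h2
  have h3 := h1.add h2
  rw [← Complex.ofReal_add] at h3
  refine h3.congr_fun fun i => ?_
  obtain ⟨k, n⟩ := i
  simp only
  rw [ha, he, hz.2, residual, ← fracSymbol_half_sq]
  simp only [map_add, map_mul, map_pow, Complex.conj_ofReal, map_natCast, map_one]
  ring

/-- Testing with single modes: the pairing vanishes if and only if all coefficients do. -/
theorem residual_eq_zero_iff {w G : L2} (hw : w ∈ H) :
    (∀ i, residual w G i = 0) ↔ ∀ χ ∈ H,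
      inner ℝ (fracDeriv (1 / 2) w) (fracDerivAdj (1 / 2) χ) + inner ℝ G (dx χ) = (0 : ℝ) := by
  constructor
  · intro h χ hχ
    have := hasSum_residual (G := G) hw hχ
    simp only [h, map_zero, zero_mul] at this
    exact_mod_cast this.unique hasSum_zero
  · rintro h ⟨k₀, n₀⟩
    classical
    set S : Finset (ℤ × ℕ) := {(k₀, n₀), (-k₀, n₀)} with hS
    have hmem : ∀ k n, ((-k, n) : ℤ × ℕ) ∈ S ↔ (k, n) ∈ S := by
      intro k n
      simp only [hS, Finset.mem_insert, Finset.mem_singleton, Prod.mk.injEq]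
      constructor
      · rintro (⟨h1, h2⟩ | ⟨h1, h2⟩)
        · exact Or.inr ⟨by omega, h2⟩
        · exact Or.inl ⟨by omega, h2⟩
      · rintro (⟨h1, h2⟩ | ⟨h1, h2⟩)
        · exact Or.inr ⟨by omega, h2⟩
        · exact Or.inl ⟨by omega, h2⟩
    obtain ⟨χ, hχ⟩ := exists_coef_eq isXBasis_sinB
        (d := fun i => if i ∈ S then residual w G i else 0)
      (fun k n => by
        simp only [hmem, conjSymm_residual w G k n]
        split_ifs <;> simp)
      (summable_of_ne_finset_zero (s := S) fun i hi => by simp [hi])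
    have hχH : χ ∈ H := mem_H_of_summable
      (summable_of_ne_finset_zero (s := S) fun i hi => by simp [hχ, hi])
    have h1 := hasSum_residual (G := G) hw hχH
    rw [h χ hχH] at h1
    have h2 : HasSum (fun i => if i ∈ S then ‖residual w G i‖ ^ 2 else 0) 0 := by
      rw [← Complex.hasSum_ofReal]
      refine h1.congr_fun fun i => ?_
      rw [hχ]
      split_ifs
      · rw [← Complex.normSq_eq_conj_mul_self, Complex.normSq_eq_norm_sq]
      · simp
    rw [hasSum_zero_iff_of_nonneg fun i => by split_ifs <;> positivity] at h2
    have := congrFun h2 (k₀, n₀)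
    simpa [hS] using this

/-! ### The Burgers equation and its integrated form -/

/-- `G = μ w_x - w²/2 - v w`, so that the Burgers equation for `w` reads `w_t = G_x`. -/
def IsFlux (μ : ℝ) (v w G : L2) : Prop :=
  G =ᵐ[measQ] fun p => μ * dx w p - 1 / 2 * w p ^ 2 - v p * w p

/-- The flux is square integrable by the `L⁴` estimate, and `w ∈ S₁` means that `w_t - G_x`
vanishes. -/
theorem exists_isFlux (μ : ℝ) {v w : L2} (hv : v ∈ H) (hw : w ∈ H) : ∃ G, IsFlux μ v w G ∧
    ∀ χ, burgersOp μ w χ + dxMul v w χ =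
      inner ℝ (fracDeriv (1 / 2) w) (fracDerivAdj (1 / 2) χ) + inner ℝ G (dx χ) := by
  have hw4 := memLp_four_of_mem_H hw
  have hsq := memLp_mul_of_four hw4 hw4
  have hvw := memLp_mul_of_four (memLp_four_of_mem_H hv) hw4
  refine ⟨μ • dx w - (1 / 2 : ℝ) • hsq.toLp _ - hvw.toLp _, ?_, fun χ => ?_⟩
  · filter_upwards [Lp.coeFn_sub (μ • dx w - (1 / 2 : ℝ) • hsq.toLp _) (hvw.toLp _),
      Lp.coeFn_sub (μ • dx w) ((1 / 2 : ℝ) • hsq.toLp _), Lp.coeFn_smul μ (dx w),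
      Lp.coeFn_smul (1 / 2 : ℝ) (hsq.toLp _), hsq.coeFn_toLp, hvw.coeFn_toLp]
      with p h1 h2 h3 h4 h5 h6
    rw [h1, Pi.sub_apply, h2, Pi.sub_apply, h3, h4, Pi.smul_apply, Pi.smul_apply, h5, h6,
      smul_eq_mul, smul_eq_mul]
    ring
  · rw [inner_sub_left, inner_sub_left, inner_smul_left, inner_smul_left,
      real_inner_comm _ (hsq.toLp _), real_inner_comm _ (hvw.toLp _), inner_toLp, inner_toLp,
      burgersOp, linOp, nonlinOp, dxMul]
    have e1 : ∫ p, w p ^ 2 * dx χ p ∂measQ = ∫ p, dx χ p * (w p * w p) ∂measQ := by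
      congr 1; ext p; ring
    have e2 : ∫ p, v p * w p * dx χ p ∂measQ = ∫ p, dx χ p * (v p * w p) ∂measQ := by
      congr 1; ext p; ring
    rw [e1, e2]
    simp only [conj_trivial]
    ring

theorem mem_S1_iff {μ : ℝ} {v w : L2} (hv : v ∈ H) (hw : w ∈ H) :
    w ∈ S1 μ v ↔ ∃ G, IsFlux μ v w G ∧ ∀ i, residual w G i = 0 := by
  obtain ⟨G, hG, h⟩ := exists_isFlux μ hv hw
  have key : w ∈ S1 μ v ↔ ∀ i, residual w G i = 0 := by
    rw [residual_eq_zero_iff hw]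
    simp only [← h]
    refine ⟨fun hs χ hχ => ?_, fun hs => ⟨hw, fun χ hχ => ?_⟩⟩
    · rw [hs.2 χ hχ]; ring
    · linarith [hs χ hχ]
  rw [key]
  refine ⟨fun hr => ⟨G, hG, hr⟩, ?_⟩
  rintro ⟨G', hG', hr⟩
  rwa [show G = G' from Lp.ext (hG.trans hG'.symm)]

/-- `W_t - μ W_xx + (W_x)²/2 = - v W_x + K`, for given derivatives `a = W_t`, `b = W_x`,
`c = W_xx`. -/
def IsPotential (μ : ℝ) (v a b c : L2) (K : ℝ) : Prop :=
  ∀ᵐ p ∂measQ, a p - μ * c p + 1 / 2 * b p ^ 2 = -(v p * b p) + K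

/-- The derivative of a function in `H^{1,2}_N(Q)` belongs to `H^{1/2,1}_0(Q)`. -/
theorem HasDerivs.mem_H {W a b c : L2} (h : HasDerivs W a b c) : b ∈ H :=
  mem_H_of_summable (summable_sinWeight_of_hasDerivs h)

theorem IsPotential.isFlux {μ K : ℝ} {v W a b c : L2} (h : HasDerivs W a b c)
    (hp : IsPotential μ v a b c K) : IsFlux μ v b (a - constL K) := by
  have e : dx b = c := h.space₂.hasDx.dx_eq
  rw [IsFlux, e]
  filter_upwards [hp, Lp.coeFn_sub a (constL K), coeFn_constL K] with p h1 h2 h3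
  rw [h2, Pi.sub_apply, h3]
  linarith

/-- Differentiating the integrated equation in `x`. -/
theorem mem_S1_of_isPotential {μ K : ℝ} {v W a b c : L2} (hv : v ∈ H) (h : HasDerivs W a b c)
    (hp : IsPotential μ v a b c K) : b ∈ S1 μ v := by
  refine (mem_S1_iff hv h.mem_H).2 ⟨_, hp.isFlux h, fun i => ?_⟩
  obtain ⟨k, n⟩ := i
  rw [residual, coef_sub isXBasis_cosB, coef_constL, h.time, h.space]
  simp
  ring

/-- Integrating the Burgers equation in `x`. -/
theorem exists_potential {μ : ℝ} {v w : L2} (hv : v ∈ H) (hw : w ∈ S1 μ v) :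
    ∃ (W a c : L2) (K : ℝ), HasDerivs W a w c ∧ IsPotential μ v a w c K := by
  obtain ⟨G, hG, hr⟩ := (mem_S1_iff hv hw.1).1 hw
  have hz := coefDxZero_of_mem_H hw.1
  -- the mean values in `x` are determined by the equation, the other coefficients by `W_x = w`
  set d : ℤ × ℕ → ℂ := fun i => match i with
    | (k, 0) => coef cosB G (k, 0) / (2 * Real.pi * Complex.I * k)
    | (k, n + 1) => -coef sinB w (k, n) / ((n + 1) * Real.pi) with hd
  have hsymm : ConjSymm d := fun k n => by
    cases n with
    | zero =>
      simp only [hd, conjSymm_coef G k]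
      rw [map_div₀]
      simp [map_ofNat]
    | succ n => simp [hd, conjSymm_coef w k n]
  have hsum : Summable fun i => ‖d i‖ ^ 2 := by
    have h1 := (hasSum_sq_coef isXBasis_cosB G).summable
    have h2 := summable_shiftMode (hasSum_sq_coef isXBasis_sinB w).summable
    refine (h1.add h2).of_nonneg_of_le (fun i => by positivity) fun i => ?_
    have hp := Real.pi_gt_three
    obtain ⟨k, n⟩ := i
    cases n with
    | zero =>
      simp only [shiftMode, add_zero, hd]
      gcongr
      by_cases hk : k = 0
      · simp [hk]
      rw [norm_div]
      refine div_le_self (norm_nonneg _) ?_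
      have : (1 : ℝ) ≤ |(k : ℝ)| := by exact_mod_cast Int.one_le_abs hk
      simp only [norm_mul, Complex.norm_ofNat, Complex.norm_real, Complex.norm_I,
        Complex.norm_intCast, Real.norm_of_nonneg Real.pi_pos.le]
      nlinarith
    | succ n =>
      simp only [shiftMode, hd]
      refine le_add_of_nonneg_of_le (by positivity) ?_
      gcongr
      rw [norm_div, norm_neg, norm_succ_mul_pi]
      refine div_le_self (norm_nonneg _) ?_
      nlinarith [(Nat.cast_nonneg n : (0 : ℝ) ≤ n)]
  obtain ⟨W, hW⟩ := exists_coef_eq isXBasis_cosB hsymm hsum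
  have hreal : ((-(coef cosB G (0, 0)).re : ℝ) : ℂ) = -coef cosB G (0, 0) := by
    have := conjSymm_coef (γ := cosB) G 0 0
    rw [neg_zero] at this
    rw [Complex.ofReal_neg, Complex.conj_eq_iff_re.1 this.symm]
  refine ⟨W, G + constL (-(coef cosB G (0, 0)).re), dx w, -(coef cosB G (0, 0)).re,
    ⟨fun k n => ?_, fun k n => ?_, hz⟩, ?_⟩
  · rw [coef_add isXBasis_cosB, coef_constL, hreal, hW]
    cases n with
    | zero =>
      by_cases hk : k = 0
      · simp [hk]
      · have : (2 * Real.pi * Complex.I * k : ℂ) ≠ 0 := by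
          simp [hk, Real.pi_ne_zero]
        simp only [hd]
        rw [mul_div_cancel₀ _ this]
        simp [hk]
    | succ n =>
      have h1 := hr (k, n)
      have h2 := succ_mul_pi_ne_zero n
      simp only [residual] at h1
      simp only [hd]
      rw [← mul_right_inj' h2]
      simp only [Prod.mk.injEq, Nat.add_eq_zero_iff, one_ne_zero, and_false, if_false, add_zero]
      rw [← mul_assoc, mul_comm _ (2 * Real.pi * Complex.I * k : ℂ), mul_assoc (_ * _ * _ * _),
        mul_div_cancel₀ _ h2]
      linear_combination h1
  · rw [hW]
    simp only [hd]
    have h2 := succ_mul_pi_ne_zero n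
    rw [neg_mul, mul_div_cancel₀ _ h2, neg_neg]
  · filter_upwards [hG, Lp.coeFn_add G (constL (-(coef cosB G (0, 0)).re)),
      coeFn_constL (-(coef cosB G (0, 0)).re)] with p h1 h2 h3
    rw [h2, Pi.add_apply, h1, h3]
    ring

theorem HasDerivs.congr_add_const {W a b c W' : L2} (h : HasDerivs W a b c) {K : ℝ}
    (hW : W' =ᵐ[measQ] fun p => W p + K) : HasDerivs W' a b c := by
  have e : W' = W + constL K := by
    ext1
    filter_upwards [hW, Lp.coeFn_add W (constL K), coeFn_constL K] with p h1 h2 h3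
    rw [h1, h2, Pi.add_apply, h3]
  refine ⟨fun k n => ?_, fun k n => ?_, h.space₂⟩
  · rw [h.time, e, coef_add isXBasis_cosB, coef_constL]
    by_cases hk : k = 0 <;> simp [hk]
  · rw [h.space, e, coef_add isXBasis_cosB, coef_constL]
    simp

/-- A solution of the integrated equation is determined by `W_x`, up to additive constants. -/
theorem potential_unique {μ K K' : ℝ} {v W W' a a' b c c' : L2} (h : HasDerivs W a b c)
    (h' : HasDerivs W' a' b c') (hp : IsPotential μ v a b c K) (hp' : IsPotential μ v a' b c' K') :
    K = K' ∧ ∃ r : ℝ, W' =ᵐ[measQ] fun p => W p + r := by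
  have hG : a - constL K = a' - constL K' := Lp.ext ((hp.isFlux h).trans (hp'.isFlux h').symm)
  have hco : ∀ i, coef cosB a i - (if i = (0, 0) then (K : ℂ) else 0) =
      coef cosB a' i - (if i = (0, 0) then (K' : ℂ) else 0) := fun i => by
    rw [← coef_constL, ← coef_constL, ← coef_sub isXBasis_cosB, ← coef_sub isXBasis_cosB, hG]
  have hK : K = K' := by
    have := hco (0, 0)
    rw [h.time, h'.time] at this
    simpa using this
  refine ⟨hK, (coef cosB W' (0, 0) - coef cosB W (0, 0)).re, ?_⟩
  set r := (coef cosB W' (0, 0) - coef cosB W (0, 0)).re with hr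
  have hr' : (r : ℂ) = coef cosB W' (0, 0) - coef cosB W (0, 0) := by
    refine Complex.conj_eq_iff_re.1 ?_
    have e1 := conjSymm_coef (γ := cosB) W 0 0
    have e2 := conjSymm_coef (γ := cosB) W' 0 0
    rw [neg_zero] at e1 e2
    rw [map_sub, ← e1, ← e2]
  have e : W' = W + constL r := by
    refine L2.ext_coef isXBasis_cosB fun i => ?_
    rw [coef_add isXBasis_cosB, coef_constL]
    obtain ⟨k, n⟩ := i
    cases n with
    | zero =>
      by_cases hk : k = 0
      · simp [hk, hr']
      · have : (2 * Real.pi * Complex.I * k : ℂ) ≠ 0 := by simp [hk, Real.pi_ne_zero]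
        have e1 := hco (k, 0)
        rw [h.time, h'.time] at e1
        simp only [Prod.mk.injEq, hk, false_and, if_false, sub_zero] at e1
        simp [hk, mul_left_cancel₀ this e1]
    | succ n =>
      have e1 := (h.space k n).symm.trans (h'.space k n)
      simp [mul_left_cancel₀ (neg_ne_zero.2 (succ_mul_pi_ne_zero n)) e1]
  filter_upwards [Lp.coeFn_add W (constL r), coeFn_constL r] with p h1 h2
  rw [e, h1, Pi.add_apply, h2]

/-! ### The Cole–Hopf transformation -/

/-- `φ_t - μ φ_xx + v φ_x + K φ = 0`, for given derivatives of `φ`. -/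
def IsHeatSol (μ : ℝ) (v φ a b c : L2) (K : ℝ) : Prop :=
  ∀ᵐ p ∂measQ, a p - μ * c p + v p * b p + K * φ p = 0

theorem HasDerivs.smul {W a b c : L2} (r : ℝ) (h : HasDerivs W a b c) :
    HasDerivs (r • W : L2) (r • a : L2) (r • b : L2) (r • c : L2) where
  time k n := by rw [coef_smul isXBasis_cosB, coef_smul isXBasis_cosB, h.time]; ring
  space k n := by rw [coef_smul isXBasis_sinB, coef_smul isXBasis_cosB, h.space]; ring
  space₂ := ⟨fun k => by rw [coef_smul isXBasis_cosB, h.space₂.1, mul_zero], fun k n => by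
    rw [coef_smul isXBasis_sinB, coef_smul isXBasis_cosB, h.space₂.2]; ring⟩

theorem hasDerivAt_exp_neg_div (m y : ℝ) :
    HasDerivAt (fun y => Real.exp (-y / m)) (-(1 / m) * Real.exp (-y / m)) y := by
  have := ((hasDerivAt_id y).neg.div_const m).exp
  exact this.congr_deriv (by simp only [Pi.neg_apply, id]; ring)

/-- `exp(-W/2μ)` belongs to `H^{1,2}_{N+}(Q)`, and the linear equation for it is the integrated
Burgers equation for `W` multiplied by `-exp(-W/2μ)/2μ`. -/
theorem exists_exp {μ : ℝ} (hμ : 0 < μ) (v : L2) (K : ℝ) {W a b c : L2} (h : HasDerivs W a b c) :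
    ∃ φ a' b' c' : L2, HasDerivs φ a' b' c' ∧
      (φ =ᵐ[measQ] fun p => Real.exp (-W p / (2 * μ))) ∧ φ ∈ sobolevNPos ∧
      (IsHeatSol μ v φ a' b' c' (K / (2 * μ)) ↔ IsPotential μ v a b c K) := by
  have hd := hasDerivAt_exp_neg_div (2 * μ)
  obtain ⟨φ, a', b', c', h', e0, e1, e2, e3⟩ := h.comp (F := fun y => Real.exp (-y / (2 * μ)))
    hd (fun y => (hd y).const_mul _) (by fun_prop)
  refine ⟨φ, a', b', c', h', e0, ⟨h'.mem_sobolevN, fun p => Real.exp (-contRep W p / (2 * μ)),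
    ?_, fun p _ => Real.exp_pos _, ?_⟩, ?_⟩
  · have := continuous_contRep h
    exact Continuous.continuousOn (by fun_prop)
  · filter_upwards [e0, ae_eq_contRep h] with p h1 h2
    rw [h1, h2]
  · have key : ∀ᵐ p ∂measQ, a' p - μ * c' p + v p * b' p + K / (2 * μ) * φ p =
        -(Real.exp (-W p / (2 * μ)) / (2 * μ)) *
          (a p - μ * c p + 1 / 2 * b p ^ 2 - (-(v p * b p) + K)) := by
      filter_upwards [e0, e1, e2, e3] with p h0 h1 h2 h3
      rw [h0, h1, h2, h3]
      field_simp
      ring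
    refine eventually_congr ?_
    filter_upwards [key] with p hp
    have : -(Real.exp (-W p / (2 * μ)) / (2 * μ)) ≠ 0 := neg_ne_zero.2 (by positivity)
    rw [hp, mul_eq_zero, or_iff_right this, sub_eq_zero]

/-- Any `C²` function which agrees with the logarithm on `[c, ∞)` serves the chain rule. -/
theorem exists_log_extension {c : ℝ} (hc : 0 < c) :
    ∃ F : ℝ → ℝ, ContDiff ℝ 2 F ∧ ∀ y, c ≤ y → F y = Real.log y := by
  set g : ℝ → ℝ := fun y => c / 2 + (y - c / 2) * Real.smoothTransition ((y - c / 2) / (c / 2))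
  have hg : ContDiff ℝ 2 g :=
    contDiff_const.add ((contDiff_id.sub contDiff_const).mul
      (Real.smoothTransition.contDiff.comp ((contDiff_id.sub contDiff_const).div_const _)))
  have hpos : ∀ y, 0 < g y := fun y => by
    rcases le_total y (c / 2) with hy | hy
    · have : Real.smoothTransition ((y - c / 2) / (c / 2)) = 0 :=
        Real.smoothTransition.zero_of_nonpos (div_nonpos_of_nonpos_of_nonneg (by linarith)
            (by linarith))
      simp only [g, this]; linarith
    · have h1 := Real.smoothTransition.nonneg ((y - c / 2) / (c / 2))
      have h2 : 0 ≤ (y - c / 2) * Real.smoothTransition ((y - c / 2) / (c / 2)) :=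
        mul_nonneg (by linarith) h1
      simp only [g]; linarith
  refine ⟨fun y => Real.log (g y), hg.log fun y => (hpos y).ne', fun y hy => ?_⟩
  have : Real.smoothTransition ((y - c / 2) / (c / 2)) = 1 :=
    Real.smoothTransition.one_of_one_le (by rw [le_div_iff₀ (by linarith)]; linarith)
  simp only [g, this]
  congr 1; ring

/-- Every function in `H^{1,2}_{N+}(Q)` is of the form `exp(-W/2μ)`. -/
theorem exists_log {μ : ℝ} (hμ : 0 < μ) {φ : L2} (hφ : φ ∈ sobolevNPos) :
    ∃ W a b c : L2, HasDerivs W a b c ∧ φ =ᵐ[measQ] fun p => Real.exp (-W p / (2 * μ)) := by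
  obtain ⟨hN, f, hf, hpos, hφf⟩ := hφ
  obtain ⟨p₀, hp₀, hmin⟩ := (isCompact_univ.prod
      (isCompact_Icc (a := (0 : ℝ)) (b := 1))).exists_isMinOn
    ⟨((0 : UnitAddCircle), (0 : ℝ)), by simp⟩ hf
  obtain ⟨F, hF, hFlog⟩ := exists_log_extension (hpos p₀ hp₀)
  have hF1 : ContDiff ℝ 1 (deriv F) := (contDiff_succ_iff_deriv (n := 1)).1 hF |>.2.2
  obtain ⟨U, a, b, c, h, e, -⟩ := (hasDerivs_of_mem_sobolevN hN).comp
    (fun y => (hF.differentiable (by norm_num) y).hasDerivAt)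
    (fun y => (hF1.differentiable (by norm_num) y).hasDerivAt) (hF1.continuous_deriv le_rfl)
  refine ⟨_, _, _, _, h.smul (-(2 * μ)), ?_⟩
  filter_upwards [e, hφf, ae_mem_measQ, Lp.coeFn_smul (-(2 * μ)) U] with p h1 h2 h3 h4
  have hp : p ∈ (univ ×ˢ Icc 0 1 : Set (UnitAddCircle × ℝ)) :=
    ⟨mem_univ _, Ioo_subset_Icc_self h3⟩
  rw [h4, Pi.smul_apply, h1, h2, hFlog _ (hmin hp), smul_eq_mul,
    show -(-(2 * μ) * Real.log (f p)) / (2 * μ) = Real.log (f p) by field_simp,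
    Real.exp_log (hpos p hp)]

/-! ### The solution sets -/

theorem classN_eq_iff {U W : sobolevN} : classN U = classN W ↔
    ∃ c : ℝ, (W : L2) =ᵐ[measQ] fun p => (U : L2) p + c := Quotient.eq (r := additiveSetoid)

theorem classNPos_eq_iff {φ ψ : sobolevNPos} : classNPos φ = classNPos ψ ↔
    ∃ η : ℝ, 0 < η ∧ (ψ : L2) = η • (φ : L2) := Quotient.eq (r := multiplicativeSetoid)

theorem hasDerivs_congr_classN {U W : sobolevN} (h : classN U = classN W) :
    HasDerivs (W : L2) (dt U) (dx U) (dx (dx U)) := by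
  obtain ⟨c, hc⟩ := classN_eq_iff.1 h
  exact (hasDerivs_of_mem_sobolevN U.2).congr_add_const hc

/-- Every representative of a pair in `S₂` solves the equation. -/
theorem isPotential_of_S2 {μ : ℝ} {v : L2} (s : S2 μ v) {W : sobolevN} (h : s.1.1 = classN W) :
    IsPotential μ v (dt W) (dx W) (dx (dx W)) s.1.2 := by
  obtain ⟨U, hU, hp⟩ := s.2
  have hd := hasDerivs_congr_classN (hU.trans h)
  rw [hd.dx_dx_eq, hd.dt_eq, hd.dx_eq]
  exact hp

theorem mem_S2 {μ K : ℝ} {v W a b c : L2} (h : HasDerivs W a b c) (hp : IsPotential μ v a b c K) :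
    (classN ⟨W, h.mem_sobolevN⟩, K) ∈ S2 μ v := by
  refine ⟨⟨W, h.mem_sobolevN⟩, rfl, ?_⟩
  rw [h.dx_dx_eq, h.dt_eq, h.dx_eq]
  exact hp

theorem exists_classN (x : NModConst) : ∃ W : sobolevN, x = classN W := by
  obtain ⟨W, hW⟩ := Quotient.exists_rep x
  exact ⟨W, hW.symm⟩

theorem exists_S2_of_S1 {μ : ℝ} {v : L2} (hv : v ∈ H) (w : S1 μ v) :
    ∃ (s : S2 μ v) (W : sobolevN), s.1.1 = classN W ∧ dx W = (w : L2) := by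
  obtain ⟨W, a, c, K, h, hp⟩ := exists_potential hv w.2
  exact ⟨⟨_, mem_S2 h hp⟩, ⟨W, h.mem_sobolevN⟩, rfl, h.dx_eq⟩

theorem S2_ext_of_dx {μ : ℝ} {v : L2} {s s' : S2 μ v} {W W' : sobolevN} (h : s.1.1 = classN W)
    (h' : s'.1.1 = classN W') (hdx : dx W = dx W') : s = s' := by
  have hd := hasDerivs_of_mem_sobolevN W.2
  have hd' := hasDerivs_of_mem_sobolevN W'.2
  have hp := isPotential_of_S2 s h
  have hp' := isPotential_of_S2 s' h'
  rw [← hdx] at hd' hp'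
  obtain ⟨hK, hc⟩ := potential_unique hd hd' hp hp'
  exact Subtype.ext (Prod.ext (by rw [h, h', classN_eq_iff]; exact hc) hK)

theorem dx_eq_of_classN {U W : sobolevN} (h : classN U = classN W) : dx W = dx U :=
  (hasDerivs_congr_classN h).dx_eq

/-- The map `([W], K) ↦ ([exp(-W/2μ)], K/2μ)` is well defined. -/
theorem exists_S3_of_S2 {μ : ℝ} (hμ : 0 < μ) {v : L2} (s : S2 μ v) : ∃ r : S3 μ v,
    ∀ W : sobolevN, s.1.1 = classN W → ∃ φ : sobolevNPos,
      (∀ᵐ p ∂measQ, (φ : L2) p = Real.exp (-(W : L2) p / (2 * μ))) ∧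
      r.1 = (classNPos φ, s.1.2 / (2 * μ)) := by
  obtain ⟨U, hU⟩ := exists_classN s.1.1
  have key : ∀ W : sobolevN, s.1.1 = classN W → ∃ φ : sobolevNPos,
      (∀ᵐ p ∂measQ, (φ : L2) p = Real.exp (-(W : L2) p / (2 * μ))) ∧
      IsHeatSol μ v φ (dt φ) (dx φ) (dx (dx φ)) (s.1.2 / (2 * μ)) := by
    intro W hW
    obtain ⟨φ, a, b, c, h, e, hpos, hiff⟩ := exists_exp hμ v s.1.2 (hasDerivs_of_mem_sobolevN W.2)
    refine ⟨⟨φ, hpos⟩, e, ?_⟩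
    rw [h.dx_dx_eq, h.dt_eq, h.dx_eq]
    exact hiff.2 (isPotential_of_S2 s hW)
  obtain ⟨φ, hφ, hsol⟩ := key U hU
  refine ⟨⟨(classNPos φ, s.1.2 / (2 * μ)), φ, rfl, hsol⟩, fun W hW => ?_⟩
  obtain ⟨ψ, hψ, -⟩ := key W hW
  refine ⟨ψ, hψ, ?_⟩
  obtain ⟨r, hr⟩ := classN_eq_iff.1 (hU.symm.trans hW)
  refine Prod.ext (classNPos_eq_iff.2 ⟨Real.exp (-r / (2 * μ)), Real.exp_pos _, ?_⟩) rfl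
  ext1
  filter_upwards [hφ, hψ, hr, Lp.coeFn_smul (Real.exp (-r / (2 * μ))) (φ : L2)] with p h1 h2 h3 h4
  rw [h4, Pi.smul_apply, h2, h1, h3, smul_eq_mul, ← Real.exp_add]
  congr 1; ring

theorem exists_S2_of_S3 {μ : ℝ} (hμ : 0 < μ) {v : L2} (r : S3 μ v) :
    ∃ (s : S2 μ v) (W : sobolevN) (φ : sobolevNPos), s.1.1 = classN W ∧
      (∀ᵐ p ∂measQ, (φ : L2) p = Real.exp (-(W : L2) p / (2 * μ))) ∧
      r.1 = (classNPos φ, s.1.2 / (2 * μ)) := by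
  obtain ⟨φ, hφ, hsol⟩ := r.2
  obtain ⟨W, a, b, c, h, e⟩ := exists_log hμ φ.2
  obtain ⟨ψ, a', b', c', h', e', -, hiff⟩ := exists_exp hμ v (2 * μ * r.1.2) h
  obtain rfl : ψ = φ := Lp.ext (e'.trans e.symm)
  have hK : 2 * μ * r.1.2 / (2 * μ) = r.1.2 := by field_simp
  rw [hK] at hiff
  have hp := hiff.1 (by rw [h'.dx_dx_eq, h'.dt_eq, h'.dx_eq] at hsol; exact hsol)
  exact ⟨⟨_, mem_S2 h hp⟩, ⟨W, h.mem_sobolevN⟩, φ, rfl, e, Prod.ext hφ.symm hK.symm⟩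

/-- The logarithm of a positive scalar factor is an additive constant. -/
theorem classN_eq_of_classNPos_eq {μ : ℝ} (hμ : 0 < μ) {W W' : sobolevN} {φ φ' : sobolevNPos}
    (h : ∀ᵐ p ∂measQ, (φ : L2) p = Real.exp (-(W : L2) p / (2 * μ)))
    (h' : ∀ᵐ p ∂measQ, (φ' : L2) p = Real.exp (-(W' : L2) p / (2 * μ)))
    (he : classNPos φ = classNPos φ') : classN W = classN W' := by
  obtain ⟨η, hη, e⟩ := classNPos_eq_iff.1 he
  refine classN_eq_iff.2 ⟨-(2 * μ) * Real.log η, ?_⟩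
  filter_upwards [h, h', Lp.coeFn_smul η (φ : L2)] with p h1 h2 h3
  rw [e, h3, Pi.smul_apply, h1, smul_eq_mul] at h2
  have h4 := congrArg Real.log h2
  rw [Real.log_mul hη.ne' (Real.exp_ne_zero _), Real.log_exp, Real.log_exp] at h4
  field_simp at h4
  linarith

end Burgers

end

theorem mainTheorem7 (μ : ℝ) (hμ : 0 < μ) (v : Burgers.L2) (hv : v ∈ Burgers.H) :
    -- the three solution sets have the same cardinality
    (Cardinal.mk (Burgers.S1 μ v) = Cardinal.mk (Burgers.S2 μ v) ∧
      Cardinal.mk (Burgers.S2 μ v) = Cardinal.mk (Burgers.S3 μ v)) ∧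
    -- the bijections, and the Cole-Hopf transformation
    ∃ (Φ₂₁ : Burgers.S1 μ v → Burgers.S2 μ v) (Φ₃₂ : Burgers.S2 μ v → Burgers.S3 μ v)
      (Φ : Burgers.S1 μ v → Burgers.S3 μ v),
      Function.Bijective Φ₂₁ ∧ Function.Bijective Φ₃₂ ∧ Function.Bijective Φ ∧
      Φ = Φ₃₂ ∘ Φ₂₁ ∧
      -- `Φ₂₁ w` is the pair `([W], K)` in `S₂` with `W_x = w`,
      -- and `W(t,x) = ∫₀ˣ w(t,y) dy - h(t)`
      (∀ (w : Burgers.S1 μ v) (W : Burgers.sobolevN),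
        (Φ₂₁ w).1.1 = Burgers.classN W →
          Burgers.dx W = (w : Burgers.L2) ∧
          ∃ h : UnitAddCircle → ℝ, MemLp h 2 volume ∧
            ∀ᵐ p ∂Burgers.measQ,
              (W : Burgers.L2) p = (∫ y in (0 : ℝ)..p.2, (w : Burgers.L2) (p.1, y)) - h p.1) ∧
      -- the inverse of `Φ₂₁` is `([W], K) ↦ W_x`
      (∀ (s : Burgers.S2 μ v) (W : Burgers.sobolevN) (w : Burgers.S1 μ v),
        s.1.1 = Burgers.classN W → Burgers.dx W = (w : Burgers.L2) → Φ₂₁ w = s) ∧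
      -- `Φ₃₂ ([W], K) = ([exp (-W / 2μ)], K / 2μ)`
      (∀ (s : Burgers.S2 μ v) (W : Burgers.sobolevN),
        s.1.1 = Burgers.classN W →
          ∃ φ : Burgers.sobolevNPos,
            (∀ᵐ p ∂Burgers.measQ,
              (φ : Burgers.L2) p = Real.exp (-(W : Burgers.L2) p / (2 * μ))) ∧
            (Φ₃₂ s).1 = (Burgers.classNPos φ, s.1.2 / (2 * μ))) := by
  classical
  choose Φ₂₁ hΦ₂₁ using fun w : Burgers.S1 μ v => Burgers.exists_S2_of_S1 hv w
  choose Φ₃₂ hΦ₃₂ using fun s : Burgers.S2 μ v => Burgers.exists_S3_of_S2 hμ s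
  have hdx : ∀ (w : Burgers.S1 μ v) (W : Burgers.sobolevN),
      (Φ₂₁ w).1.1 = Burgers.classN W → Burgers.dx W = (w : Burgers.L2) := by
    intro w W hW
    obtain ⟨U, hU, e⟩ := hΦ₂₁ w
    rw [Burgers.dx_eq_of_classN (hU.symm.trans hW), e]
  have hinv : ∀ (s : Burgers.S2 μ v) (W : Burgers.sobolevN) (w : Burgers.S1 μ v),
      s.1.1 = Burgers.classN W → Burgers.dx W = (w : Burgers.L2) → Φ₂₁ w = s := by
    intro s W w hs e
    obtain ⟨U, hU, e'⟩ := hΦ₂₁ w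
    exact Burgers.S2_ext_of_dx hU hs (e'.trans e.symm)
  have hb₁ : Function.Bijective Φ₂₁ := by
    constructor
    · intro w w' h
      obtain ⟨U, hU, e⟩ := hΦ₂₁ w
      exact Subtype.ext (e.symm.trans (hdx w' U (h ▸ hU)))
    · intro s
      obtain ⟨W, hW⟩ := Burgers.exists_classN s.1.1
      exact ⟨⟨Burgers.dx W, Burgers.mem_S1_of_isPotential hv
        (Burgers.hasDerivs_of_mem_sobolevN W.2) (Burgers.isPotential_of_S2 s hW)⟩,
        hinv s W _ hW rfl⟩
  have hb₂ : Function.Bijective Φ₃₂ := by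
    have hμ2 : 2 * μ ≠ 0 := by positivity
    -- a pair in `S₂` is recovered from its image
    have hrec : ∀ (s s' : Burgers.S2 μ v) (W' : Burgers.sobolevN) (φ' : Burgers.sobolevNPos),
        s'.1.1 = Burgers.classN W' →
        (∀ᵐ p ∂Burgers.measQ, (φ' : Burgers.L2) p = Real.exp (-(W' : Burgers.L2) p / (2 * μ))) →
        (Φ₃₂ s).1 = (Burgers.classNPos φ', s'.1.2 / (2 * μ)) → s = s' := by
      intro s s' W' φ' hs' hφ' e
      obtain ⟨W, hW⟩ := Burgers.exists_classN s.1.1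
      obtain ⟨φ, hφ, e1⟩ := hΦ₃₂ s W hW
      rw [e1, Prod.mk.injEq] at e
      refine Subtype.ext (Prod.ext ?_ ((div_left_inj' hμ2).1 e.2))
      rw [hW, hs']
      exact Burgers.classN_eq_of_classNPos_eq hμ hφ hφ' e.1
    constructor
    · intro s s' h
      obtain ⟨W', hW'⟩ := Burgers.exists_classN s'.1.1
      obtain ⟨φ', hφ', e⟩ := hΦ₃₂ s' W' hW'
      exact hrec s s' W' φ' hW' hφ' (h ▸ e)
    · intro r
      obtain ⟨s, W, φ, hs, hφ, hr⟩ := Burgers.exists_S2_of_S3 hμ r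
      obtain ⟨ψ, hψ, e⟩ := hΦ₃₂ s W hs
      refine ⟨s, Subtype.ext ?_⟩
      rw [e, hr, show ψ = φ from Subtype.ext (Lp.ext (by
        filter_upwards [hφ, hψ] with p h1 h2
        rw [h1, h2]))]
  refine ⟨⟨Cardinal.mk_congr (Equiv.ofBijective _ hb₁),
    Cardinal.mk_congr (Equiv.ofBijective _ hb₂)⟩,
    Φ₂₁, Φ₃₂, Φ₃₂ ∘ Φ₂₁, hb₁, hb₂, hb₂.comp hb₁, rfl, fun w W hW => ⟨hdx w W hW, ?_⟩, hinv, hΦ₃₂⟩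
  have hd := Burgers.hasDerivs_of_mem_sobolevN W.2
  have hc := Burgers.continuous_contRep hd
  rw [hdx w W hW] at hd
  refine ⟨fun t => -Burgers.contRep W (t, 0), ?_, hd.ae_eq_primitive⟩
  have hc' : Continuous fun t : UnitAddCircle => -Burgers.contRep W (t, 0) := by fun_prop
  obtain ⟨C, hC⟩ := isCompact_univ.exists_bound_of_continuousOn hc'.continuousOn
  exact MemLp.of_bound hc'.aestronglyMeasurable C (.of_forall fun t => hC t (mem_univ t))
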